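/- **Theorem.** A finite simple graph $G$ is distance-hereditary if and only if it is $\Delta$-confluent. Here $G$ is *distance-hereditary* if it is connected and every induced path of $G$ is isometric, i.e. the distance along the path of any two vertices of an induced path equals their distance in $G$. A *locally-monotone curve* from $p$ to $q$ is a curve in $\mathbb{R}^2$ without self-intersections that has one-sided tangent rays at all its points, and whose left and right tangent rays at every interior point form an angle of more than $90^\circ$ (it makes no sharp turn). A *$\Delta$-junction* has three distinct points, its *ports*, and any two of them are connected by a locally-monotone arc. A *$\Lambda$-junction* has three ports as well, one called its *head* and the others its *tails*; only the head is connected to each tail by a locally-monotone arc, and no locally-monotone curve within the junction connects the two tails. In either case no arc contains the third port, and the arcs do not cross: two of them may overlap in a common portion starting at their common port, and do not meet again once they have separated. A *$\Delta$-confluent drawing* of $G$ consists of distinct points of the plane for the vertices of $G$, finitely many $\Delta$- and $\Lambda$-junctions, and finitely many locally-monotone *tracks*, each with its two ends at vertices or ports, such that * every port is the end of exactly one track, and the track continues there into the arcs of the junction without a sharp turn; * the drawing is planar: distinct vertices, junctions and tracks meet only in vertices or ports that they share as ends of tracks; * replacing every junction with a new vertex (and every track with an edge) gives a tree; * two vertices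 are adjacent in $G$ if and only if some locally-monotone curve contained in the drawing connects them and passes through no other vertex. $G$ is *$\Delta$-confluent* if it has a $\Delta$-confluent drawing. -/

import Mathlib

open Set Filter Topology

/-! ### Distance-hereditary graphs -/

/-- A graph is distance-hereditary if it is connected and every induced path is isometric: the
distance along the path of any two of its vertices is their distance in the graph. -/
def IsDistanceHereditary {V : Type*} (G : SimpleGraph V) : Prop :=
  G.Connected ∧ ∀ (n : ℕ) (f : SimpleGraph.pathGraph n ↪g G) (i j : Fin n),
    (SimpleGraph.pathGraph n).dist i j = G.dist (f i) (f j)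

/-! ### Locally-monotone curves

A curve is a map `ℝ → Plane`, of which only the restriction to `[0, 1]` matters. -/

/-- The plane with its Euclidean metric. -/
abbrev Plane : Type := EuclideanSpace ℝ (Fin 2)

/-- The point set of a curve. -/
def trace (γ : ℝ → Plane) : Set Plane := γ '' Icc 0 1

/-- `d` is the unit direction of the right tangent ray of `γ` at `γ t`: the limit of the
directions from `γ t` to the points that follow it.  (Independent of the parametrization.) -/
def HasRightTangent (γ : ℝ → Plane) (t : ℝ) (d : Plane) : Prop :=
  Tendsto (fun s => ‖γ s - γ t‖⁻¹ • (γ s - γ t)) (𝓝[>] t) (𝓝 d)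

/-- `d` is the unit direction of the left tangent ray of `γ` at `γ t`: the limit of the
directions from `γ t` to the points that precede it. -/
def HasLeftTangent (γ : ℝ → Plane) (t : ℝ) (d : Plane) : Prop :=
  Tendsto (fun s => ‖γ s - γ t‖⁻¹ • (γ s - γ t)) (𝓝[<] t) (𝓝 d)

/-- Two rays with the same origin and directions `d`, `d'` form an angle of more than 90 degrees,
so that a curve that arrives along one of them and goes on along the other makes no sharp turn. -/
def NoSharpTurn (d d' : Plane) : Prop :=
  Real.pi / 2 < InnerProductGeometry.angle d d'

/-- `γ` is a locally-monotone curve from `p` to `q`: it has no self-intersections, it has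
one-sided tangents at all of its points, and it makes no sharp turns. -/
structure IsLocallyMonotone (γ : ℝ → Plane) (p q : Plane) : Prop where
  source : γ 0 = p
  target : γ 1 = q
  continuousOn : ContinuousOn γ (Icc 0 1)
  injOn : InjOn γ (Icc 0 1)
  tangent_source : ∃ d, HasRightTangent γ 0 d
  tangent_target : ∃ d, HasLeftTangent γ 1 d
  no_sharp_turn : ∀ t ∈ Ioo (0 : ℝ) 1,
    ∃ l r, HasLeftTangent γ t l ∧ HasRightTangent γ t r ∧ NoSharpTurn l r

/-- The point `x` is an end of the curve `γ`, and `d` is the tangent direction in which the curve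
leaves `x`. -/
def LeavesAlong (γ : ℝ → Plane) (x d : Plane) : Prop :=
  (γ 0 = x ∧ HasRightTangent γ 0 d) ∨ (γ 1 = x ∧ HasLeftTangent γ 1 d)

/-! ### Junctions -/

/-- The two kinds of junctions: `Δ` and `Λ`. -/
inductive JunctionKind where
  | delta
  | lambda

/-- The pairs `i < k` of ports that are connected inside a junction.  In a `Δ`-junction these are
all three pairs; in a `Λ`-junction the head (port `0`) is connected to both tails
(ports `1` and `2`). -/
def JunctionKind.Joins : JunctionKind → Fin 3 → Fin 3 → Prop
  | .delta, i, k => i < k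
  | .lambda, i, k => i = 0 ∧ i < k

/-- The point set formed by the arcs between the connected pairs of ports. -/
def arcsUnion (kind : JunctionKind) (arc : Fin 3 → Fin 3 → ℝ → Plane) : Set Plane :=
  {x | ∃ i k, kind.Joins i k ∧ x ∈ trace (arc i k)}

/-- A `Δ`- or `Λ`-junction drawn in the plane: three ports, and a locally-monotone arc between any
two ports that are connected.  (`arc i k` matters only if `kind.Joins i k`.) -/
structure Junction where
  kind : JunctionKind
  port : Fin 3 → Plane
  arc : Fin 3 → Fin 3 → ℝ → Plane
  port_injective : Function.Injective port
  arc_locallyMonotone : ∀ i k, kind.Joins i k → IsLocallyMonotone (arc i k) (port i) (port k)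
  /-- An arc does not run through the third port. -/
  port_mem_arc : ∀ i k l, kind.Joins i k → port l ∈ trace (arc i k) → l = i ∨ l = k
  /-- Arcs do not cross: two distinct arcs, which have one port in common, may overlap in a common
  portion that starts at this port, and once separated they do not meet again. -/
  arc_inter : ∀ i k i' k', kind.Joins i k → kind.Joins i' k' →
    IsPreconnected (trace (arc i k) ∩ trace (arc i' k'))
  /-- The two tails of a `Λ`-junction are disconnected from each other. -/
  tails_disconnected : kind = .lambda →
    ¬ ∃ γ, IsLocallyMonotone γ (port 1) (port 2) ∧ trace γ ⊆ arcsUnion kind arc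

/-- The point set of a junction. -/
def Junction.region (j : Junction) : Set Plane := arcsUnion j.kind j.arc

/-! ### Drawings made of vertices, junctions and tracks -/

/-- The points at which a track can end: the vertices in `V`, and the three ports of each of the
junctions in `J`. -/
abbrev Terminal (V J : Type*) : Type _ := V ⊕ (J × Fin 3)

/-- The vertex, or the junction, that a terminal belongs to. -/
def Terminal.node {V J : Type*} : Terminal V J → V ⊕ J := Sum.map id Prod.fst

/-- The data of a drawing: points for the vertices in `V`, junctions indexed by `J`, and tracks
indexed by `E`, where the track `e` goes from the terminal `src e` to the terminal `tgt e`. -/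
structure Drawing (V J E : Type*) where
  vertexPos : V → Plane
  junction : J → Junction
  src : E → Terminal V J
  tgt : E → Terminal V J
  track : E → ℝ → Plane

namespace Drawing

variable {V J E : Type*}

/-- The point of a terminal. -/
def pos (A : Drawing V J E) : Terminal V J → Plane :=
  Sum.elim A.vertexPos fun x => (A.junction x.1).port x.2

/-- The terminal `t` is one of the two ends of the track `e`. -/
def IsEnd (A : Drawing V J E) (e : E) (t : Terminal V J) : Prop := A.src e = t ∨ A.tgt e = t

/-- The point set of the drawing. -/
def carrier (A : Drawing V J E) : Set Plane :=
  range A.vertexPos ∪ (⋃ j, (A.junction j).region) ∪ ⋃ e, trace (A.track e)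

/-- The pair of nodes (vertices or junctions) joined by a track. -/
def nodes (A : Drawing V J E) (e : E) : Sym2 (V ⊕ J) :=
  s((A.src e).node, (A.tgt e).node)

/-- The graph obtained from the drawing by replacing every junction with a new vertex. -/
def underlying (A : Drawing V J E) : SimpleGraph (V ⊕ J) :=
  SimpleGraph.fromEdgeSet (range A.nodes)

/-- The drawing is well-formed: its tracks are locally-monotone curves that run smoothly into the
junctions, with one track at every port, and any two of its parts (vertices, junctions, tracks)
meet only in the terminals that they share, so that the drawing is planar. -/
structure IsPlanar (A : Drawing V J E) : Prop where
  track_locallyMonotone : ∀ e, IsLocallyMonotone (A.track e) (A.pos (A.src e)) (A.pos (A.tgt e))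
  port_track : ∀ j i, ∃! e, A.IsEnd e (.inr (j, i))
  /-- A track that ends at a port continues into the arcs at this port without a sharp turn. -/
  port_smooth : ∀ e j i k l d d', (A.junction j).kind.Joins k l →
    LeavesAlong (A.track e) ((A.junction j).port i) d →
    LeavesAlong ((A.junction j).arc k l) ((A.junction j).port i) d' → NoSharpTurn d d'
  vertex_vertex : Function.Injective A.vertexPos
  vertex_junction : ∀ v j, A.vertexPos v ∉ (A.junction j).region
  vertex_track : ∀ v e, A.vertexPos v ∈ trace (A.track e) → A.IsEnd e (.inl v)
  junction_junction : ∀ j j', j ≠ j' → Disjoint (A.junction j).region (A.junction j').region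
  track_junction : ∀ e j, ∀ x ∈ trace (A.track e) ∩ (A.junction j).region,
    ∃ i, A.IsEnd e (.inr (j, i)) ∧ x = (A.junction j).port i
  track_track : ∀ e e', e ≠ e' → ∀ x ∈ trace (A.track e) ∩ trace (A.track e'),
    ∃ t, A.IsEnd e t ∧ A.IsEnd e' t ∧ x = A.pos t

/-- Replacing every junction with a new vertex gives a tree; in particular there are no loops and
no two parallel tracks. -/
structure IsTreeLike (A : Drawing V J E) : Prop where
  no_loop : ∀ e, ¬ (A.nodes e).IsDiag
  no_parallel : Function.Injective A.nodes
  isTree : A.underlying.IsTree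

/-- The drawing represents `G`: two vertices are adjacent if and only if they are connected by a
locally-monotone curve in the drawing, which runs through no other vertex. -/
def Represents (A : Drawing V J E) (G : SimpleGraph V) : Prop :=
  ∀ u v, G.Adj u v ↔ ∃ γ, IsLocallyMonotone γ (A.vertexPos u) (A.vertexPos v) ∧
    trace γ ⊆ A.carrier ∧ ∀ w, A.vertexPos w ∈ trace γ → w = u ∨ w = v

end Drawing

/-- A graph is `Δ`-confluent if it has a `Δ`-confluent drawing: a planar confluent drawing with
finitely many junctions, all of them `Δ`- or `Λ`-junctions, and finitely many tracks, which becomes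
a tree when every junction is replaced with a new vertex. -/
def IsDeltaConfluent {V : Type*} (G : SimpleGraph V) : Prop :=
  ∃ (J E : Type) (_ : Finite J) (_ : Finite E) (A : Drawing V J E),
    A.IsPlanar ∧ A.IsTreeLike ∧ A.Represents G

/-!
# Distance-hereditary graphs are the `Δ`-confluent graphs

*From curves to routes.* In a planar drawing that is a tree, every track `e` cuts the drawing in two
closed parts that meet only in an end of `e`. An injective curve passes a cut point at most once, so
a locally-monotone curve between two vertices that runs through no other vertex has no choice: it
follows the unique sequence of tracks in the tree, and passes from port to port inside the
junctions. In a `Λ`-junction it cannot pass from tail to tail, since the piece between the tails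
would be a locally-monotone curve within the junction. Conversely such a sequence of tracks, a
*route*, is drawn by a locally-monotone curve, obtained by concatenation. Hence the drawing
represents `G` if and only if adjacency in `G` is the existence of a route
(`Drawing.represents_iff`), which is a combinatorial condition on the tree.

*Confluent graphs are distance-hereditary.* Two routes through the same track can exchange their
continuations, so between the two sides of a track the adjacency is complete between those vertices
that have a neighbour on the other side. Therefore every set `S` of at least two vertices contains
two twins of the induced subgraph, or a vertex with at most one neighbour in it: look at a lowest
branching of the tree with respect to `S` (`Drawing.exists_pruningPair_of_route`). The retraction
that folds one vertex of such a *pruning pair* onto the other maps walks to walks, and an induction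
over `S` shows that induced paths are no longer than any walk between their ends
(`SimpleGraph.IsInducedPath.le_of_pruning`). Connectedness follows by an induction over the tree:
beyond every track there is a vertex to which a route leads.

*Distance-hereditary graphs are confluent.* A distance-hereditary graph with at least two vertices
contains two twins or a pendant vertex (`IsDistanceHereditary.exists_pruningPair`). This is seen in
the last level of the distances from a fixed vertex: a component of this level, or a minimal
neighbourhood of one of its vertices, is a module, it contains no induced path on four vertices, and
hence it contains twins. Removing one vertex `x` of the pair leaves a distance-hereditary graph,
which has a drawing by induction, with straight tracks and all vertices as leaves. There the other
vertex `y` is replaced with a small triangular junction with two new leaves for `x` and `y`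
(`Drawing.graft`): a `Δ`-junction if they are adjacent twins, a `Λ`-junction with its head on the
side of the old drawing if they are non-adjacent twins, and a `Λ`-junction with its head on the side
of `y` if `x` is pendant at `y`. The triangle is acute, so that
tracks can enter its corners without a sharp turn, while the turn from one tail to the other at the
head of a `Λ`-junction is sharp.
-/

/-! ### Operations on locally-monotone curves -/

theorem NoSharpTurn.symm {d d' : Plane} (h : NoSharpTurn d d') : NoSharpTurn d' d := by
  rwa [NoSharpTurn, InnerProductGeometry.angle_comm]

/-- One-sided tangents survive a reparametrization `φ`. The filters `l` and `l'` are one-sided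
neighbourhoods, so this covers all four combinations of left and right tangents. -/
theorem tendsto_direction_reparam {γ γ' : ℝ → Plane} {φ : ℝ → ℝ} {t : ℝ} {d : Plane}
    {l l' : Filter ℝ}
    (h : Tendsto (fun s => ‖γ s - γ (φ t)‖⁻¹ • (γ s - γ (φ t))) l' (𝓝 d))
    (hφ : Tendsto φ l l') (he : ∀ᶠ s in l, γ' s = γ (φ s)) (h0 : γ' t = γ (φ t)) :
    Tendsto (fun s => ‖γ' s - γ' t‖⁻¹ • (γ' s - γ' t)) l (𝓝 d) := by
  refine (h.comp hφ).congr' ?_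
  filter_upwards [he] with s hs
  simp [hs, h0]

theorem tendsto_affine_nhdsGT {a b : ℝ} (hb : 0 < b) (t : ℝ) :
    Tendsto (fun s => a + b * s) (𝓝[>] t) (𝓝[>] (a + b * t)) := by
  refine tendsto_nhdsWithin_iff.2 ⟨?_, ?_⟩
  · exact ((by fun_prop : Continuous fun s : ℝ => a + b * s).tendsto t).mono_left
      nhdsWithin_le_nhds
  · filter_upwards [self_mem_nhdsWithin] with s (hs : t < s)
    exact add_lt_add_right (mul_lt_mul_of_pos_left hs hb) a

theorem tendsto_affine_nhdsLT {a b : ℝ} (hb : 0 < b) (t : ℝ) :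
    Tendsto (fun s => a + b * s) (𝓝[<] t) (𝓝[<] (a + b * t)) := by
  refine tendsto_nhdsWithin_iff.2 ⟨?_, ?_⟩
  · exact ((by fun_prop : Continuous fun s : ℝ => a + b * s).tendsto t).mono_left
      nhdsWithin_le_nhds
  · filter_upwards [self_mem_nhdsWithin] with s (hs : s < t)
    exact add_lt_add_right (mul_lt_mul_of_pos_left hs hb) a

theorem tendsto_one_sub_nhdsGT (t : ℝ) : Tendsto (fun s => 1 - s) (𝓝[>] t) (𝓝[<] (1 - t)) := by
  refine tendsto_nhdsWithin_iff.2 ⟨?_, ?_⟩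
  · exact ((by fun_prop : Continuous fun s : ℝ => 1 - s).tendsto t).mono_left nhdsWithin_le_nhds
  · filter_upwards [self_mem_nhdsWithin] with s (hs : t < s)
    exact sub_lt_sub_left hs 1

theorem tendsto_one_sub_nhdsLT (t : ℝ) : Tendsto (fun s => 1 - s) (𝓝[<] t) (𝓝[>] (1 - t)) := by
  refine tendsto_nhdsWithin_iff.2 ⟨?_, ?_⟩
  · exact ((by fun_prop : Continuous fun s : ℝ => 1 - s).tendsto t).mono_left nhdsWithin_le_nhds
  · filter_upwards [self_mem_nhdsWithin] with s (hs : s < t)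
    exact sub_lt_sub_left hs 1

theorem HasLeftTangent.reverse {γ : ℝ → Plane} {t : ℝ} {d : Plane}
    (h : HasLeftTangent γ (1 - t) d) : HasRightTangent (fun s => γ (1 - s)) t d :=
  tendsto_direction_reparam (φ := fun s => 1 - s) h (tendsto_one_sub_nhdsGT t)
    (Eventually.of_forall fun _ => rfl) rfl

theorem HasRightTangent.reverse {γ : ℝ → Plane} {t : ℝ} {d : Plane}
    (h : HasRightTangent γ (1 - t) d) : HasLeftTangent (fun s => γ (1 - s)) t d :=
  tendsto_direction_reparam (φ := fun s => 1 - s) h (tendsto_one_sub_nhdsLT t)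
    (Eventually.of_forall fun _ => rfl) rfl

theorem HasRightTangent.unique {γ : ℝ → Plane} {t : ℝ} {d d' : Plane}
    (h : HasRightTangent γ t d) (h' : HasRightTangent γ t d') : d = d' :=
  tendsto_nhds_unique h h'

theorem HasLeftTangent.unique {γ : ℝ → Plane} {t : ℝ} {d d' : Plane}
    (h : HasLeftTangent γ t d) (h' : HasLeftTangent γ t d') : d = d' :=
  tendsto_nhds_unique h h'

theorem trace_reverse (γ : ℝ → Plane) : trace (fun s => γ (1 - s)) = trace γ := by
  ext x
  constructor
  · rintro ⟨t, ⟨h0, h1⟩, rfl⟩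
    exact ⟨1 - t, ⟨by linarith, by linarith⟩, rfl⟩
  · rintro ⟨t, ⟨h0, h1⟩, rfl⟩
    exact ⟨1 - t, ⟨by linarith, by linarith⟩, by simp⟩

theorem IsLocallyMonotone.source_mem {γ : ℝ → Plane} {p q : Plane} (h : IsLocallyMonotone γ p q) :
    p ∈ trace γ := ⟨0, by simp, h.source⟩

theorem IsLocallyMonotone.target_mem {γ : ℝ → Plane} {p q : Plane} (h : IsLocallyMonotone γ p q) :
    q ∈ trace γ := ⟨1, by simp, h.target⟩

theorem IsLocallyMonotone.ne {γ : ℝ → Plane} {p q : Plane} (h : IsLocallyMonotone γ p q) :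
    p ≠ q := by
  rw [← h.source, ← h.target]
  intro h'
  exact zero_ne_one (h.injOn (by simp) (by simp) h')

theorem IsLocallyMonotone.isCompact {γ : ℝ → Plane} {p q : Plane}
    (h : IsLocallyMonotone γ p q) : IsCompact (trace γ) :=
  isCompact_Icc.image_of_continuousOn h.continuousOn

theorem IsLocallyMonotone.reverse {γ : ℝ → Plane} {p q : Plane} (h : IsLocallyMonotone γ p q) :
    IsLocallyMonotone (fun s => γ (1 - s)) q p where
  source := by simp [h.target]
  target := by simp [h.source]
  continuousOn := h.continuousOn.comp (by fun_prop) fun s hs =>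
    ⟨by linarith [hs.2], by linarith [hs.1]⟩
  injOn s hs t ht hst := by
    have := h.injOn (⟨by linarith [hs.2], by linarith [hs.1]⟩ : 1 - s ∈ Icc (0 : ℝ) 1)
      (⟨by linarith [ht.2], by linarith [ht.1]⟩ : 1 - t ∈ Icc (0 : ℝ) 1) hst
    linarith
  tangent_source := by
    obtain ⟨d, hd⟩ := h.tangent_target
    exact ⟨d, HasLeftTangent.reverse (by simpa using hd)⟩
  tangent_target := by
    obtain ⟨d, hd⟩ := h.tangent_source
    exact ⟨d, HasRightTangent.reverse (by simpa using hd)⟩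
  no_sharp_turn t ht := by
    obtain ⟨l, r, hl, hr, hlr⟩ := h.no_sharp_turn (1 - t) ⟨by linarith [ht.2], by linarith [ht.1]⟩
    exact ⟨r, l, hr.reverse, hl.reverse, hlr.symm⟩

theorem IsLocallyMonotone.exists_right {γ : ℝ → Plane} {p q : Plane}
    (h : IsLocallyMonotone γ p q) {t : ℝ} (ht : t ∈ Ico (0 : ℝ) 1) :
    ∃ d, HasRightTangent γ t d := by
  rcases ht.1.eq_or_lt with rfl | h0
  · exact h.tangent_source
  · obtain ⟨l, r, hl, hr, _⟩ := h.no_sharp_turn t ⟨h0, ht.2⟩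
    exact ⟨r, hr⟩

theorem IsLocallyMonotone.exists_left {γ : ℝ → Plane} {p q : Plane}
    (h : IsLocallyMonotone γ p q) {t : ℝ} (ht : t ∈ Ioc (0 : ℝ) 1) :
    ∃ d, HasLeftTangent γ t d := by
  rcases ht.2.eq_or_lt with rfl | h1
  · exact h.tangent_target
  · obtain ⟨l, r, hl, hr, _⟩ := h.no_sharp_turn t ⟨ht.1, h1⟩
    exact ⟨l, hl⟩

/-- A piece of a locally-monotone curve is a locally-monotone curve. -/
theorem IsLocallyMonotone.restrict {γ : ℝ → Plane} {p q : Plane} (h : IsLocallyMonotone γ p q)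
    {a b : ℝ} (ha : 0 ≤ a) (hab : a < b) (hb : b ≤ 1) :
    IsLocallyMonotone (fun s => γ (a + (b - a) * s)) (γ a) (γ b) := by
  have hba : 0 < b - a := by linarith
  have hmem : ∀ s ∈ Icc (0 : ℝ) 1, a + (b - a) * s ∈ Icc (0 : ℝ) 1 := fun s hs =>
    ⟨by nlinarith [hs.1], by nlinarith [hs.2]⟩
  refine ⟨by simp, by simp, h.continuousOn.comp (by fun_prop) hmem, ?_, ?_, ?_, ?_⟩
  · intro s hs t ht hst
    have := h.injOn (hmem s hs) (hmem t ht) hst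
    exact mul_left_cancel₀ hba.ne' (add_left_cancel this)
  · obtain ⟨d, hd⟩ := h.exists_right (t := a + (b - a) * 0)
      ⟨by linarith, by linarith⟩
    exact ⟨d, tendsto_direction_reparam (φ := fun s => a + (b - a) * s) hd
      (tendsto_affine_nhdsGT hba 0) (Eventually.of_forall fun _ => rfl) rfl⟩
  · obtain ⟨d, hd⟩ := h.exists_left (t := a + (b - a) * 1)
      ⟨by linarith, by linarith⟩
    exact ⟨d, tendsto_direction_reparam (φ := fun s => a + (b - a) * s) hd
      (tendsto_affine_nhdsLT hba 1) (Eventually.of_forall fun _ => rfl) rfl⟩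
  · intro t ht
    obtain ⟨l, r, hl, hr, hlr⟩ := h.no_sharp_turn (a + (b - a) * t)
      ⟨by nlinarith [ht.1], by nlinarith [ht.2]⟩
    exact ⟨l, r, tendsto_direction_reparam (φ := fun s => a + (b - a) * s) hl
      (tendsto_affine_nhdsLT hba t) (Eventually.of_forall fun _ => rfl) rfl,
      tendsto_direction_reparam (φ := fun s => a + (b - a) * s) hr
      (tendsto_affine_nhdsGT hba t) (Eventually.of_forall fun _ => rfl) rfl, hlr⟩

/-- The concatenation of two curves, each run through at double speed. -/
noncomputable def concatCurve (γ₁ γ₂ : ℝ → Plane) (t : ℝ) : Plane :=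
  if t ≤ 1 / 2 then γ₁ (2 * t) else γ₂ (2 * t - 1)

theorem concat_of_le {γ₁ γ₂ : ℝ → Plane} {t : ℝ} (h : t ≤ 1 / 2) :
    concatCurve γ₁ γ₂ t = γ₁ (0 + 2 * t) := by rw [concatCurve, if_pos h, zero_add]

theorem concat_of_ge {γ₁ γ₂ : ℝ → Plane} {t : ℝ} (h01 : γ₁ 1 = γ₂ 0) (h : 1 / 2 ≤ t) :
    concatCurve γ₁ γ₂ t = γ₂ (-1 + 2 * t) := by
  rcases h.eq_or_lt with rfl | h
  · rw [concat_of_le le_rfl]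
    convert h01 using 2 <;> norm_num
  · rw [concatCurve, if_neg (not_le.2 h)]
    ring_nf

theorem trace_concat {γ₁ γ₂ : ℝ → Plane} (h01 : γ₁ 1 = γ₂ 0) :
    trace (concatCurve γ₁ γ₂) = trace γ₁ ∪ trace γ₂ := by
  ext x
  constructor
  · rintro ⟨t, ht, rfl⟩
    rcases le_total t (1 / 2) with h | h
    · exact Or.inl ⟨_, ⟨by linarith [ht.1], by linarith⟩, (concat_of_le h).symm⟩
    · exact Or.inr ⟨_, ⟨by linarith [ht.1], by linarith [ht.2]⟩, (concat_of_ge h01 h).symm⟩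
  · rintro (⟨t, ht, rfl⟩ | ⟨t, ht, rfl⟩)
    · refine ⟨t / 2, ⟨by linarith [ht.1], by linarith [ht.2]⟩, ?_⟩
      rw [concat_of_le (by linarith [ht.2])]
      ring_nf
    · refine ⟨(t + 1) / 2, ⟨by linarith [ht.1], by linarith [ht.2]⟩, ?_⟩
      rw [concat_of_ge h01 (by linarith [ht.1])]
      ring_nf

theorem concat_left_tangent_of_gt {γ₁ γ₂ : ℝ → Plane} {t : ℝ} {d : Plane} (h01 : γ₁ 1 = γ₂ 0)
    (ht : 1 / 2 < t) (h : HasLeftTangent γ₂ (-1 + 2 * t) d) :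
    HasLeftTangent (concatCurve γ₁ γ₂) t d := by
  refine tendsto_direction_reparam (φ := fun s => -1 + 2 * s) h
    (tendsto_affine_nhdsLT two_pos t) ?_ (concat_of_ge h01 ht.le)
  filter_upwards [nhdsWithin_le_nhds (lt_mem_nhds ht)] with s hs
  exact concat_of_ge h01 (le_of_lt hs)

theorem concat_right_tangent_of_ge {γ₁ γ₂ : ℝ → Plane} {t : ℝ} {d : Plane} (h01 : γ₁ 1 = γ₂ 0)
    (ht : 1 / 2 ≤ t) (h : HasRightTangent γ₂ (-1 + 2 * t) d) :
    HasRightTangent (concatCurve γ₁ γ₂) t d := by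
  refine tendsto_direction_reparam (φ := fun s => -1 + 2 * s) h
    (tendsto_affine_nhdsGT two_pos t) ?_ (concat_of_ge h01 ht)
  filter_upwards [self_mem_nhdsWithin] with s (hs : t < s)
  exact concat_of_ge h01 (by linarith)

theorem concat_left_tangent_of_le {γ₁ γ₂ : ℝ → Plane} {t : ℝ} {d : Plane}
    (ht : t ≤ 1 / 2) (h : HasLeftTangent γ₁ (0 + 2 * t) d) :
    HasLeftTangent (concatCurve γ₁ γ₂) t d := by
  refine tendsto_direction_reparam (φ := fun s => 0 + 2 * s) h
    (tendsto_affine_nhdsLT two_pos t) ?_ (concat_of_le ht)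
  filter_upwards [self_mem_nhdsWithin] with s (hs : s < t)
  exact concat_of_le (by linarith)

theorem concat_right_tangent_of_lt {γ₁ γ₂ : ℝ → Plane} {t : ℝ} {d : Plane}
    (ht : t < 1 / 2) (h : HasRightTangent γ₁ (0 + 2 * t) d) :
    HasRightTangent (concatCurve γ₁ γ₂) t d := by
  refine tendsto_direction_reparam (φ := fun s => 0 + 2 * s) h
    (tendsto_affine_nhdsGT two_pos t) ?_ (concat_of_le ht.le)
  filter_upwards [nhdsWithin_le_nhds (gt_mem_nhds ht)] with s hs
  exact concat_of_le (le_of_lt hs)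

/-- Two locally-monotone curves that meet only where the second one continues the first one, and
do so without a sharp turn, form a locally-monotone curve. -/
theorem IsLocallyMonotone.concat {γ₁ γ₂ : ℝ → Plane} {p q r dl dr : Plane}
    (h₁ : IsLocallyMonotone γ₁ p q) (h₂ : IsLocallyMonotone γ₂ q r)
    (hint : trace γ₁ ∩ trace γ₂ ⊆ {q})
    (hl : HasLeftTangent γ₁ 1 dl) (hr : HasRightTangent γ₂ 0 dr) (hd : NoSharpTurn dl dr) :
    IsLocallyMonotone (concatCurve γ₁ γ₂) p r := by
  have h01 : γ₁ 1 = γ₂ 0 := by rw [h₁.target, h₂.source]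
  -- A parameter value on the second half whose point lies on `γ₁` can only be `1 / 2`.
  have hmix : ∀ s ∈ Icc (0 : ℝ) 1, ∀ t ∈ Icc (0 : ℝ) 1, s ≤ 1 / 2 → 1 / 2 ≤ t →
      concatCurve γ₁ γ₂ s = concatCurve γ₁ γ₂ t → s = t := by
    intro s hs t ht hs2 ht2 hst
    rw [concat_of_le hs2, concat_of_ge h01 ht2] at hst
    have hs' : (0 : ℝ) + 2 * s ∈ Icc (0 : ℝ) 1 := ⟨by linarith [hs.1], by linarith⟩
    have ht' : -1 + 2 * t ∈ Icc (0 : ℝ) 1 := ⟨by linarith, by linarith [ht.2]⟩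
    have hq : γ₁ (0 + 2 * s) = q := hint ⟨⟨_, hs', rfl⟩, ⟨_, ht', hst.symm⟩⟩
    have e1 := h₁.injOn hs' (by simp : (1 : ℝ) ∈ Icc (0 : ℝ) 1) (hq.trans h₁.target.symm)
    have e2 := h₂.injOn ht' (by simp : (0 : ℝ) ∈ Icc (0 : ℝ) 1)
      ((hst.symm.trans hq).trans h₂.source.symm)
    linarith
  refine ⟨?_, ?_, ?_, ?_, ?_, ?_, ?_⟩
  · rw [concat_of_le (by norm_num)]; simpa using h₁.source
  · rw [concat_of_ge h01 (by norm_num)]; convert h₂.target using 2; norm_num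
  · have hu : Icc (0 : ℝ) 1 = Icc 0 (1 / 2) ∪ Icc (1 / 2) 1 :=
      (Icc_union_Icc_eq_Icc (by norm_num) (by norm_num)).symm
    rw [hu]
    refine ContinuousOn.union_of_isClosed ?_ ?_ isClosed_Icc isClosed_Icc
    · refine (h₁.continuousOn.comp (f := fun s => 0 + 2 * s) (by fun_prop)
        fun s hs => ⟨by linarith [hs.1], by linarith [hs.2]⟩).congr fun s hs => ?_
      exact concat_of_le hs.2
    · refine (h₂.continuousOn.comp (f := fun s => -1 + 2 * s) (by fun_prop)
        fun s hs => ⟨by linarith [hs.1], by linarith [hs.2]⟩).congr fun s hs => ?_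
      exact concat_of_ge h01 hs.1
  · intro s hs t ht hst
    rcases le_total s (1 / 2) with hs2 | hs2 <;> rcases le_total t (1 / 2) with ht2 | ht2
    · rw [concat_of_le hs2, concat_of_le ht2] at hst
      have := h₁.injOn (⟨by linarith [hs.1], by linarith⟩ : (0 : ℝ) + 2 * s ∈ Icc (0 : ℝ) 1)
        (⟨by linarith [ht.1], by linarith⟩ : (0 : ℝ) + 2 * t ∈ Icc (0 : ℝ) 1) hst
      linarith
    · exact hmix s hs t ht hs2 ht2 hst
    · exact (hmix t ht s hs ht2 hs2 hst.symm).symm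
    · rw [concat_of_ge h01 hs2, concat_of_ge h01 ht2] at hst
      have := h₂.injOn (⟨by linarith, by linarith [hs.2]⟩ : -1 + 2 * s ∈ Icc (0 : ℝ) 1)
        (⟨by linarith, by linarith [ht.2]⟩ : -1 + 2 * t ∈ Icc (0 : ℝ) 1) hst
      linarith
  · obtain ⟨d, hd⟩ := h₁.tangent_source
    exact ⟨d, concat_right_tangent_of_lt (by norm_num) (by simpa using hd)⟩
  · obtain ⟨d, hd⟩ := h₂.tangent_target
    exact ⟨d, concat_left_tangent_of_gt h01 (by norm_num)
      (by rwa [show (-1 + 2 * 1 : ℝ) = 1 by norm_num])⟩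
  · intro t ht
    rcases lt_trichotomy t (1 / 2) with h | rfl | h
    · obtain ⟨l, r, hl, hr, hlr⟩ := h₁.no_sharp_turn (0 + 2 * t)
        ⟨by linarith [ht.1], by linarith⟩
      exact ⟨l, r, concat_left_tangent_of_le h.le hl, concat_right_tangent_of_lt h hr, hlr⟩
    · exact ⟨dl, dr, concat_left_tangent_of_le le_rfl
        (by rwa [show (0 + 2 * (1 / 2) : ℝ) = 1 by norm_num]),
        concat_right_tangent_of_ge h01 le_rfl
        (by rwa [show (-1 + 2 * (1 / 2) : ℝ) = 0 by norm_num]), hd⟩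
    · obtain ⟨l, r, hl, hr, hlr⟩ := h₂.no_sharp_turn (-1 + 2 * t)
        ⟨by linarith, by linarith [ht.2]⟩
      exact ⟨l, r, concat_left_tangent_of_gt h01 h hl, concat_right_tangent_of_ge h01 h.le hr,
        hlr⟩

theorem concat_left_tangent_one {γ₁ γ₂ : ℝ → Plane} {d : Plane} (h01 : γ₁ 1 = γ₂ 0)
    (h : HasLeftTangent γ₂ 1 d) : HasLeftTangent (concatCurve γ₁ γ₂) 1 d :=
  concat_left_tangent_of_gt h01 (by norm_num) (by rwa [show (-1 + 2 * 1 : ℝ) = 1 by norm_num])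

/-! ### Curves through cut points -/

/-- A path in the union of two closed sets that starts in one and ends in the other
meets their intersection. -/
theorem exists_mem_inter_of_continuousOn {γ : ℝ → Plane} {K₁ K₂ : Set Plane} {a b : ℝ}
    (hab : a ≤ b) (hγ : ContinuousOn γ (Icc a b)) (h₁ : IsClosed K₁) (h₂ : IsClosed K₂)
    (hK : ∀ t ∈ Icc a b, γ t ∈ K₁ ∪ K₂) (ha : (γ a ∈ K₁ ∧ γ b ∈ K₂) ∨ (γ a ∈ K₂ ∧ γ b ∈ K₁)) :
    ∃ t ∈ Icc a b, γ t ∈ K₁ ∩ K₂ := by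
  have hpre : IsPreconnected (γ '' Icc a b) := isPreconnected_Icc.image _ hγ
  rw [isPreconnected_closed_iff] at hpre
  have hma : γ a ∈ γ '' Icc a b := ⟨a, ⟨le_rfl, hab⟩, rfl⟩
  have hmb : γ b ∈ γ '' Icc a b := ⟨b, ⟨hab, le_rfl⟩, rfl⟩
  have hne : (γ '' Icc a b ∩ K₁).Nonempty ∧ (γ '' Icc a b ∩ K₂).Nonempty := by
    rcases ha with ⟨h, h'⟩ | ⟨h, h'⟩
    · exact ⟨⟨_, hma, h⟩, ⟨_, hmb, h'⟩⟩
    · exact ⟨⟨_, hmb, h'⟩, ⟨_, hma, h⟩⟩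
  obtain ⟨x, ⟨t, ht, rfl⟩, hx⟩ := hpre K₁ K₂ h₁ h₂
    (by rintro _ ⟨t, ht, rfl⟩; exact hK t ht) hne.1 hne.2
  exact ⟨t, ht, hx⟩

/-- An injective path in the union of two closed sets that meet in at most one point `p`, from one
to the other, passes through `p`, stays in the first set before, and in the second set after. -/
theorem IsLocallyMonotone.exists_cut {γ : ℝ → Plane} {p q x : Plane}
    (h : IsLocallyMonotone γ p q) {K₁ K₂ : Set Plane} (h₁ : IsClosed K₁) (h₂ : IsClosed K₂)
    (hK : trace γ ⊆ K₁ ∪ K₂) (hx : K₁ ∩ K₂ ⊆ {x}) (hp : p ∈ K₁) (hq : q ∈ K₂) :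
    ∃ τ ∈ Icc (0 : ℝ) 1, γ τ = x ∧ (∀ t ∈ Icc 0 τ, γ t ∈ K₁) ∧ ∀ t ∈ Icc τ 1, γ t ∈ K₂ := by
  have hcov : ∀ t ∈ Icc (0 : ℝ) 1, γ t ∈ K₁ ∪ K₂ := fun t ht => hK ⟨t, ht, rfl⟩
  rw [← h.source] at hp
  rw [← h.target] at hq
  obtain ⟨τ, hτ, hτx⟩ := exists_mem_inter_of_continuousOn zero_le_one h.continuousOn h₁ h₂ hcov
    (Or.inl ⟨hp, hq⟩)
  have hτ' : γ τ = x := hx hτx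
  refine ⟨τ, hτ, hτ', fun t ht => ?_, fun t ht => ?_⟩
  · by_contra hn
    have ht1 : t ∈ Icc (0 : ℝ) 1 := ⟨ht.1, ht.2.trans hτ.2⟩
    have ht2 := (hcov t ht1).resolve_left hn
    obtain ⟨s, hs, hsx⟩ := exists_mem_inter_of_continuousOn ht.1
      (h.continuousOn.mono (Icc_subset_Icc_right ht1.2)) h₁ h₂
      (fun s hs => hcov s ⟨hs.1, hs.2.trans ht1.2⟩) (Or.inl ⟨hp, ht2⟩)
    have : s = τ := h.injOn ⟨hs.1, hs.2.trans ht1.2⟩ hτ ((hx hsx).trans hτ'.symm)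
    have : t = τ := le_antisymm ht.2 (this ▸ hs.2)
    exact hn (this ▸ hτx.1)
  · by_contra hn
    have ht1 : t ∈ Icc (0 : ℝ) 1 := ⟨hτ.1.trans ht.1, ht.2⟩
    have ht2 := (hcov t ht1).resolve_right hn
    obtain ⟨s, hs, hsx⟩ := exists_mem_inter_of_continuousOn ht.2
      (h.continuousOn.mono (Icc_subset_Icc_left ht1.1)) h₁ h₂
      (fun s hs => hcov s ⟨ht1.1.trans hs.1, hs.2⟩) (Or.inl ⟨ht2, hq⟩)
    have : s = τ := h.injOn ⟨ht1.1.trans hs.1, hs.2⟩ hτ ((hx hsx).trans hτ'.symm)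
    have : t = τ := le_antisymm (this ▸ hs.1) ht.1
    exact hn (this ▸ hτx.2)

/-- An injective path cannot leave a closed set through a cut point `x` and come back. -/
theorem IsLocallyMonotone.mem_of_cut {γ : ℝ → Plane} {p q x : Plane}
    (h : IsLocallyMonotone γ p q) {K₁ K₂ : Set Plane} (h₁ : IsClosed K₁) (h₂ : IsClosed K₂)
    (hK : trace γ ⊆ K₁ ∪ K₂) (hx : K₁ ∩ K₂ ⊆ {x}) (hp : p ∈ K₁) (hq : q ∈ K₁) :
    ∀ t ∈ Icc (0 : ℝ) 1, γ t ∈ K₁ := by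
  have hcov : ∀ t ∈ Icc (0 : ℝ) 1, γ t ∈ K₁ ∪ K₂ := fun t ht => hK ⟨t, ht, rfl⟩
  rw [← h.source] at hp
  rw [← h.target] at hq
  intro t ht
  by_contra hn
  have ht2 := (hcov t ht).resolve_left hn
  obtain ⟨s, hs, hsx⟩ := exists_mem_inter_of_continuousOn ht.1
    (h.continuousOn.mono (Icc_subset_Icc_right ht.2)) h₁ h₂
    (fun s hs => hcov s ⟨hs.1, hs.2.trans ht.2⟩) (Or.inl ⟨hp, ht2⟩)
  obtain ⟨s', hs', hsx'⟩ := exists_mem_inter_of_continuousOn ht.2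
    (h.continuousOn.mono (Icc_subset_Icc_left ht.1)) h₁ h₂
    (fun s hs => hcov s ⟨ht.1.trans hs.1, hs.2⟩) (Or.inr ⟨ht2, hq⟩)
  have hss : s = s' := h.injOn ⟨hs.1, hs.2.trans ht.2⟩ ⟨ht.1.trans hs'.1, hs'.2⟩
    ((hx hsx).trans (hx hsx').symm)
  have : t = s := le_antisymm (hss ▸ hs'.1) hs.2
  exact hn (this ▸ hsx.1)

/-! ### Oriented tracks and the sides of a track in the tree -/

namespace Drawing

variable {V J E : Type*} {A : Drawing V J E}

/-- A track together with one of its two orientations. -/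
@[ext] structure Leg (A : Drawing V J E) where
  track : E
  source : Terminal V J
  target : Terminal V J
  goes : (A.src track = source ∧ A.tgt track = target) ∨
    (A.src track = target ∧ A.tgt track = source)

namespace Leg

/-- The same track, traversed in the opposite direction. -/
def rev (d : A.Leg) : A.Leg := ⟨d.track, d.target, d.source, d.goes.symm⟩

@[simp] theorem rev_source (d : A.Leg) : d.rev.source = d.target := rfl
@[simp] theorem rev_target (d : A.Leg) : d.rev.target = d.source := rfl

theorem isEnd_source (d : A.Leg) : A.IsEnd d.track d.source :=
  d.goes.elim (fun h => Or.inl h.1) fun h => Or.inr h.2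

theorem isEnd_target (d : A.Leg) : A.IsEnd d.track d.target := d.rev.isEnd_source

theorem eq_of_isEnd (d : A.Leg) {t : Terminal V J} (h : A.IsEnd d.track t) :
    t = d.source ∨ t = d.target := by
  rcases d.goes with ⟨h1, h2⟩ | ⟨h1, h2⟩ <;> rcases h with h | h <;> simp_all

theorem nodes_eq (d : A.Leg) : A.nodes d.track = s(d.source.node, d.target.node) := by
  rcases d.goes with ⟨h1, h2⟩ | ⟨h1, h2⟩
  · rw [nodes, h1, h2]
  · rw [nodes, h1, h2, Sym2.eq_swap]

end Leg

theorem exists_leg {e : E} {t : Terminal V J} (h : A.IsEnd e t) :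
    ∃ d : A.Leg, d.track = e ∧ d.source = t := by
  rcases h with h | h
  · exact ⟨⟨e, t, A.tgt e, Or.inl ⟨h, rfl⟩⟩, rfl, rfl⟩
  · exact ⟨⟨e, t, A.src e, Or.inr ⟨rfl, h⟩⟩, rfl, rfl⟩

theorem exists_leg_of_adj {n m : V ⊕ J} (h : A.underlying.Adj n m) :
    ∃ d : A.Leg, d.source.node = n ∧ d.target.node = m := by
  rw [underlying, SimpleGraph.fromEdgeSet_adj] at h
  obtain ⟨⟨e, he⟩, -⟩ := h
  rw [nodes, Sym2.eq_iff] at he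
  rcases he with ⟨h1, h2⟩ | ⟨h1, h2⟩
  · exact ⟨⟨e, A.src e, A.tgt e, Or.inl ⟨rfl, rfl⟩⟩, h1, h2⟩
  · exact ⟨⟨e, A.tgt e, A.src e, Or.inr ⟨rfl, rfl⟩⟩, h2, h1⟩

namespace Leg

theorem node_ne (hA : A.IsTreeLike) (d : A.Leg) : d.source.node ≠ d.target.node := by
  have := hA.no_loop d.track
  rwa [d.nodes_eq, Sym2.mk_isDiag_iff] at this

theorem adj (hA : A.IsTreeLike) (d : A.Leg) :
    A.underlying.Adj d.source.node d.target.node := by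
  rw [underlying, SimpleGraph.fromEdgeSet_adj]
  exact ⟨⟨d.track, d.nodes_eq⟩, d.node_ne hA⟩

/-- The two ends of a track belong to distinct nodes, so a leg is determined by its track and the
node at its source. -/
theorem eq_of_track_eq (hA : A.IsTreeLike) {d d' : A.Leg} (ht : d.track = d'.track)
    (hs : d.source.node = d'.source.node) : d = d' := by
  have h1 := d'.eq_of_isEnd (ht ▸ d.isEnd_source)
  have h2 := d'.eq_of_isEnd (ht ▸ d.isEnd_target)
  have hne := d.node_ne hA
  have hne' := d'.node_ne hA
  rcases h1 with h1 | h1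
  · rcases h2 with h2 | h2
    · exact absurd (by rw [h1, h2]) hne
    · exact Leg.ext ht h1 h2
  · exact absurd (by rw [← hs, h1]) hne'

theorem eq_or_eq_rev (hA : A.IsTreeLike) {d d' : A.Leg} (h : d.track = d'.track) :
    d = d' ∨ d = d'.rev := by
  rcases d'.eq_of_isEnd (h ▸ d.isEnd_source) with h1 | h1
  · exact Or.inl (eq_of_track_eq hA h (by rw [h1]))
  · exact Or.inr (eq_of_track_eq hA h (by rw [h1]; rfl))

/-- The nodes on the target side of a leg: those that lose their connection to its source when the
track is removed from the tree. -/
def ahead (d : A.Leg) : Set (V ⊕ J) :=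
  {n | ¬ (A.underlying.deleteEdges {A.nodes d.track}).Reachable n d.source.node}

theorem source_notMem_ahead (d : A.Leg) : d.source.node ∉ d.ahead :=
  fun h => h (SimpleGraph.Reachable.refl _)

theorem target_mem_ahead (hA : A.IsTreeLike) (d : A.Leg) : d.target.node ∈ d.ahead := by
  intro h
  have := SimpleGraph.isAcyclic_iff_forall_adj_isBridge.1 hA.isTree.isAcyclic (d.adj hA)
  rw [SimpleGraph.isBridge_iff, ← d.nodes_eq] at this
  exact this h.symm

/-- Only the track of the leg itself connects its two sides. -/
theorem eq_of_crossing (hA : A.IsTreeLike) {d d' : A.Leg} (hs : d'.source.node ∉ d.ahead)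
    (ht : d'.target.node ∈ d.ahead) : d' = d := by
  have htr : d'.track = d.track := by
    by_contra hne
    apply ht
    have hs' : (A.underlying.deleteEdges {A.nodes d.track}).Reachable d'.source.node
      d.source.node := not_not.1 hs
    refine SimpleGraph.Reachable.trans (SimpleGraph.Adj.reachable ?_) hs'
    rw [SimpleGraph.deleteEdges_adj]
    refine ⟨(d'.adj hA).symm, fun h => hne (hA.no_parallel ?_)⟩
    rw [d'.nodes_eq, Sym2.eq_swap]
    exact h
  rcases eq_or_eq_rev hA htr with h | h
  · exact h
  · rw [h] at ht
    exact absurd ht d.source_notMem_ahead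

/-- Induction over the tree, along its edges. -/
theorem _root_.Drawing.node_induction (hA : A.IsTreeLike) {P : V ⊕ J → Prop} (x : V ⊕ J)
    (hx : P x) (hP : ∀ d : A.Leg, P d.source.node → P d.target.node) (n : V ⊕ J) : P n := by
  obtain ⟨w⟩ := hA.isTree.1.preconnected n x
  induction w with
  | nil => exact hx
  | cons h _ ih =>
    obtain ⟨d, hs, ht⟩ := exists_leg_of_adj h.symm
    have := hP d (hs ▸ ih hx)
    exact ht ▸ this

theorem mem_rev_ahead (hA : A.IsTreeLike) (d : A.Leg) (n : V ⊕ J) :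
    n ∈ d.rev.ahead ↔ n ∉ d.ahead := by
  refine ⟨fun h h' => ?_, fun h h' => ?_⟩
  · refine node_induction hA (P := fun n => ¬ (n ∈ d.rev.ahead ∧ n ∈ d.ahead)) d.source.node
      (fun h => d.source_notMem_ahead h.2) (fun d' hd' hm => ?_) n ⟨h, h'⟩
    by_cases h1 : d'.source.node ∈ d.ahead
    · have h2 : d'.source.node ∉ d.rev.ahead := fun h2 => hd' ⟨h2, h1⟩
      have := eq_of_crossing hA h2 hm.1
      rw [this] at hm
      exact d.source_notMem_ahead hm.2
    · have := eq_of_crossing hA h1 hm.2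
      rw [this] at hm
      exact d.rev.source_notMem_ahead hm.1
  · have h1 : (A.underlying.deleteEdges {A.nodes d.track}).Reachable n d.source.node :=
      not_not.1 h
    have h2 : ¬ (A.underlying.deleteEdges {A.nodes d.track}).Reachable d.target.node
      d.source.node := d.target_mem_ahead hA
    have h3 : ¬ (A.underlying.deleteEdges {A.nodes d.track}).Reachable n d.target.node :=
      fun h3 => h2 (h3.symm.trans h1)
    exact h3 h'

theorem mem_rev_ahead' (hA : A.IsTreeLike) (d : A.Leg) (n : V ⊕ J) :
    n ∉ d.rev.ahead ↔ n ∈ d.ahead := by rw [mem_rev_ahead hA, not_not]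

/-- Every other node is ahead of some leg that leaves a given node. -/
theorem _root_.Drawing.exists_leg_ahead (hA : A.IsTreeLike) {x n : V ⊕ J} (h : n ≠ x) :
    ∃ d : A.Leg, d.source.node = x ∧ n ∈ d.ahead := by
  refine (or_iff_not_imp_left.1 (node_induction hA
    (P := fun n => n = x ∨ ∃ d : A.Leg, d.source.node = x ∧ n ∈ d.ahead) x (Or.inl rfl)
    (fun d' hd' => ?_) n)) h
  rcases hd' with hd' | ⟨d, hd, hn⟩
  · exact Or.inr ⟨d', hd', d'.target_mem_ahead hA⟩
  · by_cases hm : d'.target.node ∈ d.ahead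
    · exact Or.inr ⟨d, hd, hm⟩
    · have := eq_of_crossing hA (d' := d'.rev) hm hn
      left
      rw [← hd, ← this]
      rfl

theorem disjoint_ahead (hA : A.IsTreeLike) {d d' : A.Leg} (hs : d.source.node = d'.source.node)
    (hne : d ≠ d') : Disjoint d.ahead d'.ahead := by
  rw [Set.disjoint_left]
  intro n hn hn'
  refine node_induction hA (P := fun n => ¬ (n ∈ d.ahead ∧ n ∈ d'.ahead)) d.source.node
      (fun h => d.source_notMem_ahead h.1) (fun l hl hm => ?_) n ⟨hn, hn'⟩
  by_cases h1 : l.source.node ∈ d.ahead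
  · have h2 := eq_of_crossing hA (fun h2 => hl ⟨h1, h2⟩) hm.2
    rw [h2, ← hs] at h1
    exact d.source_notMem_ahead h1
  · have h2 := eq_of_crossing hA h1 hm.1
    have h3 : l.source.node ∉ d'.ahead := by
      rw [h2, hs]
      exact d'.source_notMem_ahead
    exact hne (h2.symm.trans (eq_of_crossing hA h3 hm.2))

/-- Going on from a node by another track, the side ahead shrinks. -/
theorem ahead_ssubset (hA : A.IsTreeLike) {d d' : A.Leg} (h : d.target.node = d'.source.node)
    (hne : d' ≠ d.rev) : d'.ahead ⊂ d.ahead := by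
  have hdis := disjoint_ahead hA (d := d') (d' := d.rev) h.symm hne
  refine ⟨fun n hn => (mem_rev_ahead' hA d n).1 fun hn' => Set.disjoint_left.1 hdis hn hn',
    fun hsub => ?_⟩
  exact d'.source_notMem_ahead (hsub (h ▸ d.target_mem_ahead hA))

end Leg

/-! ### Routes -/

/-- The ports `i` and `k` are connected inside a junction of the given kind. -/
def _root_.JunctionKind.Linked (K : JunctionKind) (i k : Fin 3) : Prop :=
  K.Joins i k ∨ K.Joins k i

theorem _root_.JunctionKind.Linked.symm {K : JunctionKind} {i k : Fin 3} (h : K.Linked i k) :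
    K.Linked k i := Or.symm h

theorem _root_.JunctionKind.Linked.ne {K : JunctionKind} {i k : Fin 3} (h : K.Linked i k) :
    i ≠ k := by
  rintro rfl
  rcases h with h | h <;> cases K <;> simp [JunctionKind.Joins] at h

/-- The leg `d` arrives at a port of a junction, and `d'` leaves from a port of the same junction
that is connected to it. -/
def Leg.Follows (d d' : A.Leg) : Prop :=
  ∃ j i k, d.target = .inr (j, i) ∧ d'.source = .inr (j, k) ∧ (A.junction j).kind.Linked i k

theorem Leg.Follows.rev {d d' : A.Leg} (h : d.Follows d') : d'.rev.Follows d.rev := by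
  obtain ⟨j, i, k, h1, h2, h3⟩ := h
  exact ⟨j, k, i, h2, h1, h3.symm⟩

theorem Leg.Follows.node_eq {d d' : A.Leg} (h : d.Follows d') :
    d.target.node = d'.source.node := by
  obtain ⟨j, i, k, h1, h2, h3⟩ := h
  rw [h1, h2]
  rfl

theorem Leg.Follows.ne_rev {d d' : A.Leg} (h : d.Follows d') : d' ≠ d.rev := by
  rintro rfl
  obtain ⟨j, i, k, h1, h2, h3⟩ := h
  rw [Leg.rev_source, h1] at h2
  exact h3.ne (by simpa using h2)

/-- The leg `d'` can be reached from the leg `d` by passing through junctions only. -/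
def Leg.Leads (d d' : A.Leg) : Prop := Relation.ReflTransGen Leg.Follows d d'

theorem Leg.Leads.rev {d d' : A.Leg} (h : d.Leads d') : d'.rev.Leads d.rev := by
  induction h with
  | refl => exact .refl
  | tail _ h ih => exact Relation.ReflTransGen.head h.rev ih

/-- A route from the vertex `u` to the vertex `v`: the combinatorial form of a locally-monotone
curve in the drawing that passes through no other vertex. -/
def Route (A : Drawing V J E) (u v : V) : Prop :=
  ∃ d d' : A.Leg, d.source = .inl u ∧ d'.target = .inl v ∧ d.Leads d'

theorem Route.symm {u v : V} (h : A.Route u v) : A.Route v u := by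
  obtain ⟨d, d', h1, h2, h3⟩ := h
  exact ⟨d'.rev, d.rev, h2, h1, h3.rev⟩

theorem Leg.Leads.ahead_subset (hA : A.IsTreeLike) {d d' : A.Leg} (h : d.Leads d') :
    d'.ahead ⊆ d.ahead := by
  induction h with
  | refl => exact subset_rfl
  | tail _ h ih => exact (ahead_ssubset hA h.node_eq h.ne_rev).subset.trans ih

theorem not_route_self (hA : A.IsTreeLike) (v : V) : ¬ A.Route v v := by
  rintro ⟨d, d', h1, h2, h3⟩
  have h4 := h3.ahead_subset hA (d'.target_mem_ahead hA)
  rw [h2] at h4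
  have h5 := d.source_notMem_ahead
  rw [h1] at h5
  exact h5 h4

end Drawing

/-! ### Curves in the drawing follow routes -/

theorem Junction.isClosed_region (j : Junction) : IsClosed j.region := by
  have : j.region = ⋃ i, ⋃ k, ⋃ (_ : j.kind.Joins i k), trace (j.arc i k) := by
    ext x
    simp [Junction.region, arcsUnion]
  rw [this]
  exact isClosed_iUnion_of_finite fun i => isClosed_iUnion_of_finite fun k =>
    isClosed_iUnion_of_finite fun h => (j.arc_locallyMonotone i k h).isCompact.isClosed

theorem Junction.trace_arc_subset (j : Junction) {i k : Fin 3} (h : j.kind.Joins i k) :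
    trace (j.arc i k) ⊆ j.region := fun _ hx => ⟨i, k, h, hx⟩

theorem Junction.port_mem_region (j : Junction) (i : Fin 3) : j.port i ∈ j.region := by
  have h01 : j.kind.Joins 0 1 := by cases j.kind <;> simp [JunctionKind.Joins]
  have h02 : j.kind.Joins 0 2 := by cases j.kind <;> simp [JunctionKind.Joins]
  fin_cases i
  · exact j.trace_arc_subset h01 (j.arc_locallyMonotone 0 1 h01).source_mem
  · exact j.trace_arc_subset h01 (j.arc_locallyMonotone 0 1 h01).target_mem
  · exact j.trace_arc_subset h02 (j.arc_locallyMonotone 0 2 h02).target_mem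

/-- A curve `γ` from `p` to `q` that runs along the curve `c`, in either direction: its tangents at
the ends are those in which `c` leaves its ends. -/
structure Traverses (γ c : ℝ → Plane) (p q : Plane) : Prop where
  locallyMonotone : IsLocallyMonotone γ p q
  trace_eq : trace γ = trace c
  right_tangent : ∃ d, HasRightTangent γ 0 d ∧ LeavesAlong c p d
  left_tangent : ∃ d, HasLeftTangent γ 1 d ∧ LeavesAlong c q d

theorem IsLocallyMonotone.traverses {c : ℝ → Plane} {p q : Plane} (h : IsLocallyMonotone c p q) :
    Traverses c c p q where
  locallyMonotone := h
  trace_eq := rfl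
  right_tangent := h.tangent_source.imp fun _ hd => ⟨hd, Or.inl ⟨h.source, hd⟩⟩
  left_tangent := h.tangent_target.imp fun _ hd => ⟨hd, Or.inr ⟨h.target, hd⟩⟩

theorem IsLocallyMonotone.traverses_reverse {c : ℝ → Plane} {p q : Plane}
    (h : IsLocallyMonotone c p q) : Traverses (fun s => c (1 - s)) c q p where
  locallyMonotone := h.reverse
  trace_eq := trace_reverse c
  right_tangent := h.tangent_target.imp fun _ hd =>
    ⟨HasLeftTangent.reverse (by simpa using hd), Or.inr ⟨h.target, hd⟩⟩
  left_tangent := h.tangent_source.imp fun _ hd =>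
    ⟨HasRightTangent.reverse (by simpa using hd), Or.inl ⟨h.source, hd⟩⟩

theorem Junction.exists_traverses (j : Junction) {i k : Fin 3} (h : j.kind.Linked i k) :
    ∃ γ a b, j.kind.Joins a b ∧ Traverses γ (j.arc a b) (j.port i) (j.port k) := by
  rcases h with h | h
  · exact ⟨_, i, k, h, (j.arc_locallyMonotone i k h).traverses⟩
  · exact ⟨_, k, i, h, (j.arc_locallyMonotone k i h).traverses_reverse⟩

namespace Drawing

variable {V J E : Type*} {A : Drawing V J E}

theorem Leg.exists_traverses (hP : A.IsPlanar) (d : A.Leg) :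
    ∃ γ, Traverses γ (A.track d.track) (A.pos d.source) (A.pos d.target) := by
  have h := hP.track_locallyMonotone d.track
  rcases d.goes with ⟨h1, h2⟩ | ⟨h1, h2⟩
  · rw [h1, h2] at h
    exact ⟨_, h.traverses⟩
  · rw [h1, h2] at h
    exact ⟨_, h.traverses_reverse⟩

/-- The part of the drawing formed by the nodes in `N` and the tracks between them. -/
def part (A : Drawing V J E) (N : Set (V ⊕ J)) : Set Plane :=
  {x | (∃ v, .inl v ∈ N ∧ x = A.vertexPos v) ∨ (∃ j, .inr j ∈ N ∧ x ∈ (A.junction j).region) ∨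
    ∃ d : A.Leg, d.source.node ∈ N ∧ d.target.node ∈ N ∧ x ∈ trace (A.track d.track)}

theorem isClosed_part [Finite V] [Finite J] [Finite E] (hP : A.IsPlanar) (N : Set (V ⊕ J)) :
    IsClosed (A.part N) := by
  have h1 : IsClosed {x | ∃ v, .inl v ∈ N ∧ x = A.vertexPos v} :=
    ((Set.finite_range A.vertexPos).subset (by rintro _ ⟨v, -, rfl⟩; exact ⟨v, rfl⟩)).isClosed
  have h2 : IsClosed {x | ∃ j, .inr j ∈ N ∧ x ∈ (A.junction j).region} := by
    have : {x | ∃ j, .inr j ∈ N ∧ x ∈ (A.junction j).region} =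
        ⋃ j, ⋃ (_ : .inr j ∈ N), (A.junction j).region := by
      ext x
      simp
    rw [this]
    exact isClosed_iUnion_of_finite fun j => isClosed_iUnion_of_finite fun _ =>
      (A.junction j).isClosed_region
  have h3 : IsClosed {x | ∃ d : A.Leg, d.source.node ∈ N ∧ d.target.node ∈ N ∧
      x ∈ trace (A.track d.track)} := by
    have : {x | ∃ d : A.Leg, d.source.node ∈ N ∧ d.target.node ∈ N ∧
        x ∈ trace (A.track d.track)} = ⋃ e, ⋃ (_ : ∃ d : A.Leg, d.track = e ∧
          d.source.node ∈ N ∧ d.target.node ∈ N), trace (A.track e) := by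
      ext x
      simp only [mem_ofPred_eq, mem_iUnion, exists_prop]
      constructor
      · rintro ⟨d, h1, h2, h3⟩
        exact ⟨_, ⟨d, rfl, h1, h2⟩, h3⟩
      · rintro ⟨_, ⟨d, rfl, h1, h2⟩, h3⟩
        exact ⟨d, h1, h2, h3⟩
    rw [this]
    exact isClosed_iUnion_of_finite fun e => isClosed_iUnion_of_finite fun _ =>
      (hP.track_locallyMonotone e).isCompact.isClosed
  exact h1.union (h2.union h3)

theorem isClosed_trace_track (hP : A.IsPlanar) (e : E) : IsClosed (trace (A.track e)) :=
  (hP.track_locallyMonotone e).isCompact.isClosed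

theorem vertexPos_mem_part {N : Set (V ⊕ J)} {v : V} (h : .inl v ∈ N) :
    A.vertexPos v ∈ A.part N := Or.inl ⟨v, h, rfl⟩

theorem region_subset_part {N : Set (V ⊕ J)} {j : J} (h : .inr j ∈ N) :
    (A.junction j).region ⊆ A.part N := fun _ hx => Or.inr (Or.inl ⟨j, h, hx⟩)

theorem trace_subset_part {N : Set (V ⊕ J)} {d : A.Leg} (hs : d.source.node ∈ N)
    (ht : d.target.node ∈ N) : trace (A.track d.track) ⊆ A.part N :=
  fun _ hx => Or.inr (Or.inr ⟨d, hs, ht, hx⟩)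

theorem part_mono {N M : Set (V ⊕ J)} (h : N ⊆ M) : A.part N ⊆ A.part M := by
  rintro x (⟨v, hv, rfl⟩ | ⟨j, hj, hx⟩ | ⟨d, hs, ht, hx⟩)
  · exact vertexPos_mem_part (h hv)
  · exact region_subset_part (h hj) hx
  · exact trace_subset_part (h hs) (h ht) hx

theorem part_subset_carrier (N : Set (V ⊕ J)) : A.part N ⊆ A.carrier := by
  rintro x (⟨v, hv, rfl⟩ | ⟨j, hj, hx⟩ | ⟨d, hs, ht, hx⟩)
  · exact Or.inl (Or.inl ⟨v, rfl⟩)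
  · exact Or.inl (Or.inr (mem_iUnion.2 ⟨j, hx⟩))
  · exact Or.inr (mem_iUnion.2 ⟨_, hx⟩)

theorem trace_subset_carrier (e : E) : trace (A.track e) ⊆ A.carrier :=
  fun _ hx => Or.inr (mem_iUnion.2 ⟨_, hx⟩)

/-- By planarity, disjoint sets of nodes give disjoint parts of the drawing. -/
theorem disjoint_part (hP : A.IsPlanar) {N M : Set (V ⊕ J)} (h : Disjoint N M) :
    Disjoint (A.part N) (A.part M) := by
  have hd : ∀ n, n ∈ N → n ∉ M := fun n hn => Set.disjoint_left.1 h hn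
  have end_node : ∀ (d : A.Leg) {t : Terminal V J} (S : Set (V ⊕ J)), A.IsEnd d.track t →
      d.source.node ∈ S → d.target.node ∈ S → t.node ∈ S := by
    intro d t S ht h1 h2
    rcases d.eq_of_isEnd ht with rfl | rfl
    · exact h1
    · exact h2
  rw [Set.disjoint_left]
  rintro x (⟨v, hv, rfl⟩ | ⟨j, hj, hx⟩ | ⟨d, hs, ht, hx⟩)
    (⟨v', hv', hx'⟩ | ⟨j', hj', hx'⟩ | ⟨d', hs', ht', hx'⟩)
  · exact hd _ hv (hP.vertex_vertex hx' ▸ hv')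
  · exact hP.vertex_junction v j' hx'
  · exact hd _ hv (end_node d' (t := .inl v) M (hP.vertex_track v _ hx') hs' ht')
  · exact hP.vertex_junction v' j (hx' ▸ hx)
  · by_cases hjj : j = j'
    · exact hd _ hj (hjj ▸ hj')
    · exact Set.disjoint_left.1 (hP.junction_junction j j' hjj) hx hx'
  · obtain ⟨i, hi, -⟩ := hP.track_junction d'.track j x ⟨hx', hx⟩
    exact hd _ hj (end_node d' (t := .inr (j, i)) M hi hs' ht')
  · rw [hx'] at hx
    exact hd _ (end_node d (t := .inl v') N (hP.vertex_track v' _ hx) hs ht) hv'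
  · obtain ⟨i, hi, -⟩ := hP.track_junction d.track j' x ⟨hx, hx'⟩
    exact hd _ (end_node d (t := .inr (j', i)) N hi hs ht) hj'
  · by_cases he : d.track = d'.track
    · exact hd _ hs (end_node d' M (he ▸ d.isEnd_source) hs' ht')
    · obtain ⟨t, h1, h2, -⟩ := hP.track_track _ _ he x ⟨hx, hx'⟩
      exact hd _ (end_node d N h1 hs ht) (end_node d' M h2 hs' ht')

/-- A leg meets the part of the drawing ahead of it only at its target. -/
theorem Leg.trace_inter_part_ahead (hP : A.IsPlanar) (d : A.Leg) :
    trace (A.track d.track) ∩ A.part d.ahead ⊆ {A.pos d.target} := by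
  have key : ∀ t, A.IsEnd d.track t → t.node ∈ d.ahead → t = d.target := fun t ht hn =>
    (d.eq_of_isEnd ht).resolve_left fun h => d.source_notMem_ahead (h ▸ hn)
  rintro x ⟨hx, ⟨v, hv, rfl⟩ | ⟨j, hj, hx'⟩ | ⟨d', hs, ht, hx'⟩⟩
  · rw [← key _ (hP.vertex_track v _ hx) hv]
    rfl
  · obtain ⟨i, hi, rfl⟩ := hP.track_junction d.track j x ⟨hx, hx'⟩
    rw [← key _ hi hj]
    rfl
  · by_cases he : d.track = d'.track
    · rcases d'.eq_of_isEnd (he ▸ d.isEnd_source) with h | h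
      · exact absurd (h ▸ hs) d.source_notMem_ahead
      · exact absurd (h ▸ ht) d.source_notMem_ahead
    · obtain ⟨t, h1, h2, rfl⟩ := hP.track_track _ _ he x ⟨hx, hx'⟩
      rcases d'.eq_of_isEnd h2 with h | h
      · rw [key _ h1 (h ▸ hs)]
        rfl
      · rw [key _ h1 (h ▸ ht)]
        rfl

/-- A leg together with the part ahead of it meets the rest of the drawing only at its source. -/
theorem Leg.cut (hP : A.IsPlanar) (hA : A.IsTreeLike) (d : A.Leg) :
    (trace (A.track d.track) ∪ A.part d.ahead) ∩ A.part d.rev.ahead ⊆ {A.pos d.source} := by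
  rintro x ⟨hx | hx, hx'⟩
  · exact d.rev.trace_inter_part_ahead hP ⟨hx, hx'⟩
  · refine absurd hx' (Set.disjoint_left.1 (disjoint_part hP ?_) hx)
    rw [Set.disjoint_left]
    exact fun n hn hn' => (d.mem_rev_ahead hA n).1 hn' hn

theorem Leg.carrier_subset (hA : A.IsTreeLike) (d : A.Leg) :
    A.carrier ⊆ (trace (A.track d.track) ∪ A.part d.ahead) ∪ A.part d.rev.ahead := by
  have hor : ∀ n, n ∈ d.ahead ∨ n ∈ d.rev.ahead := fun n => by
    rw [d.mem_rev_ahead hA]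
    exact em _
  rintro x ((⟨v, rfl⟩ | hx) | hx)
  · exact (hor (.inl v)).imp (fun h => Or.inr (vertexPos_mem_part h)) vertexPos_mem_part
  · obtain ⟨j, hx⟩ := mem_iUnion.1 hx
    exact (hor (.inr j)).imp (fun h => Or.inr (region_subset_part h hx))
      fun h => region_subset_part h hx
  · obtain ⟨e, hx⟩ := mem_iUnion.1 hx
    obtain ⟨l, rfl, -⟩ := exists_leg (Or.inl rfl : A.IsEnd e (A.src e))
    by_cases h1 : l.source.node ∈ d.ahead <;> by_cases h2 : l.target.node ∈ d.ahead
    · exact Or.inl (Or.inr (trace_subset_part h1 h2 hx))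
    · have := Leg.eq_of_crossing hA (d := d) (d' := l.rev) h2 h1
      exact Or.inl (Or.inl (this ▸ hx))
    · have := Leg.eq_of_crossing hA (d := d) (d' := l) h1 h2
      exact Or.inl (Or.inl (this ▸ hx))
    · exact Or.inr (trace_subset_part ((d.mem_rev_ahead hA _).2 h1)
        ((d.mem_rev_ahead hA _).2 h2) hx)

theorem pos_inl (v : V) : A.pos (.inl v) = A.vertexPos v := rfl

theorem pos_inr (j : J) (i : Fin 3) : A.pos (.inr (j, i)) = (A.junction j).port i := rfl

/-- A sequence of legs, each following the previous one, is drawn by a locally-monotone curve: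
concatenate the tracks with the arcs of the junctions in between. The curve does not intersect
itself since a track and the junction before it lie ahead of everything visited earlier. -/
theorem Leg.Leads.exists_curve (hP : A.IsPlanar) (hA : A.IsTreeLike) {d d' : A.Leg}
    (h : d.Leads d') : ∃ γ, IsLocallyMonotone γ (A.pos d.source) (A.pos d'.target) ∧
      trace γ ⊆ trace (A.track d'.track) ∪ A.part d'.rev.ahead ∧
      (∃ l, HasLeftTangent γ 1 l ∧ LeavesAlong (A.track d'.track) (A.pos d'.target) l) ∧
      ∀ w, A.vertexPos w ∈ trace γ → .inl w = d.source ∨ .inl w = d'.target := by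
  induction h with
  | refl =>
    obtain ⟨γ, hγ⟩ := d.exists_traverses hP
    refine ⟨γ, hγ.locallyMonotone, hγ.trace_eq ▸ subset_union_left, hγ.left_tangent,
      fun w hw => ?_⟩
    rw [hγ.trace_eq] at hw
    exact d.eq_of_isEnd (hP.vertex_track w _ hw)
  | @tail m d' _ hf ih =>
    obtain ⟨γ, hγ, hsub, ⟨l, hl, hl'⟩, hw⟩ := ih
    obtain ⟨j, i, k, hm, hd', hlink⟩ := id hf
    obtain ⟨α, a, b, hab, hα⟩ := (A.junction j).exists_traverses hlink
    obtain ⟨β, hβ⟩ := d'.exists_traverses hP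
    have hαsub : trace α ⊆ (A.junction j).region :=
      hα.trace_eq ▸ (A.junction j).trace_arc_subset hab
    have hmn : m.target.node = .inr j := by rw [hm]; rfl
    have hdn : d'.source.node = .inr j := by rw [hd']; rfl
    rw [hm] at hγ hl'
    rw [hd'] at hβ
    rw [pos_inr] at hγ hβ hl'
    obtain ⟨r, hr, hr'⟩ := hα.right_tangent
    have h1 : trace γ ∩ trace α ⊆ {(A.junction j).port i} := by
      rintro x ⟨hx, hxα⟩
      rcases hsub hx with hx | hx
      · obtain ⟨i', hi', rfl⟩ := hP.track_junction _ j x ⟨hx, hαsub hxα⟩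
        rcases m.eq_of_isEnd hi' with h | h
        · exact absurd (by rw [← h, hmn]; rfl) (m.node_ne hA)
        · rw [hm] at h
          simp_all
      · exact absurd (region_subset_part (N := {.inr j}) rfl (hαsub hxα))
          (Set.disjoint_left.1 (disjoint_part hP (Set.disjoint_singleton_right.2
            (hmn ▸ m.rev.source_notMem_ahead))) hx)
    have hγα := hγ.concat hα.locallyMonotone h1 hl hr (hP.port_smooth _ j i a b _ _ hab hl' hr')
    have e1 : γ 1 = α 0 := by rw [hγ.target, hα.locallyMonotone.source]
    have hmem : d'.source.node ∈ d'.rev.ahead := d'.rev.target_mem_ahead hA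
    have hss := (Leg.ahead_ssubset hA hf.rev.node_eq hf.rev.ne_rev).subset
    have hsub' : trace (concatCurve γ α) ⊆ A.part d'.rev.ahead := by
      rw [trace_concat e1]
      rintro x (hx | hx)
      · rcases hsub hx with hx | hx
        · exact trace_subset_part (hss (m.rev.target_mem_ahead hA)) (hf.node_eq ▸ hmem) hx
        · exact part_mono hss hx
      · exact region_subset_part (hdn ▸ hmem) (hαsub hx)
    have h2 : trace (concatCurve γ α) ∩ trace β ⊆ {(A.junction j).port k} := by
      rintro x ⟨hx, hxβ⟩
      have := d'.rev.trace_inter_part_ahead hP ⟨hβ.trace_eq ▸ hxβ, hsub' hx⟩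
      rwa [Leg.rev_target, hd', pos_inr] at this
    obtain ⟨l2, hl2, hl2'⟩ := hα.left_tangent
    obtain ⟨r2, hr2, hr2'⟩ := hβ.right_tangent
    have e2 : concatCurve γ α 1 = β 0 := by rw [hγα.target, hβ.locallyMonotone.source]
    refine ⟨_, hγα.concat hβ.locallyMonotone h2 (concat_left_tangent_one e1 hl2) hr2
      (hP.port_smooth _ j k a b _ _ hab hr2' hl2').symm, ?_, ?_, fun w hwx => ?_⟩
    · rw [trace_concat e2, hβ.trace_eq]
      exact union_subset (hsub'.trans subset_union_right) subset_union_left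
    · exact hβ.left_tangent.imp fun _ h => ⟨concat_left_tangent_one e2 h.1, h.2⟩
    · rw [trace_concat e2, trace_concat e1, hβ.trace_eq] at hwx
      rcases hwx with (hwx | hwx) | hwx
      · refine (hw w hwx).imp_right fun h => ?_
        rw [hm] at h
        cases h
      · exact absurd (hαsub hwx) (hP.vertex_junction w j)
      · right
        refine (d'.eq_of_isEnd (hP.vertex_track w _ hwx)).resolve_left fun h => ?_
        rw [hd'] at h
        cases h

theorem node_eq_inl {t : Terminal V J} {v : V} (h : t.node = .inl v) : t = .inl v := by
  rcases t with t | t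
  · exact congrArg _ (Sum.inl_injective h)
  · cases h

theorem node_eq_inr {t : Terminal V J} {j : J} (h : t.node = .inr j) :
    ∃ i, t = .inr (j, i) := by
  rcases t with t | ⟨j', i⟩
  · cases h
  · exact ⟨i, by rw [← Sum.inr_injective h]⟩

section Finite

variable [Finite V] [Finite J] [Finite E]

/-- A curve from the part ahead of a leg to the other side of it leaves the part ahead through the
source of the leg. -/
theorem Leg.exists_cut (hP : A.IsPlanar) (hA : A.IsTreeLike) (d : A.Leg) {γ : ℝ → Plane}
    {u v : V} (hγ : IsLocallyMonotone γ (A.vertexPos u) (A.vertexPos v))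
    (hsub : trace γ ⊆ A.carrier) (hu : .inl u ∈ d.ahead) (hv : .inl v ∉ d.ahead) :
    ∃ τ ∈ Icc (0 : ℝ) 1, γ τ = A.pos d.source ∧
      (∀ t ∈ Icc 0 τ, γ t ∈ trace (A.track d.track) ∪ A.part d.ahead) ∧
      ∀ t ∈ Icc τ 1, γ t ∈ A.part d.rev.ahead :=
  hγ.exists_cut ((isClosed_trace_track hP _).union (isClosed_part hP _)) (isClosed_part hP _)
    (hsub.trans (d.carrier_subset hA)) (d.cut hP hA) (Or.inr (vertexPos_mem_part hu))
    (vertexPos_mem_part ((d.mem_rev_ahead hA _).2 hv))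

/-- A curve between vertices that lie beyond the two tails of a `Λ`-junction does not exist: its
piece between the tails would stay within the junction. -/
theorem not_curve_between_tails (hP : A.IsPlanar) (hA : A.IsTreeLike) {γ : ℝ → Plane} {u v : V}
    (hγ : IsLocallyMonotone γ (A.vertexPos u) (A.vertexPos v)) (hsub : trace γ ⊆ A.carrier)
    {j : J} (hj : (A.junction j).kind = .lambda) {d₁ d₂ : A.Leg} (h₁ : d₁.source = .inr (j, 1))
    (h₂ : d₂.source = .inr (j, 2)) (hu : .inl u ∈ d₁.ahead) (hv : .inl v ∈ d₂.ahead) : False := by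
  obtain ⟨e, he, -⟩ := hP.port_track j 0
  obtain ⟨d₀, -, h₀⟩ := exists_leg he
  have n₀ : d₀.source.node = .inr j := by rw [h₀]; rfl
  have n₁ : d₁.source.node = .inr j := by rw [h₁]; rfl
  have n₂ : d₂.source.node = .inr j := by rw [h₂]; rfl
  have h01 : d₀ ≠ d₁ := by rintro rfl; simp [h₀] at h₁
  have h02 : d₀ ≠ d₂ := by rintro rfl; simp [h₀] at h₂
  have h12 : d₁ ≠ d₂ := by rintro rfl; simp [h₁] at h₂
  -- Exactly three legs leave the junction, since every port is the end of one track.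
  have hall : ∀ d : A.Leg, d.source.node = .inr j → d = d₀ ∨ d = d₁ ∨ d = d₂ := by
    intro d hd
    obtain ⟨i, hi⟩ := node_eq_inr hd
    have key : ∀ d' : A.Leg, d'.source = .inr (j, i) → d = d' := fun d' hd' =>
      Leg.eq_of_track_eq hA ((hP.port_track j i).unique (hi ▸ d.isEnd_source)
        (hd' ▸ d'.isEnd_source)) (by rw [hi, hd'])
    fin_cases i
    · exact Or.inl (key _ h₀)
    · exact Or.inr (Or.inl (key _ h₁))
    · exact Or.inr (Or.inr (key _ h₂))
  have hv₁ : .inl v ∉ d₁.ahead :=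
    Set.disjoint_right.1 (Leg.disjoint_ahead hA (n₁.trans n₂.symm) h12) hv
  have hu₂ : .inl u ∉ d₂.ahead :=
    Set.disjoint_left.1 (Leg.disjoint_ahead hA (n₁.trans n₂.symm) h12) hu
  have hu₀ : .inl u ∉ d₀.ahead :=
    Set.disjoint_right.1 (Leg.disjoint_ahead hA (n₀.trans n₁.symm) h01) hu
  have hv₀ : .inl v ∉ d₀.ahead :=
    Set.disjoint_right.1 (Leg.disjoint_ahead hA (n₀.trans n₂.symm) h02) hv
  obtain ⟨σ, hσ, hσ₁, hσ₂, hσ₃⟩ := d₁.exists_cut hP hA hγ hsub hu hv₁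
  obtain ⟨τ', hτ', hτ₁', hτ₂', hτ₃'⟩ := d₂.exists_cut hP hA hγ.reverse
    (by rwa [trace_reverse]) hv hu₂
  -- The curve leaves the side of `u` at time `σ`, and enters the side of `v` at time `τ`.
  set τ := 1 - τ' with hτdef
  have hτ : τ ∈ Icc (0 : ℝ) 1 := ⟨by linarith [hτ'.2], by linarith [hτ'.1]⟩
  have hτ₁ : γ τ = A.pos d₂.source := hτ₁'
  have hτ₂ : ∀ t ∈ Icc 0 τ, γ t ∈ A.part d₂.rev.ahead := fun t ht => by
    simpa using hτ₃' (1 - t) ⟨by linarith [ht.2], by linarith [ht.1]⟩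
  have hc := hγ.mem_of_cut (isClosed_part hP d₀.rev.ahead)
    ((isClosed_trace_track hP d₀.track).union (isClosed_part hP d₀.ahead))
    (hsub.trans ((d₀.carrier_subset hA).trans (union_comm _ _).subset))
    ((inter_comm _ _).subset.trans (d₀.cut hP hA))
    (vertexPos_mem_part ((d₀.mem_rev_ahead hA _).2 hu₀))
    (vertexPos_mem_part ((d₀.mem_rev_ahead hA _).2 hv₀))
  rw [h₁, pos_inr] at hσ₁
  rw [h₂, pos_inr] at hτ₁
  have hreg : ∀ d : A.Leg, d.source.node = .inr j →
      (A.junction j).region ⊆ A.part d.rev.ahead := fun d hd =>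
    region_subset_part (hd ▸ d.rev.target_mem_ahead hA)
  have hστ : σ < τ := by
    by_contra! hle
    have hm := hσ₂ τ ⟨hτ.1, hle⟩
    have := d₁.cut hP hA ⟨hm, hreg d₁ n₁ (hτ₁ ▸ (A.junction j).port_mem_region 2)⟩
    rw [h₁, pos_inr, mem_singleton_iff, hτ₁] at this
    exact absurd ((A.junction j).port_injective this) (by decide)
  -- A point that is on the junction's side of all three tracks lies in the junction.
  have hin : ∀ x, x ∈ A.carrier → x ∈ A.part d₀.rev.ahead → x ∈ A.part d₁.rev.ahead →
      x ∈ A.part d₂.rev.ahead → x ∈ (A.junction j).region := by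
    intro x hx hx0 hx1 hx2
    have hx' : ∀ d : A.Leg, d.source.node = .inr j → x ∈ A.part d.rev.ahead := by
      intro d hd
      rcases hall d hd with rfl | rfl | rfl <;> assumption
    have hcut : ∀ d : A.Leg, d.source.node = .inr j →
        x ∈ trace (A.track d.track) ∪ A.part d.ahead → x ∈ (A.junction j).region := by
      intro d hd hxd
      have h := d.cut hP hA ⟨hxd, hx' d hd⟩
      obtain ⟨i, hi⟩ := node_eq_inr hd
      rw [hi, pos_inr, mem_singleton_iff] at h
      exact h ▸ (A.junction j).port_mem_region i
    rcases hx with (⟨w, rfl⟩ | hx) | hx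
    · obtain ⟨d, hd, hn⟩ := exists_leg_ahead hA (by simp : (.inl w : V ⊕ J) ≠ .inr j)
      exact hcut d hd (Or.inr (vertexPos_mem_part hn))
    · obtain ⟨j', hx⟩ := mem_iUnion.1 hx
      by_cases hjj : j' = j
      · exact hjj ▸ hx
      · obtain ⟨d, hd, hn⟩ := exists_leg_ahead hA (by simpa : (.inr j' : V ⊕ J) ≠ .inr j)
        exact hcut d hd (Or.inr (region_subset_part hn hx))
    · obtain ⟨e, hx⟩ := mem_iUnion.1 hx
      obtain ⟨l, rfl, -⟩ := exists_leg (Or.inl rfl : A.IsEnd e (A.src e))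
      by_cases hl : l.source.node = .inr j
      · exact hcut l hl (Or.inl hx)
      · obtain ⟨d, hd, hn⟩ := exists_leg_ahead hA hl
        by_cases hm : l.target.node ∈ d.ahead
        · exact hcut d hd (Or.inr (trace_subset_part hn hm hx))
        · have := Leg.eq_of_crossing hA (d := d) (d' := l.rev) hm hn
          exact hcut d hd (Or.inl (this ▸ hx))
  refine (A.junction j).tails_disconnected hj ⟨_, hσ₁ ▸ hτ₁ ▸ hγ.restrict hσ.1 hστ hτ.2, ?_⟩
  rintro _ ⟨s, hs, rfl⟩
  set t := σ + (τ - σ) * s with ht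
  have ht1 : σ ≤ t := by nlinarith [hs.1]
  have ht2 : t ≤ τ := by nlinarith [hs.2]
  have ht01 : t ∈ Icc (0 : ℝ) 1 := ⟨hσ.1.trans ht1, ht2.trans hτ.2⟩
  exact hin _ (hsub ⟨t, ht01, rfl⟩) (hc t ht01) (hσ₃ t ⟨ht1, ht01.2⟩) (hτ₂ t ⟨ht01.1, ht2⟩)

/-- A curve between two vertices that lie beyond different ports of a junction shows that the ports
are connected inside the junction. -/
theorem linked_of_curve (hP : A.IsPlanar) (hA : A.IsTreeLike) {γ : ℝ → Plane} {u v : V}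
    (hγ : IsLocallyMonotone γ (A.vertexPos u) (A.vertexPos v)) (hsub : trace γ ⊆ A.carrier)
    {j : J} {d d' : A.Leg} {i k : Fin 3} (h : d.source = .inr (j, i))
    (h' : d'.source = .inr (j, k)) (hne : d ≠ d') (hu : .inl u ∈ d.ahead)
    (hv : .inl v ∈ d'.ahead) : (A.junction j).kind.Linked i k := by
  have hik : i ≠ k := by
    rintro rfl
    exact hne (Leg.eq_of_track_eq hA ((hP.port_track j i).unique (h ▸ d.isEnd_source)
        (h' ▸ d'.isEnd_source)) (by rw [h, h']))
  rcases hk : (A.junction j).kind with _ | _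
  · exact lt_or_gt_of_ne hik
  · have key : (i = 1 ∧ k = 2) ∨ (i = 2 ∧ k = 1) ∨ i = 0 ∧ 0 < k ∨ k = 0 ∧ 0 < i := by
      clear h h'
      revert i k
      decide
    rcases key with ⟨rfl, rfl⟩ | ⟨rfl, rfl⟩ | ⟨rfl, hk⟩ | ⟨rfl, hi⟩
    · exact (not_curve_between_tails hP hA hγ hsub hk h h' hu hv).elim
    · exact (not_curve_between_tails hP hA hγ.reverse (by rwa [trace_reverse]) hk h' h hv hu).elim
    · exact Or.inl ⟨rfl, hk⟩
    · exact Or.inr ⟨rfl, hi⟩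

/-- In a tree the curve has no choice of tracks: at every junction it must take the track that leads
towards `v`, and by the previous lemma the junction connects the two ports. -/
theorem route_of_curve (hP : A.IsPlanar) (hA : A.IsTreeLike) {γ : ℝ → Plane} {u v : V}
    (hγ : IsLocallyMonotone γ (A.vertexPos u) (A.vertexPos v)) (hsub : trace γ ⊆ A.carrier)
    (hw : ∀ w, A.vertexPos w ∈ trace γ → w = u ∨ w = v) : A.Route u v := by
  have huv : (.inl v : V ⊕ J) ≠ .inl u := by
    intro h
    exact hγ.ne (by rw [Sum.inl_injective h])
  obtain ⟨d, hd, hvd⟩ := exists_leg_ahead hA huv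
  have hd' : d.source = .inl u := node_eq_inl hd
  -- Follow the legs in whose direction `v` lies; the side ahead shrinks at each step.
  have key : ∀ (n : ℕ) (m : A.Leg), m.ahead.ncard = n → d.Leads m → .inl u ∉ m.ahead →
      .inl v ∈ m.ahead → A.Route u v := by
    intro n
    induction n using Nat.strong_induction_on with
    | _ n ih =>
    intro m hn hdm hum hvm
    rcases hmt : m.target with w | ⟨j, i⟩
    · obtain ⟨τ, hτ, hτw, -⟩ := m.rev.exists_cut hP hA hγ hsub
        ((m.mem_rev_ahead hA _).2 hum) ((m.rev.mem_rev_ahead hA _).1 hvm)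
      rw [Leg.rev_source, hmt, pos_inl] at hτw
      have hwm : .inl w ∈ m.ahead := by
        have := m.target_mem_ahead hA
        rwa [hmt] at this
      rcases hw w ⟨τ, hτ, hτw⟩ with rfl | rfl
      · exact absurd hwm hum
      · exact ⟨d, m, hd', hmt, hdm⟩
    · obtain ⟨d', hs, hvd'⟩ := exists_leg_ahead hA (by simp : (.inl v : V ⊕ J) ≠ .inr j)
      obtain ⟨k, hk⟩ := node_eq_inr hs
      have hne : m.rev ≠ d' := by
        rintro rfl
        exact (m.mem_rev_ahead hA _).1 hvd' hvm
      have hlt := Leg.ahead_ssubset hA (d := m) (d' := d') (by rw [hmt, hk]; rfl) hne.symm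
      refine ih _ ?_ d' rfl (Relation.ReflTransGen.tail hdm ⟨j, i, k, hmt, hk, ?_⟩)
        (fun h => hum (hlt.subset h)) hvd'
      · rw [← hn]
        exact Set.ncard_lt_ncard hlt (Set.toFinite _)
      · exact linked_of_curve hP hA hγ hsub (d := m.rev) hmt hk hne
          ((m.mem_rev_ahead hA _).2 hum) hvd'
  exact key _ d rfl .refl (hd ▸ d.source_notMem_ahead) hvd

/-- In a planar tree-like drawing, the curves that define adjacency exist exactly along routes. -/
theorem exists_curve_iff_route (hP : A.IsPlanar) (hA : A.IsTreeLike) (u v : V) :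
    (∃ γ, IsLocallyMonotone γ (A.vertexPos u) (A.vertexPos v) ∧ trace γ ⊆ A.carrier ∧
      ∀ w, A.vertexPos w ∈ trace γ → w = u ∨ w = v) ↔ A.Route u v := by
  constructor
  · rintro ⟨γ, h1, h2, h3⟩
    exact route_of_curve hP hA h1 h2 h3
  · rintro ⟨d, d', h1, h2, h3⟩
    obtain ⟨γ, hγ, hsub, -, hw⟩ := h3.exists_curve hP hA
    rw [h1, h2] at hγ hw
    refine ⟨γ, hγ, hsub.trans (union_subset (trace_subset_carrier _) (part_subset_carrier _)),
      fun w hw' => ?_⟩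
    simpa using hw w hw'

theorem represents_iff (hP : A.IsPlanar) (hA : A.IsTreeLike) (G : SimpleGraph V) :
    A.Represents G ↔ ∀ u v, G.Adj u v ↔ A.Route u v :=
  forall₂_congr fun u v => by rw [exists_curve_iff_route hP hA]

end Finite

end Drawing

/-! ### Induced paths and pruning pairs -/

namespace SimpleGraph

variable {V : Type*} {G : SimpleGraph V}

theorem pathGraph_dist {n : ℕ} {i j : Fin n} (h : i ≤ j) :
    (pathGraph n).dist i j = (j : ℕ) - i := by
  have hle : ∀ (k : ℕ) (j : Fin n), (j : ℕ) = i + k → ∃ w : (pathGraph n).Walk i j,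
      w.length = k := by
    intro k
    induction k with
    | zero =>
      intro j hj
      obtain rfl : j = i := Fin.ext hj
      exact ⟨.nil, rfl⟩
    | succ k ih =>
      intro j hj
      obtain ⟨w, hw⟩ := ih ⟨i + k, by omega⟩ rfl
      refine ⟨w.concat (pathGraph_adj.2 (Or.inl (by simp; omega))), by simp [hw]⟩
  have hge : ∀ {i j : Fin n} (w : (pathGraph n).Walk i j), (j : ℕ) ≤ i + w.length := by
    intro i j w
    induction w with
    | nil => simp
    | cons h w ih =>
      rw [pathGraph_adj] at h
      rw [Walk.length_cons]
      omega
  obtain ⟨w, hw⟩ := hle ((j : ℕ) - i) j (by have : (i : ℕ) ≤ j := h; omega)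
  refine le_antisymm (hw ▸ dist_le w) ?_
  obtain ⟨w', hw'⟩ := w.reachable.exists_walk_length_eq_dist
  have := hge w'
  omega

/-- The vertices `p 0, …, p n` form an induced path. -/
def IsInducedPath (G : SimpleGraph V) (p : ℕ → V) (n : ℕ) : Prop :=
  ∀ i j, i < j → j ≤ n → p i ≠ p j ∧ (G.Adj (p i) (p j) ↔ j = i + 1)

/-- The vertices `q 0, …, q m` form a walk that may also pause. -/
def IsLazyWalk (G : SimpleGraph V) (q : ℕ → V) (m : ℕ) : Prop :=
  ∀ i < m, q i = q (i + 1) ∨ G.Adj (q i) (q (i + 1))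

theorem IsInducedPath.adj_iff {p : ℕ → V} {n : ℕ} (h : G.IsInducedPath p n) {i j : ℕ}
    (hi : i ≤ n) (hj : j ≤ n) : G.Adj (p i) (p j) ↔ j = i + 1 ∨ i = j + 1 := by
  rcases lt_trichotomy i j with hij | rfl | hij
  · rw [(h i j hij hj).2]
    omega
  · simp
  · rw [G.adj_comm, (h j i hij hi).2]
    omega

theorem IsInducedPath.eq_of_eq {p : ℕ → V} {n : ℕ} (h : G.IsInducedPath p n) {i j : ℕ}
    (hi : i ≤ n) (hj : j ≤ n) (hij : p i = p j) : i = j := by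
  by_contra hne
  rcases lt_or_gt_of_ne hne with h' | h'
  · exact (h i j h' hj).1 hij
  · exact (h j i h' hi).1 hij.symm

theorem _root_.isDistanceHereditary_iff : IsDistanceHereditary G ↔
    G.Connected ∧ ∀ p n, G.IsInducedPath p n → n ≤ G.dist (p 0) (p n) := by
  refine and_congr_right fun hG => ⟨fun h p n hp => ?_, fun h n f i j => ?_⟩
  · have hinj : Function.Injective fun i : Fin (n + 1) => p i := fun i j hij =>
      Fin.ext (hp.eq_of_eq (by omega) (by omega) hij)
    have hadj : ∀ {i j : Fin (n + 1)}, G.Adj (p i) (p j) ↔ (pathGraph (n + 1)).Adj i j := by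
      intro i j
      rw [hp.adj_iff (by omega) (by omega), pathGraph_adj]
      omega
    have hf := h (n + 1) ⟨⟨_, hinj⟩, hadj⟩ 0 (Fin.last n)
    rw [pathGraph_dist (Fin.zero_le _)] at hf
    have hf' : n - 0 = G.dist (p 0) (p n) := hf
    omega
  · wlog hij : i ≤ j generalizing i j
    · rw [dist_comm, G.dist_comm]
      exact this j i (le_of_not_ge hij)
    refine le_antisymm ?_ ?_
    · have := h (fun k => f ⟨min (i + k) j, by omega⟩) ((j : ℕ) - i) fun a b hab hb => by
        refine ⟨fun hf => ?_, ?_⟩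
        · have h1 := Fin.ext_iff.1 (f.injective hf)
          simp only at h1
          omega
        · rw [f.map_adj_iff, pathGraph_adj]
          simp only
          omega
      have hle : (i : ℕ) ≤ j := hij
      have h1 : (⟨min (i + 0) j, by omega⟩ : Fin n) = i := Fin.ext (by simpa using hle)
      have h2 : (⟨min (i + (j - i)) j, by omega⟩ : Fin n) = j := Fin.ext (by simp; omega)
      simp only [h1, h2] at this
      rwa [pathGraph_dist hij]
    · have hr : (pathGraph n).Reachable i j := pathGraph_preconnected n i j
      obtain ⟨w, hw⟩ := hr.exists_walk_length_eq_dist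
      rw [← hw, ← w.length_map f.toHom]
      exact dist_le _

/-- Within the vertex set `S`, the vertices `x` and `y` are twins, or `x` has no neighbour other
than `y`. -/
def IsPruningPair (G : SimpleGraph V) (S : Set V) (x y : V) : Prop :=
  x ∈ S ∧ y ∈ S ∧ x ≠ y ∧ ((∀ z ∈ S, z ≠ x → z ≠ y → (G.Adj x z ↔ G.Adj y z)) ∨
    ∀ z ∈ S, G.Adj x z → z = y)

theorem IsPruningPair.dominated {S : Set V} {x y z : V} (h : G.IsPruningPair S x y) (hz : z ∈ S)
    (hxz : G.Adj x z) : z = y ∨ G.Adj y z := by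
  rcases h.2.2.2 with h' | h'
  · exact or_iff_not_imp_left.2 fun hzy => (h' z hz hxz.ne' hzy).1 hxz
  · exact Or.inl (h' z hz hxz)

open Classical in
/-- The retraction that moves `x` to `y` and fixes all other vertices. -/
noncomputable def fold (x y z : V) : V := if z = x then y else z

theorem fold_self (x y : V) : fold x y x = y := if_pos rfl

theorem fold_of_ne {x y z : V} (h : z ≠ x) : fold x y z = z := if_neg h

theorem IsPruningPair.fold_mem {S : Set V} {x y z : V} (h : G.IsPruningPair S x y) (hz : z ∈ S) :
    fold x y z ∈ S \ {x} := by
  by_cases hzx : z = x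
  · rw [hzx, fold_self]
    exact ⟨h.2.1, h.2.2.1.symm⟩
  · rw [fold_of_ne hzx]
    exact ⟨hz, hzx⟩

theorem IsPruningPair.fold_adj {S : Set V} {x y z w : V} (h : G.IsPruningPair S x y) (hz : z ∈ S)
    (hw : w ∈ S) (hzw : G.Adj z w) :
    fold x y z = fold x y w ∨ G.Adj (fold x y z) (fold x y w) := by
  by_cases hzx : z = x
  · subst hzx
    rw [fold_self, fold_of_ne hzw.ne']
    exact (h.dominated hw hzw).imp_left Eq.symm
  · by_cases hwx : w = x
    · subst hwx
      rw [fold_self, fold_of_ne hzw.ne]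
      exact (h.dominated hz hzw.symm).imp_right Adj.symm
    · rw [fold_of_ne hzx, fold_of_ne hwx]
      exact Or.inr hzw

theorem IsPruningPair.fold_lazyWalk {S : Set V} {x y : V} (h : G.IsPruningPair S x y) {q : ℕ → V}
    {m : ℕ} (hq : G.IsLazyWalk q m) (hqS : ∀ i ≤ m, q i ∈ S) :
    G.IsLazyWalk (fun i => fold x y (q i)) m := fun i hi =>
  (hq i hi).elim (fun e => Or.inl (congrArg _ e)) fun e =>
    h.fold_adj (hqS i hi.le) (hqS (i + 1) hi) e

/-- If every vertex set contains a pruning pair, an induced path is no longer than any walk between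
its ends. The walk is folded onto fewer vertices, together with the path if need be. -/
theorem IsInducedPath.le_of_pruning [Finite V]
    (hG : ∀ S : Set V, 2 ≤ S.ncard → ∃ x y, G.IsPruningPair S x y) (S : Set V) {p q : ℕ → V}
    {n m : ℕ} (hp : G.IsInducedPath p n) (hq : G.IsLazyWalk q m) (hpS : ∀ i ≤ n, p i ∈ S)
    (hqS : ∀ i ≤ m, q i ∈ S) (h0 : q 0 = p 0) (h1 : q m = p n) : n ≤ m := by
  induction hk : S.ncard using Nat.strong_induction_on generalizing S p q n m with
  | _ k ih =>
  -- Paths with at most three vertices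
  have hshort : n ≤ 2 → n ≤ m := by
    intro hn
    rcases Nat.eq_zero_or_pos n with h | hpos
    · omega
    have hne := (hp 0 n hpos le_rfl).1
    rcases m with _ | _ | m
    · exact absurd (h0.symm.trans h1) hne
    · rcases hq 0 one_pos with h | h
      · exact absurd (h0.symm.trans (h.trans h1)) hne
      · rw [h0, zero_add, h1, (hp 0 n hpos le_rfl).2] at h
        omega
    · omega
  rcases Nat.eq_zero_or_pos n with rfl | hpos
  · exact Nat.zero_le _
  have hends := (hp 0 n hpos le_rfl).1
  obtain ⟨x, y, hxy⟩ := hG S (by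
    rw [← Set.ncard_pair hends]
    exact Set.ncard_le_ncard (by
      rintro z (rfl | rfl)
      · exact hpS 0 (Nat.zero_le _)
      · exact hpS n le_rfl) (Set.toFinite _))
  have hlt : (S \ {x}).ncard < k := hk ▸ Set.ncard_sdiff_singleton_lt_of_mem hxy.1
  have hq' := hxy.fold_lazyWalk hq hqS
  have hqS' : ∀ i ≤ m, fold x y (q i) ∈ S \ {x} := fun i hi => hxy.fold_mem (hqS i hi)
  by_cases hx : ∃ a ≤ n, p a = x
  swap
  · push Not at hx
    exact ih _ hlt (S \ {x}) hp hq' (fun i hi => ⟨hpS i hi, hx i hi⟩) hqS'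
      (by rw [h0, fold_of_ne (hx 0 (Nat.zero_le _))]) (by rw [h1, fold_of_ne (hx n le_rfl)]) rfl
  obtain ⟨a, ha, hpa⟩ := hx
  rcases hxy.2.2.2 with htw | hpend
  · by_cases hy : ∃ b ≤ n, p b = y
    · obtain ⟨b, hb, hpb⟩ := hy
      have hab : a ≠ b := by
        rintro rfl
        exact hxy.2.2.1 (hpa.symm.trans hpb)
      have key : ∀ c ≤ n, c ≠ a → c ≠ b → ((c = a + 1 ∨ a = c + 1) ↔ (c = b + 1 ∨ b = c + 1)) := by
        intro c hc hca hcb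
        rw [← hp.adj_iff ha hc, ← hp.adj_iff hb hc, hpa, hpb]
        refine htw _ (hpS c hc) (fun h => hca ?_) fun h => hcb ?_
        · exact hp.eq_of_eq hc ha (h.trans hpa.symm)
        · exact hp.eq_of_eq hc hb (h.trans hpb.symm)
      have k1 := key (a + 1)
      have k2 := key (a - 1)
      have k3 := key (b + 1)
      have k4 := key (b - 1)
      -- Two vertices of a path with the same neighbours on it, other than themselves, are the ends
      -- of a path with two or three vertices.
      apply hshort
      omega
    · -- The vertex `y` can take the place of its twin `x` on the path.
      push Not at hy
      have hp' : G.IsInducedPath (fun i => fold x y (p i)) n := by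
        intro i j hij hj
        have hij' := hp i j hij hj
        by_cases hi : p i = x
        · have hjx : p j ≠ x := fun h => hij'.1 (hi.trans h.symm)
          simp only [hi, fold_self, fold_of_ne hjx]
          refine ⟨(hy j hj).symm, ?_⟩
          rw [← htw _ (hpS j hj) hjx (hy j hj), ← hi]
          exact hij'.2
        · by_cases hjx : p j = x
          · simp only [hjx, fold_self, fold_of_ne hi]
            refine ⟨hy i (by omega), ?_⟩
            rw [G.adj_comm, ← htw _ (hpS i (by omega)) hi (hy i (by omega)), ← hjx, G.adj_comm]
            exact hij'.2
          · simpa only [fold_of_ne hi, fold_of_ne hjx] using hij'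
      exact ih _ hlt (S \ {x}) hp' hq' (fun i hi => hxy.fold_mem (hpS i hi)) hqS'
        (by rw [h0]) (by rw [h1]) rfl
  · -- The vertex `x` is pendant at `y` in the path, so it is one of the ends of the path.
    have hm : 0 < m := by
      rcases Nat.eq_zero_or_pos m with rfl | h
      · exact absurd (h0.symm.trans h1) hends
      · exact h
    have hnb : ∀ c ≤ n, c = a + 1 ∨ a = c + 1 → p c = y := fun c hc hca =>
      hpend _ (hpS c hc) (hpa ▸ (hp.adj_iff ha hc).2 hca)
    have hqx : ∀ c ≤ m, q c = x ∨ G.Adj x (q c) → fold x y (q c) = y := by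
      rintro c hc (h | h)
      · rw [h, fold_self]
      · rw [fold_of_ne h.ne', hpend _ (hqS c hc) h]
    have hpx : ∀ c ≤ n, c ≠ a → p c ≠ x := fun c hc hca h =>
      hca (hp.eq_of_eq hc ha (h.trans hpa.symm))
    by_cases ha0 : a = 0
    · subst ha0
      have : n - 1 ≤ m - 1 := ih _ hlt (S \ {x}) (p := fun i => p (i + 1))
        (q := fun i => fold x y (q (i + 1))) (fun i j hij hj => by
          have := hp (i + 1) (j + 1) (by omega) (by omega)
          rwa [Nat.add_right_cancel_iff] at this)
        (fun i hi => hq' (i + 1) (by omega))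
        (fun i hi => ⟨hpS _ (by omega), hpx _ (by omega) (by omega)⟩)
        (fun i hi => hqS' _ (by omega))
        (by
          rw [hqx _ (by omega), hnb 1 (by omega) (by omega)]
          rw [← hpa, ← h0]
          exact (hq 0 hm).imp_left Eq.symm)
        (by
          simp only [Nat.sub_add_cancel hm, Nat.sub_add_cancel hpos]
          rw [h1, fold_of_ne (hpx n le_rfl (by omega))]) rfl
      omega
    · have han : a = n := by
        by_contra hne
        have h2 := (hnb (a - 1) (by omega) (by omega)).trans
          (hnb (a + 1) (by omega) (by omega)).symm
        have := hp.eq_of_eq (by omega) (by omega) h2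
        omega
      subst han
      have : a - 1 ≤ m - 1 := ih _ hlt (S \ {x}) (p := p) (q := fun i => fold x y (q i))
        (fun i j hij hj => hp i j hij (by omega))
        (fun i hi => hq' i (by omega))
        (fun i hi => ⟨hpS _ (by omega), hpx _ (by omega) (by omega)⟩)
        (fun i hi => hqS' _ (by omega))
        (by simp only [h0]; rw [fold_of_ne (hpx 0 (by omega) (by omega))])
        (by
          rw [hqx _ (by omega), hnb (a - 1) (by omega) (by omega)]
          have := hq (m - 1) (by omega)
          rw [Nat.sub_add_cancel hm, h1, hpa] at this
          exact this.imp_right Adj.symm) rfl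
      omega

/-- A connected graph, every vertex set of which contains a pruning pair, is
distance-hereditary. -/
theorem Connected.isDistanceHereditary_of_pruning [Finite V] (hG : G.Connected)
    (h : ∀ S : Set V, 2 ≤ S.ncard → ∃ x y, G.IsPruningPair S x y) : IsDistanceHereditary G := by
  refine isDistanceHereditary_iff.2 ⟨hG, fun p n hp => ?_⟩
  obtain ⟨w, hw⟩ := hG.exists_walk_length_eq_dist (p 0) (p n)
  rw [← hw]
  exact hp.le_of_pruning h Set.univ (q := w.getVert) (fun i hi => Or.inr (w.adj_getVert_succ hi))
    (fun _ _ => trivial) (fun _ _ => trivial) w.getVert_zero w.getVert_length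

/-! ### Distance-hereditary graphs have pruning pairs -/

/-- Removing the first vertex of a pruning pair keeps a graph distance-hereditary. -/
theorem _root_.IsDistanceHereditary.induce_compl {x y : V} (hG : IsDistanceHereditary G)
    (h : G.IsPruningPair Set.univ x y) : IsDistanceHereditary (G.induce {x}ᶜ) := by
  rw [isDistanceHereditary_iff] at hG ⊢
  have hf : ∀ z, fold x y z ∈ ({x}ᶜ : Set V) := fun z => (h.fold_mem (z := z) trivial).2
  have hwalk : ∀ {u v : V}, G.Walk u v →
      (G.induce {x}ᶜ).Reachable ⟨fold x y u, hf u⟩ ⟨fold x y v, hf v⟩ := by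
    intro u v w
    induction w with
    | nil => exact .refl _
    | @cons a b c hab w ih =>
      refine Reachable.trans ?_ ih
      rcases h.fold_adj trivial trivial hab with h' | h'
      · simp [h']
      · exact Adj.reachable (G := G.induce {x}ᶜ) h'
  have hconn : (G.induce {x}ᶜ).Connected := by
    refine (connected_iff _).2 ⟨fun a b => ?_, ⟨y, h.2.2.1.symm⟩⟩
    obtain ⟨w⟩ := hG.1.preconnected a b
    have := hwalk w
    simpa only [fold_of_ne a.2, fold_of_ne b.2] using this
  refine ⟨hconn, fun p n hp => ?_⟩
  have h1 := hG.2 (fun i => p i) n fun i j hij hj => by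
    have := hp i j hij hj
    exact ⟨fun e => this.1 (Subtype.ext e), this.2⟩
  obtain ⟨w, hw⟩ := hconn.exists_walk_length_eq_dist (p 0) (p n)
  rw [← hw]
  refine h1.trans ?_
  rw [← w.length_map (Embedding.induce {x}ᶜ).toHom]
  exact dist_le _

/-- There is no induced path on four vertices in `S`. -/
def IsP4FreeOn (G : SimpleGraph V) (S : Set V) : Prop :=
  ∀ a ∈ S, ∀ b ∈ S, ∀ c ∈ S, ∀ d ∈ S, a ≠ c → a ≠ d → b ≠ d → G.Adj a b → G.Adj b c → G.Adj c d →
    ¬ G.Adj a c → ¬ G.Adj b d → G.Adj a d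

theorem IsP4FreeOn.mono {S T : Set V} (h : G.IsP4FreeOn T) (hST : S ⊆ T) : G.IsP4FreeOn S :=
  fun a ha b hb c hc d hd => h a (hST ha) b (hST hb) c (hST hc) d (hST hd)

theorem IsP4FreeOn.compl {S : Set V} (h : G.IsP4FreeOn S) : Gᶜ.IsP4FreeOn S := by
  intro a ha b hb c hc d hd hac had hbd hab hbc hcd nac nbd
  rw [compl_adj] at *
  refine ⟨had, fun h' => ?_⟩
  have hac' : G.Adj a c := by by_contra hn; exact nac ⟨hac, hn⟩
  have hbd' : G.Adj b d := by by_contra hn; exact nbd ⟨hbd, hn⟩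
  -- The complement of the path `a b c d` is the path `b d a c`.
  exact hbc.2 (h b hb d hd a ha c hc hab.1.symm hbc.1 hcd.1.symm hbd' h'.symm hac'
    (fun h => hab.2 h.symm) fun h => hcd.2 h.symm)

/-- A vertex set splits into two nonempty parts with no edges between them. -/
def IsSplitOn (G : SimpleGraph V) (S : Set V) : Prop :=
  ∃ A B : Set V, A.Nonempty ∧ B.Nonempty ∧ A ∪ B = S ∧ Disjoint A B ∧
    ∀ a ∈ A, ∀ b ∈ B, ¬ G.Adj a b

theorem IsP4FreeOn.split_insert {S : Set V} {x : V} (hx : x ∉ S) (h : G.IsP4FreeOn (insert x S))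
    (hS : G.IsSplitOn S) : G.IsSplitOn (insert x S) ∨ Gᶜ.IsSplitOn (insert x S) := by
  obtain ⟨A, B, hA, hB, rfl, hAB, hno⟩ := hS
  have main : ∀ A B : Set V, x ∉ A ∪ B → G.IsP4FreeOn (insert x (A ∪ B)) → Disjoint A B →
      (∀ a ∈ A, ∀ b ∈ B, ¬ G.Adj a b) → (∃ b ∈ B, G.Adj x b) → (∃ a ∈ A, ¬ G.Adj x a) →
      G.IsSplitOn (insert x (A ∪ B)) := by
    rintro A B hx h hAB hno ⟨b, hb, hxb⟩ ⟨a, ha, hxa⟩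
    -- If a non-neighbour of `x` in `A` had a neighbour `c` of `x` in `A`, then `b x c a'` would be
    -- an induced path; so the non-neighbours of `x` in `A` are separated from everything else.
    refine ⟨{a' ∈ A | ¬ G.Adj x a'}, insert x (B ∪ {c ∈ A | G.Adj x c}), ⟨a, ha, hxa⟩,
      ⟨x, mem_insert _ _⟩, ?_, ?_, ?_⟩
    · ext z
      simp only [mem_union, mem_insert_iff, mem_ofPred_eq]
      tauto
    · rw [Set.disjoint_left]
      rintro z ⟨hz, hxz⟩ (rfl | hz' | hz')
      · exact hx (Or.inl hz)
      · exact Set.disjoint_left.1 hAB hz hz'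
      · exact hxz hz'.2
    · rintro a' ⟨ha', hxa'⟩ c (rfl | hc | ⟨hc, hxc⟩) hadj
      · exact hxa' hadj.symm
      · exact hno _ ha' _ hc hadj
      · have hne : ∀ z ∈ A, b ≠ z := fun z hz hbz =>
          Set.disjoint_left.1 hAB hz (hbz ▸ hb)
        have hxa'' : x ≠ a' := fun h => hx (Or.inl (h ▸ ha'))
        exact hno _ ha' _ hb (h b (by simp [hb]) x (by simp) c (by simp [hc]) a' (by simp [ha'])
          (hne c hc) (hne a' ha') hxa'' hxb.symm hxc hadj.symm
          (fun h => hno _ hc _ hb h.symm) hxa').symm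
  by_cases h1 : ∃ b ∈ B, G.Adj x b
  swap
  · push Not at h1
    refine Or.inl ⟨insert x A, B, ⟨x, mem_insert _ _⟩, hB, by rw [insert_union], ?_, ?_⟩
    · rw [Set.disjoint_insert_left]
      exact ⟨fun h => hx (Or.inr h), hAB⟩
    · rintro a (rfl | ha) b hb
      · exact h1 b hb
      · exact hno a ha b hb
  by_cases h2 : ∃ a ∈ A, G.Adj x a
  swap
  · push Not at h2
    refine Or.inl ⟨A, insert x B, hA, ⟨x, mem_insert _ _⟩, by rw [union_insert], ?_, ?_⟩
    · rw [Set.disjoint_insert_right]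
      exact ⟨fun h => hx (Or.inl h), hAB⟩
    · rintro a ha b (rfl | hb) hab
      · exact h2 a ha hab.symm
      · exact hno a ha b hb hab
  by_cases h3 : ∃ a ∈ A, ¬ G.Adj x a
  · exact Or.inl (main A B hx h hAB hno h1 h3)
  by_cases h4 : ∃ b ∈ B, ¬ G.Adj x b
  · rw [union_comm] at *
    exact Or.inl (main B A hx h hAB.symm (fun b hb a ha hab => hno a ha b hb hab.symm) h2 h4)
  · push Not at h3 h4
    refine Or.inr ⟨{x}, A ∪ B, singleton_nonempty x, hA.inl, rfl,
      Set.disjoint_singleton_left.2 hx, ?_⟩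
    rintro _ rfl b (hb | hb) hxb
    · exact hxb.2 (h3 b hb)
    · exact hxb.2 (h4 b hb)

/-- A set with at least two vertices and no induced path on four vertices splits in the graph or in
its complement. -/
theorem IsP4FreeOn.split {S : Set V} (hfin : S.Finite) (h : G.IsP4FreeOn S) (h2 : S.Nontrivial) :
    G.IsSplitOn S ∨ Gᶜ.IsSplitOn S := by
  induction S, hfin using Set.Finite.induction_on with
  | empty => exact absurd h2 Set.not_nontrivial_empty
  | @insert x S hx _ ih =>
    by_cases hS : S.Nontrivial
    · rcases ih (h.mono (subset_insert _ _)) hS with h' | h'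
      · exact h.split_insert hx h'
      · have := h.compl.split_insert hx h'
        rwa [compl_compl, or_comm] at this
    · rw [Set.not_nontrivial_iff] at hS
      have hne : S.Nonempty := by
        by_contra hS'
        rw [Set.not_nonempty_iff_eq_empty] at hS'
        subst hS'
        simp at h2
      obtain ⟨y, hy⟩ := hne
      obtain rfl := hS.eq_singleton_of_mem hy
      have hxy : x ≠ y := hx
      by_cases hadj : G.Adj x y
      · refine Or.inr ⟨{x}, {y}, singleton_nonempty _, singleton_nonempty _, rfl,
          by simpa using hxy, ?_⟩
        rintro _ rfl _ rfl h'
        exact h'.2 hadj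
      · refine Or.inl ⟨{x}, {y}, singleton_nonempty _, singleton_nonempty _, rfl,
          by simpa using hxy, ?_⟩
        rintro _ rfl _ rfl h'
        exact hadj h'

/-- A finite set with at least two vertices and no induced path on four vertices contains two
vertices that are twins within the set. -/
theorem IsP4FreeOn.exists_twins {S : Set V} (hfin : S.Finite) (h : G.IsP4FreeOn S)
    (h2 : S.Nontrivial) : ∃ x ∈ S, ∃ y ∈ S, x ≠ y ∧
      ∀ z ∈ S, z ≠ x → z ≠ y → (G.Adj x z ↔ G.Adj y z) := by
  induction hk : S.ncard using Nat.strong_induction_on generalizing S with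
  | _ k ih =>
  have key : ∃ A B : Set V, A.Nonempty ∧ B.Nonempty ∧ A ∪ B = S ∧ Disjoint A B ∧
      ∃ c : Prop, ∀ a ∈ A, ∀ b ∈ B, (G.Adj a b ↔ c) := by
    rcases h.split hfin h2 with ⟨A, B, hA, hB, hS, hAB, hno⟩ | ⟨A, B, hA, hB, hS, hAB, hno⟩
    · exact ⟨A, B, hA, hB, hS, hAB, False, fun a ha b hb => iff_false_intro (hno a ha b hb)⟩
    · refine ⟨A, B, hA, hB, hS, hAB, True, fun a ha b hb => iff_true_intro ?_⟩
      by_contra hn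
      refine hno a ha b hb ⟨?_, hn⟩
      rintro rfl
      exact Set.disjoint_left.1 hAB ha hb
  -- Twins of a part that is uniformly joined to the other part are twins of the whole.
  have main : ∀ A B : Set V, B.Nonempty → A ∪ B = S → Disjoint A B →
      (∃ c : Prop, ∀ a ∈ A, ∀ b ∈ B, (G.Adj a b ↔ c)) → A.Nontrivial → ∃ x ∈ S, ∃ y ∈ S, x ≠ y ∧
      ∀ z ∈ S, z ≠ x → z ≠ y → (G.Adj x z ↔ G.Adj y z) := by
    rintro A B ⟨b, hb⟩ rfl hAB ⟨c, hc⟩ hA2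
    have hlt : A.ncard < k := by
      rw [← hk]
      refine Set.ncard_lt_ncard ⟨subset_union_left, fun hsub => ?_⟩ hfin
      exact Set.disjoint_left.1 hAB (hsub (Or.inr hb)) hb
    obtain ⟨x, hx, y, hy, hxy, htw⟩ := ih _ hlt (hfin.subset subset_union_left)
      (h.mono subset_union_left) hA2 rfl
    refine ⟨x, Or.inl hx, y, Or.inl hy, hxy, ?_⟩
    rintro z (hz | hz) hzx hzy
    · exact htw z hz hzx hzy
    · rw [hc x hx z hz, hc y hy z hz]
  obtain ⟨A, B, hA, hB, hS, hAB, c, hc⟩ := key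
  by_cases hA2 : A.Nontrivial
  · exact main A B hB hS hAB ⟨c, hc⟩ hA2
  by_cases hB2 : B.Nontrivial
  · exact main B A hA (by rw [union_comm, hS]) hAB.symm
      ⟨c, fun b hb a ha => by rw [G.adj_comm]; exact hc a ha b hb⟩ hB2
  rw [Set.not_nontrivial_iff] at hA2 hB2
  obtain ⟨a, ha⟩ := hA
  obtain ⟨b, hb⟩ := hB
  have hab : a ≠ b := by
    rintro rfl
    exact Set.disjoint_left.1 hAB ha hb
  refine ⟨a, hS ▸ Or.inl ha, b, hS ▸ Or.inr hb, hab, fun z hz hza hzb => ?_⟩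
  rw [← hS] at hz
  rcases hz with hz | hz
  · exact absurd (hA2 hz ha) hza
  · exact absurd (hB2 hz hb) hzb

end SimpleGraph

namespace SimpleGraph

variable {V : Type*} {G : SimpleGraph V}

theorem dist_le_two {a b c : V} (hab : G.Adj a b) (hbc : G.Adj b c) : G.dist a c ≤ 2 :=
  dist_le (.cons hab (.cons hbc .nil))

theorem isInducedPath_three {a b c : V} (hab : G.Adj a b) (hbc : G.Adj b c) (hac : a ≠ c)
    (nac : ¬ G.Adj a c) : G.IsInducedPath (fun | 0 => a | 1 => b | _ => c) 2 := by
  intro i j hij hj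
  interval_cases j <;> interval_cases i <;> simp_all [hab.ne, hbc.ne]

theorem isInducedPath_four {a b c d : V} (hab : G.Adj a b) (hbc : G.Adj b c) (hcd : G.Adj c d)
    (hac : a ≠ c) (had : a ≠ d) (hbd : b ≠ d) (nac : ¬ G.Adj a c) (nad : ¬ G.Adj a d)
    (nbd : ¬ G.Adj b d) : G.IsInducedPath (fun | 0 => a | 1 => b | 2 => c | _ => d) 3 := by
  intro i j hij hj
  interval_cases j <;> interval_cases i <;> simp_all [hab.ne, hbc.ne, hcd.ne]

theorem isInducedPath_five {a b c d e : V} (hab : G.Adj a b) (hbc : G.Adj b c) (hcd : G.Adj c d)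
    (hde : G.Adj d e) (hac : a ≠ c) (had : a ≠ d) (hae : a ≠ e) (hbd : b ≠ d) (hbe : b ≠ e)
    (hce : c ≠ e) (nac : ¬ G.Adj a c) (nad : ¬ G.Adj a d) (nae : ¬ G.Adj a e) (nbd : ¬ G.Adj b d)
    (nbe : ¬ G.Adj b e) (nce : ¬ G.Adj c e) :
    G.IsInducedPath (fun | 0 => a | 1 => b | 2 => c | 3 => d | _ => e) 4 := by
  intro i j hij hj
  interval_cases j <;> interval_cases i <;> simp_all [hab.ne, hbc.ne, hcd.ne, hde.ne]

theorem Connected.dist_le_of_adj (hG : G.Connected) (u : V) {x y : V} (h : G.Adj x y) :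
    G.dist u y ≤ G.dist u x + 1 := by
  have := hG.dist_triangle (u := u) (v := x) (w := y)
  rwa [dist_eq_one_iff_adj.2 h] at this

theorem Connected.exists_adj_dist (hG : G.Connected) {u x : V} (h : 0 < G.dist u x) :
    ∃ b, G.Adj x b ∧ G.dist u b + 1 = G.dist u x := by
  obtain ⟨w, hw⟩ := hG.exists_walk_length_eq_dist x u
  rw [G.dist_comm] at hw
  cases w with
  | nil => simp at h
  | @cons _ b _ hb w =>
    refine ⟨b, hb, ?_⟩
    have h1 : G.dist u b ≤ w.length := by
      rw [G.dist_comm]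
      exact dist_le w
    have h2 := hG.dist_le_of_adj u hb.symm
    rw [Walk.length_cons] at hw
    omega

/-- A geodesic from `a` to `u`, as a sequence of vertices. -/
theorem Connected.exists_geodesic (hG : G.Connected) (u a : V) : ∃ g : ℕ → V, g 0 = a ∧
    (∀ s ≤ G.dist u a, G.dist u (g s) + s = G.dist u a) ∧
    ∀ s < G.dist u a, G.Adj (g s) (g (s + 1)) := by
  induction hl : G.dist u a generalizing a with
  | zero => exact ⟨fun _ => a, rfl, fun s hs => by simp_all, fun s hs => by omega⟩
  | succ l ih =>
    obtain ⟨b, hab, hb⟩ := hG.exists_adj_dist (u := u) (x := a) (by omega)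
    obtain ⟨g, h0, h1, h2⟩ := ih b (by omega)
    refine ⟨fun | 0 => a | s + 1 => g s, rfl, fun s hs => ?_, fun s hs => ?_⟩
    · rcases s with _ | s
      · simpa using hl
      · have := h1 s (by omega)
        simp only
        omega
    · rcases s with _ | s
      · simpa [h0] using hab
      · exact h2 s (by omega)

/-- In a distance-hereditary graph, an induced path that ends in a vertex closer to `u` than all of
its other vertices extends by a geodesic to an induced path to `u`, which gives the distance of its
first vertex from `u`. -/
theorem _root_.IsDistanceHereditary.add_le_dist (hG : IsDistanceHereditary G) (u : V) {c : ℕ → V}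
    {r : ℕ} (hc : G.IsInducedPath c r) (hlev : ∀ i < r, G.dist u (c r) < G.dist u (c i)) :
    r + G.dist u (c r) ≤ G.dist u (c 0) := by
  obtain ⟨hconn, hG⟩ := isDistanceHereditary_iff.1 hG
  obtain ⟨g, h0, h1, h2⟩ := hconn.exists_geodesic u (c r)
  set l := G.dist u (c r) with hl
  set p : ℕ → V := fun i => if i ≤ r then c i else g (i - r) with hp
  have hpc : ∀ i ≤ r, p i = c i := fun i hi => if_pos hi
  have hpg : ∀ i, r ≤ i → p i = g (i - r) := by
    intro i hi
    rcases hi.eq_or_lt with rfl | hi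
    · rw [hpc _ le_rfl, Nat.sub_self, h0]
    · exact if_neg (by omega)
  have hind : G.IsInducedPath p (r + l) := by
    have far : ∀ {x y : V}, G.dist u y < G.dist u x → x ≠ y ∧
        (G.Adj x y → G.dist u x = G.dist u y + 1) := fun {x y} h => by
      refine ⟨fun e => by rw [e] at h; omega, fun hxy => ?_⟩
      have := hconn.dist_le_of_adj u hxy.symm
      omega
    intro i j hij hj
    rcases le_or_gt j r with hjr | hjr
    · rw [hpc i (by omega), hpc j hjr]
      exact hc i j hij hjr
    have hj1 := h1 (j - r) (by omega)
    rw [hpg j hjr.le]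
    rcases lt_or_ge i r with hir | hir
    · rw [hpc i hir.le]
      have h3 := hlev i hir
      have h4 := far (x := c i) (y := g (j - r)) (by omega)
      exact ⟨h4.1, fun h => by have := h4.2 h; omega, fun h => by omega⟩
    · rw [hpg i hir]
      have h3 := h1 (i - r) (by omega)
      have h4 := far (x := g (i - r)) (y := g (j - r)) (by omega)
      refine ⟨h4.1, fun h => by have := h4.2 h; omega, fun h => ?_⟩
      subst h
      rw [show i + 1 - r = i - r + 1 by omega]
      exact h2 _ (by omega)
  have hlast : p (r + l) = u := by
    rw [hpg _ (by omega), Nat.add_sub_cancel_left]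
    have := h1 l le_rfl
    exact (hconn.dist_eq_zero_iff.1 (by omega)).symm
  have := hG p (r + l) hind
  rw [hlast, hpc 0 (Nat.zero_le _), G.dist_comm] at this
  exact this

section Levels

variable (hG : IsDistanceHereditary G) (u : V)
include hG

/-- Adjacent vertices at the same distance from `u` have the same neighbours one level closer to
`u`. -/
theorem adj_pred_of_adj {x y a : V} (hxy : G.Adj x y) (hlev : G.dist u x = G.dist u y)
    (hxa : G.Adj x a) (ha : G.dist u a + 1 = G.dist u x) : G.Adj y a := by
  by_contra hya
  have hne : y ≠ a := by rintro rfl; omega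
  have := hG.add_le_dist u (isInducedPath_three hxy.symm hxa hne hya) (by
    intro i hi
    interval_cases i <;> simp only <;> omega)
  simp only at this
  omega

/-- Two neighbours of `v`, both one level closer to `u` than `v`, have the same neighbours in the
next level; otherwise `y v x a` starts an induced path that is longer than the distance. -/
theorem adj_pred_of_common {v x y a : V} (hvx : G.Adj v x) (hvy : G.Adj v y)
    (hx : G.dist u x + 1 = G.dist u v) (hy : G.dist u y + 1 = G.dist u v) (hxa : G.Adj x a)
    (ha : G.dist u a + 1 = G.dist u x) : G.Adj y a := by
  by_cases hxy : G.Adj x y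
  · exact adj_pred_of_adj hG u hxy (by omega) hxa ha
  by_cases hne : x = y
  · exact hne ▸ hxa
  by_contra hya
  have hva : ¬ G.Adj v a := fun h => by
    have := hG.1.dist_le_of_adj u h.symm
    omega
  have := hG.add_le_dist u (isInducedPath_four hvy.symm hvx hxa (Ne.symm hne)
    (by rintro rfl; omega) (by rintro rfl; omega) (fun h => hxy h.symm) hya hva) (by
      intro i hi
      interval_cases i <;> simp only <;> omega)
  simp only at this
  omega

theorem exists_common_pred {v x y : V} (hvx : G.Adj v x) (hvy : G.Adj v y)
    (hx : G.dist u x + 1 = G.dist u v) (hy : G.dist u y + 1 = G.dist u v) (hne : x ≠ y) :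
    ∃ b, G.Adj x b ∧ G.Adj y b ∧ G.dist u b + 1 = G.dist u x := by
  obtain ⟨b, hb, hbl⟩ := hG.1.exists_adj_dist (u := u) (x := x) (by
    by_contra! h
    exact hne ((hG.1.dist_eq_zero_iff.1 (by omega : G.dist u x = 0)).symm.trans
      (hG.1.dist_eq_zero_iff.1 (by omega : G.dist u y = 0))))
  exact ⟨b, hb, adj_pred_of_common hG u hvx hvy hx hy hb hbl, hbl⟩

/-- Let `x` and `y` be neighbours of `v` one level closer to `u`. A non-neighbour of `v` in the
level of `x` and `y` is adjacent to both or to none of them: otherwise it has an induced path of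
length three to `v` or to `y`, but also a common neighbour with it. -/
theorem adj_level_of_common {v x y z : V} (hvx : G.Adj v x) (hvy : G.Adj v y)
    (hvz : ¬ G.Adj v z) (hx : G.dist u x + 1 = G.dist u v) (hy : G.dist u y + 1 = G.dist u v)
    (hz : G.dist u z + 1 = G.dist u v) (hzx : G.Adj z x) : G.Adj z y := by
  by_contra hzy
  have hxy : x ≠ y := by rintro rfl; exact hzy hzx
  have hyz : y ≠ z := by rintro rfl; exact hvz hvy
  have hvz' : v ≠ z := by rintro rfl; omega
  obtain ⟨b, hxb, hyb, hbl⟩ := exists_common_pred hG u hvx hvy hx hy hxy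
  have hzb : G.Adj z b := adj_pred_of_adj hG u hzx.symm (by omega) hxb hbl
  by_cases hadj : G.Adj x y
  · have hvb : ¬ G.Adj v b := fun h => by
      have := hG.1.dist_le_of_adj u h.symm
      omega
    have := (isDistanceHereditary_iff.1 hG).2 _ _ (isInducedPath_four hvy hyb hzb.symm
      (by rintro rfl; omega) hvz' hyz hvb hvz fun h => hzy h.symm)
    have h2 := dist_le_two hvx hzx.symm
    simp only at this
    omega
  · have := (isDistanceHereditary_iff.1 hG).2 _ _ (isInducedPath_four hvy.symm hvx hzx.symm
      hxy.symm hyz hvz' (fun h => hadj h.symm) (fun h => hzy h.symm) hvz)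
    have h2 := dist_le_two hyb hzb.symm
    simp only at this
    omega

/-- Let `x` and `y` be neighbours of `v` one level closer to `u`. A vertex `w` of the level of `v`
that has a neighbour `z` not adjacent to `v` is adjacent to both or to none of them: otherwise there
is an induced path of length three from `v` to `w`, or of length four from `y` to `z`. -/
theorem adj_succ_of_common {v w x y z : V} (hvx : G.Adj v x) (hvy : G.Adj v y) (hwx : G.Adj w x)
    (hwz : G.Adj w z) (hvz : ¬ G.Adj v z) (hvw : ¬ G.Adj v w) (hw : G.dist u w = G.dist u v)
    (hx : G.dist u x + 1 = G.dist u v) (hy : G.dist u y + 1 = G.dist u v)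
    (hz : G.dist u z + 1 = G.dist u v) : G.Adj w y := by
  by_contra hwy
  have hxy : x ≠ y := by rintro rfl; exact hwy hwx
  have hxz : x ≠ z := by rintro rfl; exact hvz hvx
  have hyz : y ≠ z := by rintro rfl; exact hvz hvy
  have hvw' : v ≠ w := by rintro rfl; exact hwy hvy
  have hvz' : v ≠ z := by rintro rfl; omega
  have hyw : y ≠ w := by rintro rfl; omega
  obtain ⟨b, hxb, hyb, hbl⟩ := exists_common_pred hG u hvx hvy hx hy hxy
  have hzb : G.Adj z b :=
    adj_pred_of_common hG u hwx hwz (by omega) (by omega) hxb hbl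
  by_cases hadj : G.Adj x y
  · have hyz' : G.Adj y z :=
      adj_level_of_common hG u hwx hwz hwy (by omega) (by omega) (by omega) hadj.symm
    have := (isDistanceHereditary_iff.1 hG).2 _ _ (isInducedPath_four hvy hyz' hwz.symm
      hvz' hvw' hyw hvz hvw fun h => hwy h.symm)
    have h2 := dist_le_two hvx hwx.symm
    simp only at this
    omega
  · have nxz : ¬ G.Adj x z := fun h => hadj
      (adj_level_of_common hG u hwz hwx hwy (by omega) (by omega) (by omega)
        (adj_level_of_common hG u hvx hvy hvz hx hy hz h.symm).symm).symm
    have nyz : ¬ G.Adj y z := fun h => nxz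
      (adj_level_of_common hG u hvy hvx hvz hy hx hz h.symm).symm
    have := (isDistanceHereditary_iff.1 hG).2 _ _ (isInducedPath_five hvy.symm hvx hwx.symm hwz
      hxy.symm hyw hyz hvw' hvz' hxz (fun h => hadj h.symm) (fun h => hwy h.symm) nyz hvw hvz nxz)
    have h2 := dist_le_two hyb hzb.symm
    simp only at this
    omega

/-- A module whose vertices have a common neighbour has no induced path on four vertices, and hence
contains twins. -/
theorem exists_pruningPair_of_module [Finite V] {S : Set V} (hS : S.Nontrivial) {b : V}
    (hb : ∀ x ∈ S, G.Adj b x)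
    (hmod : ∀ x ∈ S, ∀ y ∈ S, ∀ z ∉ S, G.Adj x z → G.Adj y z) :
    ∃ x y, G.IsPruningPair Set.univ x y := by
  have hP4 : G.IsP4FreeOn S := by
    intro a ha b' hb' c hc d hd hac had hbd hab hbc hcd nac nbd
    by_contra nad
    have := (isDistanceHereditary_iff.1 hG).2 _ _
      (isInducedPath_four hab hbc hcd hac had hbd nac nad nbd)
    have h2 := dist_le_two (hb a ha).symm (hb d hd)
    simp only at this
    omega
  obtain ⟨x, hx, y, hy, hxy, htw⟩ := hP4.exists_twins (Set.toFinite _) hS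
  refine ⟨x, y, trivial, trivial, hxy, Or.inl fun z _ hzx hzy => ?_⟩
  by_cases hz : z ∈ S
  · exact htw z hz hzx hzy
  · exact ⟨hmod x hx y hy z hz, hmod y hy x hx z hz⟩

end Levels

/-- A distance-hereditary graph with at least two vertices has two twins or a pendant vertex. They
are found in the last level of the graph, seen from a vertex `u`, or in the level before. -/
theorem _root_.IsDistanceHereditary.exists_pruningPair [Finite V] [Nontrivial V]
    (hG : IsDistanceHereditary G) : ∃ x y, G.IsPruningPair Set.univ x y := by
  obtain ⟨u⟩ := hG.1.nonempty
  obtain ⟨v₀, hv₀⟩ := Finite.exists_max fun v => G.dist u v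
  set k := G.dist u v₀ with hk
  have hpos : 0 < k := by
    obtain ⟨w, hw⟩ := exists_ne u
    exact (hG.1.pos_dist_of_ne hw.symm).trans_le (hv₀ w)
  by_cases hedge : ∃ s t, G.Adj s t ∧ G.dist u s = k ∧ G.dist u t = k
  · -- The component of an edge within the last level is a module.
    obtain ⟨s, t, hst, hs, ht⟩ := hedge
    set R : Set V := {x | Relation.ReflTransGen (fun a b => G.Adj a b ∧ G.dist u b = k) s x}
    have hR : ∀ x ∈ R, G.dist u x = k ∧
        ∀ a, G.dist u a + 1 = k → (G.Adj s a ↔ G.Adj x a) := by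
      intro x hx
      induction hx with
      | refl => exact ⟨hs, fun _ _ => Iff.rfl⟩
      | @tail b c _ hbc ih =>
        refine ⟨hbc.2, fun a ha => (ih.2 a ha).trans ⟨fun h => ?_, fun h => ?_⟩⟩
        · exact adj_pred_of_adj hG u hbc.1 (ih.1.trans hbc.2.symm) h (by rw [ih.1, ha])
        · exact adj_pred_of_adj hG u hbc.1.symm (hbc.2.trans ih.1.symm) h (by rw [hbc.2, ha])
    obtain ⟨b, hb, hbl⟩ := hG.1.exists_adj_dist (u := u) (x := s) (by omega)
    refine exists_pruningPair_of_module hG (S := R) ⟨s, .refl, t, .single ⟨hst, ht⟩, hst.ne⟩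
      (b := b) (fun x hx => (((hR x hx).2 b (by omega)).1 hb).symm) fun x hx y hy z hz hxz => ?_
    have h1 : G.dist u z ≠ k := fun h => hz (Relation.ReflTransGen.tail hx ⟨hxz, h⟩)
    have h2 : G.dist u z ≤ k := hv₀ z
    have h3 := hG.1.dist_le_of_adj u hxz.symm
    have h4 := (hR x hx).1
    have h5 : G.dist u z + 1 = k := by omega
    exact ((hR y hy).2 z h5).1 (((hR x hx).2 z h5).2 hxz)
  · -- The last level is independent; in it, choose a vertex with a minimal neighbourhood, which is
    -- then a module.
    push Not at hedge
    obtain ⟨v, hv, hmin⟩ := Set.exists_min_image {v | G.dist u v = k}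
      (fun v => (G.neighborSet v).ncard) (Set.toFinite _) ⟨v₀, rfl⟩
    have hv' : G.dist u v = k := hv
    have hlev : ∀ w x, G.dist u w = k → G.Adj w x → G.dist u x + 1 = k := by
      intro w x hw hwx
      have h1 := hedge w x hwx hw
      have h2 : G.dist u x ≤ k := hv₀ x
      have h3 := hG.1.dist_le_of_adj u hwx.symm
      omega
    by_cases hS : (G.neighborSet v).Nontrivial
    · refine exists_pruningPair_of_module hG hS (b := v) (fun x hx => hx)
        fun x hx y hy z hz hxz => ?_
      have hx1 := hlev v x hv' hx
      have hy1 := hlev v y hv' hy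
      have hz1 := hG.1.dist_le_of_adj u hxz
      have hz2 := hG.1.dist_le_of_adj u hxz.symm
      rcases (by omega : G.dist u z + 2 = k ∨ G.dist u z + 1 = k ∨ G.dist u z = k) with h | h | h
      · exact adj_pred_of_common hG u hx hy (by omega) (by omega) hxz (by omega)
      · exact (adj_level_of_common hG u hx hy hz (by omega) (by omega) (by omega) hxz.symm).symm
      · -- By minimality, `N(z)` is not a proper subset of `N(v)`, so `z` has a neighbour outside
        -- of `N(v)`.
        by_contra hyz
        have hle : (G.neighborSet v).ncard ≤ (G.neighborSet z).ncard := hmin z h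
        have hex : ∃ z', G.Adj z z' ∧ ¬ G.Adj v z' := by
          by_contra! hsub
          refine absurd hle (not_le.2 (Set.ncard_lt_ncard ⟨hsub, fun h' => ?_⟩ (Set.toFinite _)))
          exact hyz (h' hy : G.Adj z y).symm
        obtain ⟨z', hzz', hvz'⟩ := hex
        have := hlev z z' h hzz'
        exact hyz (adj_succ_of_common hG u hx hy hxz.symm hzz' hvz'
          (fun h' => hedge v z h' hv' h) (by omega) (by omega) (by omega) (by omega)).symm
    · rw [Set.not_nontrivial_iff] at hS
      obtain ⟨x, hx, -⟩ := hG.1.exists_adj_dist (u := u) (x := v) (by omega)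
      exact ⟨v, x, trivial, trivial, hx.ne, Or.inr fun z _ hz => hS hz hx⟩

end SimpleGraph

/-! ### Routes define distance-hereditary graphs -/

theorem JunctionKind.linked_or_exists (K : JunctionKind) {i k : Fin 3} (h : i ≠ k) :
    K.Linked i k ∨ ∃ m, K.Linked i m ∧ K.Linked m k := by
  rcases K with _ | _
  · exact Or.inl (lt_or_gt_of_ne h)
  · change ((i = 0 ∧ i < k) ∨ (k = 0 ∧ k < i)) ∨ ∃ m : Fin 3,
      ((i = 0 ∧ i < m) ∨ (m = 0 ∧ m < i)) ∧ ((m = 0 ∧ m < k) ∨ (k = 0 ∧ k < m))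
    revert i k
    decide

theorem JunctionKind.exists_linked (K : JunctionKind) (i : Fin 3) : ∃ k, K.Linked i k := by
  obtain ⟨k, hk⟩ := exists_ne i
  rcases K.linked_or_exists hk.symm with h | ⟨m, h, -⟩
  · exact ⟨k, h⟩
  · exact ⟨m, h⟩

namespace Drawing

variable {V J E : Type*} {A : Drawing V J E}

theorem Leg.eq_of_port_eq (hP : A.IsPlanar) (hA : A.IsTreeLike) {d d' : A.Leg} {j : J} {i : Fin 3}
    (h : d.source = .inr (j, i)) (h' : d'.source = .inr (j, i)) : d = d' :=
  Leg.eq_of_track_eq hA ((hP.port_track j i).unique (h ▸ d.isEnd_source) (h' ▸ d'.isEnd_source))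
    (by rw [h, h'])

theorem exists_leg_of_port (hP : A.IsPlanar) (j : J) (i : Fin 3) :
    ∃ d : A.Leg, d.source = .inr (j, i) := by
  obtain ⟨e, he, -⟩ := hP.port_track j i
  obtain ⟨d, -, hd⟩ := exists_leg he
  exact ⟨d, hd⟩

/-- A sequence of legs from one side of a track to the other runs through this track. -/
theorem Leg.Leads.through (hA : A.IsTreeLike) {d d' l : A.Leg} (h : d.Leads d')
    (hd : d.source.node ∉ l.ahead) (hd' : d'.target.node ∈ l.ahead) :
    d.Leads l ∧ l.Leads d' := by
  induction h with
  | refl =>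
    rw [Leg.eq_of_crossing hA hd hd']
    exact ⟨.refl, .refl⟩
  | @tail m d' hm hf ih =>
    by_cases h : m.target.node ∈ l.ahead
    · exact ⟨(ih h).1, (ih h).2.tail hf⟩
    · have := Leg.eq_of_crossing hA (hf.node_eq ▸ h) hd'
      rw [← this]
      exact ⟨hm.tail hf, .refl⟩

section Graph

variable {G : SimpleGraph V} (hP : A.IsPlanar) (hA : A.IsTreeLike)
  (hG : ∀ u v, G.Adj u v ↔ A.Route u v)
include hA hG

/-- Across a track, adjacency is complete between the vertices that have neighbours on the other
side. -/
theorem adj_across {l : A.Leg} {x y z z' : V} (hx : .inl x ∉ l.ahead) (hy : .inl y ∉ l.ahead)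
    (hz : .inl z ∈ l.ahead) (hz' : .inl z' ∈ l.ahead) (hxz : G.Adj x z) (hyz : G.Adj y z') :
    G.Adj x z' := by
  obtain ⟨d, d', h1, h2, h3⟩ := (hG _ _).1 hxz
  obtain ⟨c, c', h1', h2', h3'⟩ := (hG _ _).1 hyz
  have h4 := h3.through hA (l := l) (by rwa [h1]) (by rwa [h2])
  have h5 := h3'.through hA (l := l) (by rwa [h1']) (by rwa [h2'])
  exact (hG _ _).2 ⟨d, c', h1, h2', h4.1.trans h5.2⟩

/-- Across a track that ends at a vertex, there are no neighbours but this vertex. -/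
theorem eq_of_adj_across {l : A.Leg} {x z w : V} (hx : .inl x ∉ l.ahead) (hz : .inl z ∈ l.ahead)
    (hw : l.target = .inl w) (hxz : G.Adj x z) : z = w := by
  obtain ⟨d, d', h1, h2, h3⟩ := (hG _ _).1 hxz
  have h4 := h3.through hA (l := l) (by rwa [h1]) (by rwa [h2])
  rcases Relation.ReflTransGen.cases_head h4.2 with rfl | ⟨m, ⟨j, i, k, h, -⟩, -⟩
  · exact Sum.inl_injective (h2.symm.trans hw)
  · rw [hw] at h
    cases h

theorem eq_of_adj_branch {S : Set V} {l : A.Leg} {x w : V} (hw : l.source = .inl w)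
    (hsub : {v ∈ S | .inl v ∈ l.ahead}.Subsingleton) (hx : x ∈ S) (hxl : .inl x ∈ l.ahead) :
    ∀ z ∈ S, G.Adj x z → z = w := by
  intro z hz hxz
  have hzl : .inl z ∉ l.ahead := fun h => hxz.ne (hsub ⟨hx, hxl⟩ ⟨hz, h⟩)
  exact eq_of_adj_across hA hG (l := l.rev) (fun h => (l.mem_rev_ahead hA _).1 h hxl)
    ((l.mem_rev_ahead hA _).2 hzl) hw hxz

include hP

/-- If two vertices of `S` lie ahead of a leg, then `S` contains a pruning pair. Choose such a leg
with as few nodes ahead as possible. Beyond the node at its target, every branch has at most one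
vertex of `S`: if this node is a vertex, then such a vertex of `S` is pendant at it, and if it is a
junction, then there are two of them, which are twins unless one of them has no neighbour in the
rest of `S`. -/
theorem exists_pruningPair_ahead [Finite V] [Finite J] {S : Set V} (l : A.Leg)
    (hl : {v ∈ S | .inl v ∈ l.ahead}.Nontrivial) : ∃ x y, G.IsPruningPair S x y := by
  induction hn : l.ahead.ncard using Nat.strong_induction_on generalizing l with
  | _ n ih =>
  have next : ∀ {x}, .inl x ∈ l.ahead → .inl x ≠ l.target.node →
      (∃ x y, G.IsPruningPair S x y) ∨ ∃ d : A.Leg, d.source.node = l.target.node ∧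
        .inl x ∈ d.ahead ∧ d ≠ l.rev ∧ {v ∈ S | .inl v ∈ d.ahead}.Subsingleton := by
    intro x hx hne
    obtain ⟨d, hd, hxd⟩ := exists_leg_ahead hA hne
    have hdl : d ≠ l.rev := by
      rintro rfl
      exact (l.mem_rev_ahead hA _).1 hxd hx
    by_cases hnt : {v ∈ S | .inl v ∈ d.ahead}.Nontrivial
    · refine Or.inl (ih _ ?_ d hnt rfl)
      rw [← hn]
      exact Set.ncard_lt_ncard (Leg.ahead_ssubset hA hd.symm hdl) (Set.toFinite _)
    · exact Or.inr ⟨d, hd, hxd, hdl, Set.not_nontrivial_iff.1 hnt⟩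
  rcases ht : l.target with w | ⟨j, i⟩
  · obtain ⟨x, hx, hxw⟩ := hl.exists_ne w
    rw [ht] at next
    rcases next hx.2 (fun h => hxw (Sum.inl_injective h)) with h | ⟨d, hd, hxd, -, hsub⟩
    · exact h
    have hpend : ∀ z ∈ S, G.Adj x z → z = w :=
      eq_of_adj_branch hA hG (node_eq_inl hd) hsub hx.1 hxd
    by_cases hwS : w ∈ S
    · exact ⟨x, w, hx.1, hwS, hxw, Or.inr hpend⟩
    · obtain ⟨y, hy, hyx⟩ := hl.exists_ne x
      exact ⟨x, y, hx.1, hy.1, hyx.symm, Or.inr fun z hz hxz =>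
        absurd (hpend z hz hxz ▸ hz) hwS⟩
  · obtain ⟨x, hx, y, hy, hxy⟩ := hl
    rw [ht] at next
    rcases next hx.2 (fun h => by cases h) with h | ⟨d₁, hd₁, hxd, hdl₁, hsub₁⟩
    · exact h
    rcases next hy.2 (fun h => by cases h) with h | ⟨d₂, hd₂, hyd, hdl₂, hsub₂⟩
    · exact h
    have hd12 : d₁ ≠ d₂ := by
      rintro rfl
      exact hxy (hsub₁ ⟨hx.1, hxd⟩ ⟨hy.1, hyd⟩)
    obtain ⟨b, hb⟩ := node_eq_inr hd₁
    obtain ⟨c, hc⟩ := node_eq_inr hd₂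
    have hib : i ≠ b := by
      rintro rfl
      exact hdl₁ (Leg.eq_of_port_eq hP hA hb ht)
    have hic : i ≠ c := by
      rintro rfl
      exact hdl₂ (Leg.eq_of_port_eq hP hA hc ht)
    have hbc : b ≠ c := by
      rintro rfl
      exact hd12 (Leg.eq_of_port_eq hP hA hb hc)
    have hout : ∀ z ∈ S, z ≠ x → z ≠ y → .inl z ∉ l.ahead := by
      intro z hz hzx hzy hzl
      obtain ⟨d, hd, hzd⟩ := exists_leg_ahead hA (by simp : (.inl z : V ⊕ J) ≠ .inr j)
      obtain ⟨a, ha⟩ := node_eq_inr hd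
      have hcases : ∀ i b c a : Fin 3, i ≠ b → i ≠ c → b ≠ c → a = i ∨ a = b ∨ a = c := by
        decide
      rcases hcases i b c a hib hic hbc with rfl | rfl | rfl
      · rw [Leg.eq_of_port_eq hP hA (d' := l.rev) ha ht] at hzd
        exact (l.mem_rev_ahead hA _).1 hzd hzl
      · rw [Leg.eq_of_port_eq hP hA ha hb] at hzd
        exact hzx (hsub₁ ⟨hz, hzd⟩ ⟨hx.1, hxd⟩)
      · rw [Leg.eq_of_port_eq hP hA ha hc] at hzd
        exact hzy (hsub₂ ⟨hz, hzd⟩ ⟨hy.1, hyd⟩)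
    by_cases hzx : ∃ z ∈ S, z ≠ y ∧ G.Adj x z
    swap
    · push Not at hzx
      exact ⟨x, y, hx.1, hy.1, hxy, Or.inr fun z hz hxz => by
        by_contra hne
        exact hzx z hz hne hxz⟩
    by_cases hzy : ∃ z ∈ S, z ≠ x ∧ G.Adj y z
    swap
    · push Not at hzy
      exact ⟨y, x, hy.1, hx.1, hxy.symm, Or.inr fun z hz hyz => by
        by_contra hne
        exact hzy z hz hne hyz⟩
    obtain ⟨a, ha, hay, hxa⟩ := hzx
    obtain ⟨b, hb, hbx, hyb⟩ := hzy
    have hnot : ∀ {v}, .inl v ∈ l.ahead → .inl v ∉ l.rev.ahead := fun hv h =>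
      (l.mem_rev_ahead hA _).1 h hv
    have hin : ∀ {z}, z ∈ S → z ≠ x → z ≠ y → .inl z ∈ l.rev.ahead := fun hz h1 h2 =>
      (l.mem_rev_ahead hA _).2 (hout _ hz h1 h2)
    refine ⟨x, y, hx.1, hy.1, hxy, Or.inl fun z hz hzx hzy => ⟨fun h => ?_, fun h => ?_⟩⟩
    · exact adj_across hA hG (hnot hy.2) (hnot hx.2) (hin hb hbx hyb.ne') (hin hz hzx hzy) hyb h
    · exact adj_across hA hG (hnot hx.2) (hnot hy.2) (hin ha hxa.ne' hay) (hin hz hzx hzy) hxa h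

theorem exists_pruningPair_of_route [Finite V] [Finite J] {S : Set V} (hS : S.Nontrivial) :
    ∃ x y, G.IsPruningPair S x y := by
  obtain ⟨x, hx, y, hy, hxy⟩ := hS
  obtain ⟨d, hd, hyd⟩ := exists_leg_ahead hA
    (fun h => hxy (Sum.inl_injective h).symm : (.inl y : V ⊕ J) ≠ .inl x)
  by_cases hnt : {v ∈ S | .inl v ∈ d.ahead}.Nontrivial
  · exact exists_pruningPair_ahead hP hA hG d hnt
  · exact ⟨y, x, hy, hx, hxy.symm, Or.inr
      (eq_of_adj_branch hA hG (node_eq_inl hd) (Set.not_nontrivial_iff.1 hnt) hy hyd)⟩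

/-- Every vertex ahead of a leg is connected to one that the leg leads to, and there are such
vertices. -/
theorem exists_reachable_ahead [Finite V] [Finite J] (l : A.Leg) :
    (∃ v, ∃ d : A.Leg, d.target = .inl v ∧ l.Leads d) ∧
    ∀ x, .inl x ∈ l.ahead → ∃ v, (∃ d : A.Leg, d.target = .inl v ∧ l.Leads d) ∧
      G.Reachable x v := by
  induction hn : l.ahead.ncard using Nat.strong_induction_on generalizing l with
  | _ n ih =>
  have next : ∀ d : A.Leg, d.source.node = l.target.node → d ≠ l.rev →
      d.ahead.ncard < n := fun d hd hdl =>
    hn ▸ Set.ncard_lt_ncard (Leg.ahead_ssubset hA hd.symm hdl) (Set.toFinite _)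
  rcases ht : l.target with w | ⟨j, i⟩
  · refine ⟨⟨w, l, ht, .refl⟩, fun x hx => ⟨w, ⟨l, ht, .refl⟩, ?_⟩⟩
    by_cases hxw : x = w
    · rw [hxw]
    · obtain ⟨d, hd, hxd⟩ := exists_leg_ahead hA
        (fun h => hxw (Sum.inl_injective h) : (.inl x : V ⊕ J) ≠ .inl w)
      have hdl : d ≠ l.rev := by
        rintro rfl
        exact (l.mem_rev_ahead hA _).1 hxd hx
      obtain ⟨v, ⟨d', hd', hlead⟩, hr⟩ := (ih _ (next d (by rw [hd, ht]; rfl) hdl) d rfl).2 x hxd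
      exact hr.trans (((hG _ _).2 ⟨d, d', node_eq_inl hd, hd', hlead⟩).reachable).symm
  · have next' : ∀ {d : A.Leg} {k : Fin 3}, d.source = .inr (j, k) → k ≠ i →
        d.ahead.ncard < n := fun {d k} hd hk => next d (by rw [hd, ht]; rfl) (by
      rintro rfl
      rw [Leg.rev_source, ht] at hd
      simp_all)
    have follow : ∀ {d : A.Leg} {k : Fin 3}, d.source = .inr (j, k) →
        (A.junction j).kind.Linked i k → l.Follows d := fun hd hk => ⟨j, i, _, ht, hd, hk⟩
    refine ⟨?_, fun x hx => ?_⟩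
    · obtain ⟨k, hk⟩ := (A.junction j).kind.exists_linked i
      obtain ⟨d, hd⟩ := exists_leg_of_port hP j k
      obtain ⟨v, d', hd', hlead⟩ := (ih _ (next' hd hk.ne.symm) d rfl).1
      exact ⟨v, d', hd', hlead.head (follow hd hk)⟩
    · obtain ⟨d, hd, hxd⟩ := exists_leg_ahead hA (by simp : (.inl x : V ⊕ J) ≠ .inr j)
      obtain ⟨k, hk⟩ := node_eq_inr hd
      have hki : k ≠ i := by
        rintro rfl
        rw [Leg.eq_of_port_eq hP hA (d' := l.rev) hk ht] at hxd
        exact (l.mem_rev_ahead hA _).1 hxd hx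
      obtain ⟨v, ⟨d', hd', hlead⟩, hr⟩ := (ih _ (next' hk hki) d rfl).2 x hxd
      rcases (A.junction j).kind.linked_or_exists hki.symm with h | ⟨m, him, hmk⟩
      · exact ⟨v, ⟨d', hd', hlead.head (follow hk h)⟩, hr⟩
      · -- From the port `k` one cannot get to `i`, but both are connected to `m`.
        obtain ⟨c, hc⟩ := exists_leg_of_port hP j m
        obtain ⟨v', c', hc', hlead'⟩ := (ih _ (next' hc him.ne.symm) c rfl).1
        refine ⟨v', ⟨c', hc', hlead'.head (follow hc him)⟩, hr.trans ?_⟩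
        have hroute : A.Route v' v := ⟨c'.rev, d', hc', hd',
          Leg.Leads.rev hlead' |>.trans (hlead.head ⟨j, m, k, hc, hk, hmk⟩)⟩
        exact ((hG _ _).2 hroute).reachable.symm

theorem connected_of_route [Finite V] [Finite J] : G.Connected := by
  refine (SimpleGraph.connected_iff _).2 ⟨fun x y => ?_, ?_⟩
  · by_cases hxy : y = x
    · rw [hxy]
    · obtain ⟨d, hd, hyd⟩ := exists_leg_ahead hA
        (fun h => hxy (Sum.inl_injective h) : (.inl y : V ⊕ J) ≠ .inl x)
      obtain ⟨v, ⟨d', hd', hlead⟩, hr⟩ := (exists_reachable_ahead hP hA hG d).2 y hyd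
      exact (((hG _ _).2 ⟨d, d', node_eq_inl hd, hd', hlead⟩).reachable).trans hr.symm
  · obtain ⟨v | j⟩ := hA.isTree.1.nonempty
    · exact ⟨v⟩
    · obtain ⟨d, -⟩ := exists_leg_of_port hP j 0
      exact (exists_reachable_ahead hP hA hG d).1.nonempty

theorem isDistanceHereditary_of_route [Finite V] [Finite J] : IsDistanceHereditary G :=
  (connected_of_route hP hA hG).isDistanceHereditary_of_pruning fun _ hS =>
    exists_pruningPair_of_route hP hA hG ((Set.one_lt_ncard_iff_nontrivial).1 hS)

end Graph

end Drawing

/-! ### Grafting a junction in place of a leaf -/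

namespace Drawing

variable {V J E : Type*}

theorem edgeSet_underlying {A : Drawing V J E} (h : ∀ e, ¬ (A.nodes e).IsDiag) :
    A.underlying.edgeSet = range A.nodes := by
  rw [underlying, SimpleGraph.edgeSet_fromEdgeSet, sdiff_eq_left, Set.disjoint_left]
  rintro _ ⟨e, rfl⟩ hd
  exact h e hd

theorem isTreeLike_iff_card [Finite V] [Finite J] [Finite E] {A : Drawing V J E} :
    A.IsTreeLike ↔ (∀ e, ¬ (A.nodes e).IsDiag) ∧ Function.Injective A.nodes ∧
      A.underlying.Connected ∧ Nat.card E + 1 = Nat.card (V ⊕ J) := by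
  have key : (∀ e, ¬ (A.nodes e).IsDiag) → Function.Injective A.nodes →
      Nat.card A.underlying.edgeSet = Nat.card E := fun h h' => by
    rw [edgeSet_underlying h]
    exact Nat.card_range_of_injective h'
  constructor
  · intro hA
    have := SimpleGraph.isTree_iff_connected_and_card.1 hA.isTree
    rw [key hA.no_loop hA.no_parallel] at this
    exact ⟨hA.no_loop, hA.no_parallel, this⟩
  · rintro ⟨h1, h2, h3, h4⟩
    refine ⟨h1, h2, SimpleGraph.isTree_iff_connected_and_card.2 ⟨h3, ?_⟩⟩
    rw [key h1 h2, h4]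

section Graft

variable {x : V}

open Classical in
/-- The terminal of the grafted drawing that takes the place of a terminal of the old one: the leaf
`y` gives way to the port `a` of the new junction. -/
noncomputable def graftTerminal (y : ↥({x}ᶜ : Set V)) (a : Fin 3) :
    Terminal ↥({x}ᶜ : Set V) J → Terminal V (Option J)
  | .inl v => if v = y then .inr (none, a) else .inl v
  | .inr (j, i) => .inr (some j, i)

open Classical in
/-- The node of the grafted drawing that takes the place of a node of the old one. -/
noncomputable def graftNode (y : ↥({x}ᶜ : Set V)) : ↥({x}ᶜ : Set V) ⊕ J → V ⊕ Option J
  | .inl v => if v = y then .inr none else .inl v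
  | .inr j => .inr (some j)

open Classical in
/-- The points of the terminals of the grafted drawing. -/
noncomputable def graftVertexPos (A : Drawing ↥({x}ᶜ : Set V) J E) (y : ↥({x}ᶜ : Set V))
    (Y X : Plane) (v : V) : Plane :=
  if h : v = x then X else if v = y then Y else A.vertexPos ⟨v, h⟩

/-- The drawing obtained from `A` when the leaf `y` is replaced with the junction `g`, whose port
`a` takes over the track of `y`, while new tracks lead from the port `b` to the new place `Y` of
`y`, and from the port `c` to the new vertex `x` at `X`. All tracks are drawn as line segments. -/
noncomputable def graft (A : Drawing ↥({x}ᶜ : Set V) J E) (y : ↥({x}ᶜ : Set V)) (g : Junction)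
    (a b c : Fin 3) (Y X : Plane) : Drawing V (Option J) (E ⊕ Bool) :=
  let pos : Terminal V (Option J) → Plane :=
    Sum.elim (A.graftVertexPos y Y X) fun t => (t.1.elim g A.junction).port t.2
  let src : E ⊕ Bool → Terminal V (Option J) :=
    Sum.elim (fun e => graftTerminal y a (A.src e)) fun n => .inr (none, cond n c b)
  let tgt : E ⊕ Bool → Terminal V (Option J) :=
    Sum.elim (fun e => graftTerminal y a (A.tgt e)) fun n => .inl (cond n x y)
  { vertexPos := A.graftVertexPos y Y X
    junction := fun o => o.elim g A.junction
    src := src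
    tgt := tgt
    track := fun e => AffineMap.lineMap (pos (src e)) (pos (tgt e)) }

variable {A : Drawing ↥({x}ᶜ : Set V) J E} {y : ↥({x}ᶜ : Set V)} {g : Junction} {a b c : Fin 3}
  {Y X : Plane}

theorem graftTerminal_leaf : graftTerminal (J := J) y a (.inl y) = .inr (none, a) := if_pos rfl

theorem graftTerminal_inl {v : ↥({x}ᶜ : Set V)} (h : v ≠ y) :
    graftTerminal (J := J) y a (.inl v) = .inl ↑v := if_neg h

theorem graftTerminal_inr (j : J) (i : Fin 3) :
    graftTerminal y a (.inr (j, i)) = .inr (some j, i) := rfl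

theorem graftNode_leaf : graftNode (J := J) y (.inl y) = .inr none := if_pos rfl

theorem graftNode_inl {v : ↥({x}ᶜ : Set V)} (h : v ≠ y) :
    graftNode (J := J) y (.inl v) = .inl ↑v := if_neg h

theorem node_graftTerminal (t : Terminal ↥({x}ᶜ : Set V) J) :
    (graftTerminal y a t).node = graftNode y t.node := by
  rcases t with v | ⟨j, i⟩
  · by_cases h : v = y
    · subst h
      rw [graftTerminal_leaf]
      exact graftNode_leaf.symm
    · rw [graftTerminal_inl h]
      exact (graftNode_inl h).symm
  · rfl

theorem graftNode_injective : Function.Injective (graftNode (J := J) y) := by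
  rintro (v | j) (v' | j') h
  · by_cases hv : v = y <;> by_cases hv' : v' = y
    · rw [hv, hv']
    · simp [graftNode, hv, hv'] at h
    · simp [graftNode, hv, hv'] at h
    · rw [graftNode_inl hv, graftNode_inl hv'] at h
      rw [Subtype.ext (Sum.inl_injective h)]
  · by_cases hv : v = y <;> simp [graftNode, hv] at h
  · by_cases hv' : v' = y <;> simp [graftNode, hv'] at h
  · simpa [graftNode] using h

theorem graftTerminal_injective : Function.Injective (graftTerminal (J := J) y a) := by
  rintro (v | ⟨j, i⟩) (v' | ⟨j', i'⟩) h
  · by_cases hv : v = y <;> by_cases hv' : v' = y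
    · rw [hv, hv']
    · simp [graftTerminal, hv, hv'] at h
    · simp [graftTerminal, hv, hv'] at h
    · rw [graftTerminal_inl hv, graftTerminal_inl hv'] at h
      rw [Subtype.ext (Sum.inl_injective h)]
  · by_cases hv : v = y <;> simp [graftTerminal, hv] at h
  · by_cases hv' : v' = y <;> simp [graftTerminal, hv'] at h
  · simpa [graftTerminal] using h

theorem graftNode_ne_left (n : ↥({x}ᶜ : Set V) ⊕ J) (s : Bool) :
    graftNode y n ≠ .inl (cond s x y) := by
  rcases n with v | j
  · by_cases hv : v = y
    · rw [hv, graftNode_leaf]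
      simp
    · rw [graftNode_inl hv]
      intro h
      cases s
      · exact hv (Subtype.ext (Sum.inl_injective h))
      · exact v.2 (Sum.inl_injective h)
  · simp [graftNode]

theorem graftNode_cases (n : V ⊕ Option J) :
    (∃ m, n = graftNode y m) ∨ ∃ s : Bool, n = .inl (cond s x y) := by
  rcases n with v | _ | j
  · by_cases hx : v = x
    · exact Or.inr ⟨true, by rw [hx]; rfl⟩
    · by_cases hy : v = y
      · exact Or.inr ⟨false, by rw [hy]; rfl⟩
      · refine Or.inl ⟨.inl ⟨v, hx⟩, (graftNode_inl (y := y) (v := ⟨v, hx⟩) fun h => hy ?_).symm⟩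
        rw [← h]
  · exact Or.inl ⟨.inl y, graftNode_leaf.symm⟩
  · exact Or.inl ⟨.inr j, rfl⟩

theorem nodes_graft_inl (e : E) :
    (A.graft y g a b c Y X).nodes (.inl e) = (A.nodes e).map (graftNode y) := by
  change s((graftTerminal y a (A.src e)).node, (graftTerminal y a (A.tgt e)).node) = _
  rw [node_graftTerminal, node_graftTerminal]
  rfl

theorem nodes_graft_inr (s : Bool) :
    (A.graft y g a b c Y X).nodes (.inr s) = s(.inr none, .inl (cond s x y)) := rfl

theorem isTreeLike_graft [Finite V] [Finite J] [Finite E] (hA : A.IsTreeLike) :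
    (A.graft y g a b c Y X).IsTreeLike := by
  obtain ⟨h1, h2, h3, h4⟩ := isTreeLike_iff_card.1 hA
  have hloop : ∀ e, ¬ ((A.graft y g a b c Y X).nodes e).IsDiag := by
    rintro (e | s)
    · rw [nodes_graft_inl, Sym2.isDiag_map graftNode_injective]
      exact h1 e
    · rw [nodes_graft_inr, Sym2.mk_isDiag_iff]
      simp
  have hmem : ∀ (e : E) (s : Bool),
      (.inl (cond s x ↑y) : V ⊕ Option J) ∉ (A.nodes e).map (graftNode y) := by
    intro e s hm
    obtain ⟨n, -, hn⟩ := Sym2.mem_map.1 hm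
    exact graftNode_ne_left n s hn
  refine isTreeLike_iff_card.2 ⟨hloop, ?_, ?_, ?_⟩
  · rintro (e | s) (e' | s') h
    · rw [nodes_graft_inl, nodes_graft_inl] at h
      rw [h2 (Sym2.map.injective graftNode_injective h)]
    · rw [nodes_graft_inl, nodes_graft_inr] at h
      exact absurd (h ▸ Sym2.mem_mk_right _ _) (hmem e s')
    · rw [nodes_graft_inl, nodes_graft_inr] at h
      exact absurd (h ▸ Sym2.mem_mk_right _ _) (hmem e' s)
    · rw [nodes_graft_inr, nodes_graft_inr, Sym2.eq_iff] at h
      have hxy : x ≠ y := fun h => y.2 h.symm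
      cases s <;> cases s' <;> simp_all
  · have hadj : ∀ n m, A.underlying.Adj n m →
        (A.graft y g a b c Y X).underlying.Adj (graftNode y n) (graftNode y m) := by
      intro n m h
      rw [underlying, SimpleGraph.fromEdgeSet_adj] at h ⊢
      obtain ⟨⟨e, he⟩, hne⟩ := h
      exact ⟨⟨.inl e, by rw [nodes_graft_inl, he]; rfl⟩, fun h => hne (graftNode_injective h)⟩
    have hleaf : ∀ s : Bool, (A.graft y g a b c Y X).underlying.Adj (.inr none)
        (.inl (cond s x y)) := fun s => by
      rw [underlying, SimpleGraph.fromEdgeSet_adj]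
      exact ⟨⟨.inr s, rfl⟩, by simp⟩
    have hreach : ∀ n, (A.graft y g a b c Y X).underlying.Reachable (.inr none) n := by
      intro n
      rcases graftNode_cases (y := y) n with ⟨m, rfl⟩ | ⟨s, rfl⟩
      · rw [← graftNode_leaf (y := y)]
        exact (h3.preconnected (.inl y) m).map ⟨graftNode y, fun {n m} h => hadj n m h⟩
      · exact (hleaf s).reachable
    exact (SimpleGraph.connected_iff _).2
      ⟨fun n m => (hreach n).symm.trans (hreach m), ⟨.inr none⟩⟩
  · have hV : Nat.card ↥({x}ᶜ : Set V) + 1 = Nat.card V := by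
      have h := Set.ncard_add_ncard_compl ({x} : Set V)
      rw [Set.ncard_singleton] at h
      rw [Nat.card_coe_set_eq]
      omega
    rw [Nat.card_sum] at h4 ⊢
    rw [Nat.card_sum, Finite.card_option, ← hV, Nat.card_eq_fintype_card (α := Bool),
      Fintype.card_bool]
    omega

/-! ### Routes in the grafted drawing -/

theorem isEnd_graft_inl {e : E} {t : Terminal V (Option J)} :
    (A.graft y g a b c Y X).IsEnd (.inl e) t ↔ ∃ t', A.IsEnd e t' ∧ graftTerminal y a t' = t := by
  constructor
  · rintro (h | h)
    · exact ⟨_, Or.inl rfl, h⟩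
    · exact ⟨_, Or.inr rfl, h⟩
  · rintro ⟨t', rfl | rfl, rfl⟩
    · exact Or.inl rfl
    · exact Or.inr rfl

theorem isEnd_graft_inr {s : Bool} {t : Terminal V (Option J)} :
    (A.graft y g a b c Y X).IsEnd (.inr s) t ↔
      .inr (none, cond s c b) = t ∨ .inl (cond s x ↑y) = t := Iff.rfl

/-- A leg of the old drawing as a leg of the grafted drawing. -/
noncomputable def Leg.graft (d : A.Leg) (y : ↥({x}ᶜ : Set V)) (g : Junction) (a b c : Fin 3)
    (Y X : Plane) : (A.graft y g a b c Y X).Leg where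
  track := .inl d.track
  source := graftTerminal y a d.source
  target := graftTerminal y a d.target
  goes := d.goes.imp
    (fun h => ⟨congrArg (graftTerminal y a) h.1, congrArg (graftTerminal y a) h.2⟩)
    fun h => ⟨congrArg (graftTerminal y a) h.1, congrArg (graftTerminal y a) h.2⟩

/-- The leg from the new junction to the leaf `y`, or to the leaf `x`. -/
noncomputable def leafLeg (A : Drawing ↥({x}ᶜ : Set V) J E) (y : ↥({x}ᶜ : Set V)) (g : Junction)
    (a b c : Fin 3) (Y X : Plane) (s : Bool) : (A.graft y g a b c Y X).Leg where
  track := .inr s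
  source := .inr (none, cond s c b)
  target := .inl (cond s x y)
  goes := Or.inl ⟨rfl, rfl⟩

theorem leg_graft_cases (m : (A.graft y g a b c Y X).Leg) :
    (∃ d : A.Leg, m = d.graft y g a b c Y X) ∨
      ∃ s, m = leafLeg A y g a b c Y X s ∨ m = (leafLeg A y g a b c Y X s).rev := by
  obtain ⟨e | s, p, q, h⟩ := m
  · left
    rcases h with ⟨rfl, rfl⟩ | ⟨rfl, rfl⟩
    · exact ⟨⟨e, A.src e, A.tgt e, Or.inl ⟨rfl, rfl⟩⟩, rfl⟩
    · exact ⟨⟨e, A.tgt e, A.src e, Or.inr ⟨rfl, rfl⟩⟩, rfl⟩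
  · right
    rcases h with ⟨rfl, rfl⟩ | ⟨rfl, rfl⟩
    · exact ⟨s, Or.inl rfl⟩
    · exact ⟨s, Or.inr rfl⟩

theorem Leg.Leads.graft {d d' : A.Leg} (h : d.Leads d') :
    (d.graft y g a b c Y X).Leads (d'.graft y g a b c Y X) := by
  induction h with
  | refl => exact .refl
  | tail _ hf ih =>
    obtain ⟨j, i, k, h1, h2, h3⟩ := hf
    refine Relation.ReflTransGen.tail ih ⟨some j, i, k, ?_, ?_, h3⟩
    · simp only [Leg.graft, h1, graftTerminal_inr]
    · simp only [Leg.graft, h2, graftTerminal_inr]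

theorem graftTerminal_eq_none {t : Terminal ↥({x}ᶜ : Set V) J} {i : Fin 3}
    (h : graftTerminal y a t = .inr (none, i)) : t = .inl y ∧ i = a := by
  rcases t with v | ⟨j, k⟩
  · by_cases hv : v = y
    · subst hv
      rw [graftTerminal_leaf] at h
      simp_all
    · rw [graftTerminal_inl hv] at h
      simp at h
  · simp [graftTerminal] at h

theorem graftTerminal_eq_some {t : Terminal ↥({x}ᶜ : Set V) J} {j : J} {i : Fin 3}
    (h : graftTerminal y a t = .inr (some j, i)) : t = .inr (j, i) :=
  graftTerminal_injective (h.trans (graftTerminal_inr j i).symm)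

theorem graftTerminal_eq_inl {t : Terminal ↥({x}ᶜ : Set V) J} {v : V}
    (h : graftTerminal y a t = .inl v) : ∃ w, t = .inl w ∧ w ≠ y ∧ v = w := by
  rcases t with w | ⟨j, k⟩
  · by_cases hw : w = y
    · subst hw
      rw [graftTerminal_leaf] at h
      cases h
    · rw [graftTerminal_inl hw] at h
      exact ⟨w, rfl, hw, (Sum.inl_injective h).symm⟩
  · simp [graftTerminal] at h

variable (hA : A.IsTreeLike) {l : A.Leg} (hl : l.source = .inl y)
  (hleaf : ∀ e, A.IsEnd e (.inl y) → e = l.track)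
include hA hl hleaf

theorem eq_of_source_leaf {d : A.Leg} (hd : d.source = .inl y) : d = l :=
  Leg.eq_of_track_eq hA (hleaf _ (hd ▸ d.isEnd_source)) (by rw [hd, hl])

/-- From an old leg one gets to the old legs that it led to before, and also to the new leaves if it
led to the old leaf. -/
theorem leads_graft {d : A.Leg} {m : (A.graft y g a b c Y X).Leg}
    (h : (d.graft y g a b c Y X).Leads m) :
    (∃ d', m = d'.graft y g a b c Y X ∧ d.Leads d') ∨
      ∃ s, m = leafLeg A y g a b c Y X s ∧ d.Leads l.rev ∧ g.kind.Linked a (cond s c b) := by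
  induction h with
  | refl => exact Or.inl ⟨d, rfl, .refl⟩
  | @tail m m' _ hf ih =>
    obtain ⟨o, i, k, h1, h2, h3⟩ := hf
    rcases ih with ⟨d', rfl, hd'⟩ | ⟨s, rfl, -⟩
    · rcases o with _ | j
      · obtain ⟨h4, rfl⟩ := graftTerminal_eq_none h1
        have h5 : d' = l.rev := by
          rw [← eq_of_source_leaf hA hl hleaf (d := d'.rev) h4]
          rfl
        rw [h5] at hd'
        rcases leg_graft_cases m' with ⟨d'', rfl⟩ | ⟨s, rfl | rfl⟩
        · exact absurd (graftTerminal_eq_none h2).2 h3.ne.symm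
        · have h6 : cond s c b = k := by simpa [leafLeg] using h2
          exact Or.inr ⟨s, rfl, hd', h6 ▸ h3⟩
        · simp [leafLeg, Leg.rev] at h2
      · have h4 := graftTerminal_eq_some h1
        rcases leg_graft_cases m' with ⟨d'', rfl⟩ | ⟨s, rfl | rfl⟩
        · exact Or.inl ⟨d'', rfl, hd'.tail ⟨j, i, k, h4, graftTerminal_eq_some h2, h3⟩⟩
        · simp [leafLeg] at h2
        · simp [leafLeg, Leg.rev] at h2
    · simp [leafLeg] at h1

theorem route_graft_old {u v : ↥({x}ᶜ : Set V)} (hu : u ≠ y) (hv : v ≠ y) :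
    (A.graft y g a b c Y X).Route u v ↔ A.Route u v := by
  constructor
  · rintro ⟨m, m', h1, h2, h3⟩
    rcases leg_graft_cases m with ⟨d, rfl⟩ | ⟨s, rfl | rfl⟩
    · rcases leads_graft hA hl hleaf h3 with ⟨d', rfl, hd'⟩ | ⟨s, rfl, -⟩
      · exact ⟨d, d', graftTerminal_injective (h1.trans (graftTerminal_inl hu).symm),
          graftTerminal_injective (h2.trans (graftTerminal_inl hv).symm), hd'⟩
      · have h4 : cond s x ↑y = (v : V) := by simpa [leafLeg] using h2
        cases s
        · exact absurd (Subtype.ext h4.symm) hv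
        · exact absurd h4.symm v.2
    · simp [leafLeg] at h1
    · have h4 : cond s x ↑y = (u : V) := by simpa [leafLeg] using h1
      cases s
      · exact absurd (Subtype.ext h4.symm) hu
      · exact absurd h4.symm u.2
  · rintro ⟨d, d', h1, h2, h3⟩
    exact ⟨_, _, (congrArg _ h1).trans (graftTerminal_inl hu),
      (congrArg _ h2).trans (graftTerminal_inl hv), h3.graft⟩

theorem route_graft_leaf {u : ↥({x}ᶜ : Set V)} (hu : u ≠ y) (s : Bool) :
    (A.graft y g a b c Y X).Route u (cond s x y) ↔
      g.kind.Linked a (cond s c b) ∧ A.Route u y := by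
  have hxy : x ≠ y := fun h => y.2 h.symm
  constructor
  · rintro ⟨m, m', h1, h2, h3⟩
    rcases leg_graft_cases m with ⟨d, rfl⟩ | ⟨s', rfl | rfl⟩
    · rcases leads_graft hA hl hleaf h3 with ⟨d', rfl, hd'⟩ | ⟨s', rfl, h4, h5⟩
      · obtain ⟨w, -, hw, h4⟩ := graftTerminal_eq_inl h2
        cases s
        · exact absurd (Subtype.ext h4.symm) hw
        · exact absurd h4.symm w.2
      · have h6 : cond s' x ↑y = cond s x ↑y := by simpa [leafLeg] using h2
        have h7 : s' = s := by
          cases s <;> cases s' <;> simp_all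
        exact ⟨h7 ▸ h5, d, l.rev, graftTerminal_injective (h1.trans (graftTerminal_inl hu).symm),
          hl, h4⟩
    · simp [leafLeg] at h1
    · have h4 : cond s' x ↑y = (u : V) := by simpa [leafLeg] using h1
      cases s'
      · exact absurd (Subtype.ext h4.symm) hu
      · exact absurd h4.symm u.2
  · rintro ⟨h, d, d', h1, h2, h3⟩
    have h4 : d' = l.rev := by
      rw [← eq_of_source_leaf hA hl hleaf (d := d'.rev) h2]
      rfl
    refine ⟨d.graft y g a b c Y X, leafLeg A y g a b c Y X s,
      (congrArg _ h1).trans (graftTerminal_inl hu), rfl,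
      Relation.ReflTransGen.tail h3.graft ⟨none, a, cond s c b, ?_, rfl, h⟩⟩
    rw [h4]
    exact (congrArg _ hl).trans graftTerminal_leaf

theorem route_graft_new : (A.graft y g a b c Y X).Route y x ↔ g.kind.Linked b c := by
  have hxy : x ≠ y := fun h => y.2 h.symm
  constructor
  · rintro ⟨m, m', h1, h2, h3⟩
    rcases leg_graft_cases m with ⟨d, rfl⟩ | ⟨s, rfl | rfl⟩
    · obtain ⟨w, -, hw, h4⟩ := graftTerminal_eq_inl h1
      exact absurd (Subtype.ext h4.symm) hw
    · simp [leafLeg] at h1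
    have hs : s = false := by
      cases s
      · rfl
      · exact absurd (by simpa [leafLeg] using h1) hxy
    subst hs
    have hm' : m' = leafLeg A y g a b c Y X true ∨
        m' = (leafLeg A y g a b c Y X false).rev := by
      rcases leg_graft_cases m' with ⟨d, rfl⟩ | ⟨s, rfl | rfl⟩
      · obtain ⟨w, -, hw, h4⟩ := graftTerminal_eq_inl h2
        exact absurd h4.symm w.2
      · cases s
        · exact absurd (by simpa [leafLeg] using h2) hxy.symm
        · exact Or.inl rfl
      · simp [leafLeg] at h2
    rcases hm' with rfl | rfl
    swap
    · simp [leafLeg] at h2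
    rcases Relation.ReflTransGen.cases_head h3 with h | ⟨m, ⟨o, i, k, h4, h5, h6⟩, h7⟩
    · simp [leafLeg, Leg.rev] at h
    obtain ⟨rfl, rfl⟩ : none = o ∧ b = i := by simpa [leafLeg, Leg.rev] using h4
    rcases leg_graft_cases m with ⟨d, rfl⟩ | ⟨s, rfl | rfl⟩
    · -- The old part of the drawing is a dead end: no leg leads to its own reverse.
      rcases leads_graft hA hl hleaf h7 with ⟨d', h, -⟩ | ⟨s, -, h8, -⟩
      · simp [leafLeg, Leg.graft] at h
      · rw [eq_of_source_leaf hA hl hleaf (graftTerminal_eq_none h5).1] at h8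
        have := h8.ahead_subset hA (l.rev.target_mem_ahead hA)
        exact absurd this l.source_notMem_ahead
    · have h8 : cond s c b = k := by simpa [leafLeg] using h5
      cases s
      · exact absurd h8 h6.ne
      · obtain rfl : c = k := h8
        exact h6
    · simp [leafLeg] at h5
  · intro h
    exact ⟨(leafLeg A y g a b c Y X false).rev, leafLeg A y g a b c Y X true, rfl, rfl,
      .single ⟨none, b, c, rfl, rfl, h⟩⟩

end Graft

end Drawing

/-! ### Line segments and triangular junctions -/

/-- The unit vector that points from `p` to `q`. -/
noncomputable def direction (p q : Plane) : Plane := ‖q - p‖⁻¹ • (q - p)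

theorem noSharpTurn_iff {d d' : Plane} (hd : d ≠ 0) (hd' : d' ≠ 0) :
    NoSharpTurn d d' ↔ inner ℝ d d' < 0 := by
  rw [NoSharpTurn, InnerProductGeometry.angle, ← not_le, Real.arccos_le_pi_div_two, not_le,
    div_neg_iff]
  have h : 0 < ‖d‖ * ‖d'‖ := by positivity
  simp [h, h.not_gt]

theorem direction_ne_zero {p q : Plane} (h : p ≠ q) : direction p q ≠ 0 :=
  smul_ne_zero (inv_ne_zero (norm_ne_zero_iff.2 (sub_ne_zero.2 h.symm))) (sub_ne_zero.2 h.symm)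

theorem noSharpTurn_direction {p q p' q' : Plane} (h : p ≠ q) (h' : p' ≠ q') :
    NoSharpTurn (direction p q) (direction p' q') ↔ inner ℝ (q - p) (q' - p') < 0 := by
  rw [noSharpTurn_iff (direction_ne_zero h) (direction_ne_zero h'), direction, direction,
    real_inner_smul_left, real_inner_smul_right]
  have h1 : 0 < ‖q - p‖⁻¹ := inv_pos.2 (norm_pos_iff.2 (sub_ne_zero.2 h.symm))
  have h2 : 0 < ‖q' - p'‖⁻¹ := inv_pos.2 (norm_pos_iff.2 (sub_ne_zero.2 h'.symm))
  simp only [mul_neg_iff, h1, h2, h1.not_gt, h2.not_gt, true_and, false_and, or_false]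

/-- The points on a ray from `p` through `q` lie in the direction of `q`. -/
theorem direction_of_ray {p q : Plane} {t : ℝ} (ht : 0 < t) :
    direction p (p + t • (q - p)) = direction p q := by
  rw [direction, direction, add_sub_cancel_left, norm_smul, Real.norm_of_nonneg ht.le, smul_smul,
    mul_inv, mul_comm t⁻¹, mul_assoc, inv_mul_cancel₀ ht.ne', mul_one]

theorem lineMap_eq (p q : Plane) (t : ℝ) : AffineMap.lineMap p q t = p + t • (q - p) := by
  rw [AffineMap.lineMap_apply_module', add_comm]

theorem trace_lineMap (p q : Plane) : trace (AffineMap.lineMap (k := ℝ) p q) = segment ℝ p q :=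
  (segment_eq_image_lineMap ℝ p q).symm

theorem hasRightTangent_lineMap (p q : Plane) (t : ℝ) :
    HasRightTangent (AffineMap.lineMap p q) t (direction p q) := by
  refine tendsto_const_nhds.congr' ?_
  filter_upwards [self_mem_nhdsWithin] with s (hs : t < s)
  have h : AffineMap.lineMap p q s - AffineMap.lineMap p q t = (s - t) • (q - p) := by
    rw [lineMap_eq, lineMap_eq, add_sub_add_left_eq_sub, ← sub_smul]
  have := direction_of_ray (p := p) (q := q) (sub_pos.2 hs)
  rw [← this, direction, add_sub_cancel_left, h]

theorem hasLeftTangent_lineMap (p q : Plane) (t : ℝ) :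
    HasLeftTangent (AffineMap.lineMap p q) t (direction q p) := by
  have h := (hasRightTangent_lineMap q p (1 - t)).reverse
  have h' : (fun s : ℝ => AffineMap.lineMap q p (1 - s)) = (AffineMap.lineMap p q : ℝ → Plane) := by
    funext s
    exact AffineMap.lineMap_apply_one_sub q p s
  rwa [h'] at h

theorem isLocallyMonotone_lineMap {p q : Plane} (h : p ≠ q) :
    IsLocallyMonotone (AffineMap.lineMap p q) p q where
  source := AffineMap.lineMap_apply_zero p q
  target := AffineMap.lineMap_apply_one p q
  continuousOn := AffineMap.lineMap_continuous.continuousOn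
  injOn := (AffineMap.lineMap_injective ℝ h).injOn
  tangent_source := ⟨_, hasRightTangent_lineMap p q 0⟩
  tangent_target := ⟨_, hasLeftTangent_lineMap p q 1⟩
  no_sharp_turn t _ := by
    refine ⟨_, _, hasLeftTangent_lineMap p q t, hasRightTangent_lineMap p q t, ?_⟩
    rw [noSharpTurn_direction h.symm h, ← neg_sub q p, inner_neg_left, neg_neg_iff_pos]
    exact real_inner_self_pos.2 (sub_ne_zero.2 h.symm)

theorem LeavesAlong.lineMap {p q x d : Plane} (h : LeavesAlong (AffineMap.lineMap p q) x d) :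
    (x = p ∧ d = direction p q) ∨ (x = q ∧ d = direction q p) := by
  rcases h with ⟨h1, h2⟩ | ⟨h1, h2⟩
  · left
    rw [AffineMap.lineMap_apply_zero] at h1
    exact ⟨h1.symm, h2.unique (hasRightTangent_lineMap p q 0)⟩
  · right
    rw [AffineMap.lineMap_apply_one] at h1
    exact ⟨h1.symm, h2.unique (hasLeftTangent_lineMap p q 1)⟩

theorem leavesAlong_lineMap_left (p q : Plane) :
    LeavesAlong (AffineMap.lineMap p q) p (direction p q) :=
  Or.inl ⟨AffineMap.lineMap_apply_zero p q, hasRightTangent_lineMap p q 0⟩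

theorem leavesAlong_lineMap_right (p q : Plane) :
    LeavesAlong (AffineMap.lineMap p q) q (direction q p) :=
  Or.inr ⟨AffineMap.lineMap_apply_one p q, hasLeftTangent_lineMap p q 1⟩

theorem mem_segment_iff {p q x : Plane} :
    x ∈ segment ℝ p q ↔ ∃ t ∈ Icc (0 : ℝ) 1, x = p + t • (q - p) := by
  rw [segment_eq_image']
  exact ⟨fun ⟨t, ht, h⟩ => ⟨t, ht, h.symm⟩, fun ⟨t, ht, h⟩ => ⟨t, ht, h.symm⟩⟩

/-- All angles of the triangle are acute. -/
def IsAcute (port : Fin 3 → Plane) : Prop :=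
  ∀ i k l, i ≠ k → i ≠ l → k ≠ l → 0 < inner ℝ (port k - port i) (port l - port i)

theorem IsAcute.injective {port : Fin 3 → Plane} (h : IsAcute port) :
    Function.Injective port := by
  intro i k hik
  by_contra hne
  have third : ∀ i k : Fin 3, ∃ l, i ≠ l ∧ k ≠ l := by decide
  obtain ⟨l, h1, h2⟩ := third i k
  have := h i k l hne h1 h2
  rw [hik, sub_self, inner_zero_left] at this
  exact lt_irrefl _ this

theorem IsAcute.notMem_segment {port : Fin 3 → Plane} (h : IsAcute port) {i k l : Fin 3}
    (hik : i ≠ k) (hli : l ≠ i) (hlk : l ≠ k) : port l ∉ segment ℝ (port i) (port k) := by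
  intro hmem
  obtain ⟨t, ht, htl⟩ := mem_segment_iff.1 hmem
  have h1 := h l i k hli hlk hik
  have e1 : port i - port l = (-t) • (port k - port i) := by
    rw [htl]
    module
  have e2 : port k - port l = (1 - t) • (port k - port i) := by
    rw [htl]
    module
  rw [e1, e2, real_inner_smul_left, real_inner_smul_right] at h1
  have h2 : 0 ≤ inner ℝ (port k - port i) (port k - port i) := real_inner_self_nonneg
  have h3 : 0 ≤ t * ((1 - t) * inner ℝ (port k - port i) (port k - port i)) :=
    mul_nonneg ht.1 (mul_nonneg (by linarith [ht.2]) h2)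
  linarith

theorem IsAcute.segment_inter {port : Fin 3 → Plane} (h : IsAcute port) {i k l : Fin 3}
    (hik : i ≠ k) (hil : i ≠ l) (hkl : k ≠ l) :
    segment ℝ (port i) (port k) ∩ segment ℝ (port i) (port l) ⊆ {port i} := by
  rintro x ⟨hx, hx'⟩
  obtain ⟨s, hs, rfl⟩ := mem_segment_iff.1 hx
  obtain ⟨t, ht, hst⟩ := mem_segment_iff.1 hx'
  have e : s • (port k - port i) = t • (port l - port i) := add_left_cancel hst
  set u := port k - port i with hu
  set w := port l - port i with hw
  have h1 : 0 < inner ℝ u w := h i k l hik hil hkl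
  have h2 := h k i l hik.symm hkl hil
  have h3 := h l i k hil.symm hkl.symm hik
  rw [show port i - port k = -u by rw [hu]; abel, show port l - port k = w - u by rw [hu, hw]; abel,
    inner_neg_left, inner_sub_right] at h2
  rw [show port i - port l = -w by rw [hw]; abel, show port k - port l = u - w by rw [hu, hw]; abel,
    inner_neg_left, inner_sub_right, real_inner_comm u w] at h3
  have e1 : s * inner ℝ u u = t * inner ℝ u w := by
    rw [← real_inner_smul_right, e, real_inner_smul_right]
  have e2 : s * inner ℝ u w = t * inner ℝ w w := by
    rw [← real_inner_smul_left, e, real_inner_smul_left]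
  have hs0 : s = 0 := by
    by_contra hne
    have hpos : 0 < s := lt_of_le_of_ne hs.1 (Ne.symm hne)
    nlinarith [ht.1, mul_pos hpos (by linarith : 0 < inner ℝ u u - inner ℝ u w),
      mul_nonneg ht.1 (by linarith : 0 ≤ inner ℝ w w - inner ℝ u w)]
  simp [hs0]

theorem JunctionKind.Joins.lt {K : JunctionKind} {i k : Fin 3} (h : K.Joins i k) : i < k := by
  cases K
  · exact h
  · exact h.2

/-- A curve that runs from one arm of an acute angle to the other makes a sharp turn. -/
theorem not_isLocallyMonotone_acute {o p q : Plane} {γ : ℝ → Plane}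
    (hpq : 0 < inner ℝ (p - o) (q - o)) (hint : segment ℝ o p ∩ segment ℝ o q ⊆ {o})
    (hγ : IsLocallyMonotone γ p q) (hsub : trace γ ⊆ segment ℝ o p ∪ segment ℝ o q) : False := by
  have hop : o ≠ p := by
    rintro rfl
    simp at hpq
  have hoq : o ≠ q := by
    rintro rfl
    simp at hpq
  have hclosed : ∀ a b : Plane, IsClosed (segment ℝ a b) := fun a b => by
    rw [← trace_lineMap]
    exact (isCompact_Icc.image AffineMap.lineMap_continuous).isClosed
  obtain ⟨τ, hτ, hτo, hbefore, hafter⟩ := hγ.exists_cut (hclosed o p) (hclosed o q) hsub hint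
    (right_mem_segment ℝ o p) (right_mem_segment ℝ o q)
  have hτ0 : 0 < τ := lt_of_le_of_ne hτ.1 fun h => hop (by rw [← hτo, ← h, hγ.source])
  have hτ1 : τ < 1 := lt_of_le_of_ne hτ.2 fun h => hoq (by rw [← hτo, h, hγ.target])
  have hdir : ∀ (r : Plane) (s : ℝ), γ s ∈ segment ℝ o r → s ∈ Icc (0 : ℝ) 1 → s ≠ τ →
      direction o r = ‖γ s - γ τ‖⁻¹ • (γ s - γ τ) := by
    intro r s hs hs1 hsτ
    obtain ⟨t, ht, hst⟩ := mem_segment_iff.1 hs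
    have ht0 : t ≠ 0 := by
      rintro rfl
      exact hsτ (hγ.injOn hs1 hτ (by rw [hst, hτo]; simp))
    rw [hst, hτo, ← direction_of_ray (lt_of_le_of_ne ht.1 ht0.symm), direction]
  obtain ⟨l, r, hl, hr, hlr⟩ := hγ.no_sharp_turn τ ⟨hτ0, hτ1⟩
  have hl' : HasLeftTangent γ τ (direction o p) := by
    refine tendsto_const_nhds.congr' ?_
    filter_upwards [Ioo_mem_nhdsLT hτ0] with s hs
    exact hdir p s (hbefore s ⟨hs.1.le, hs.2.le⟩) ⟨hs.1.le, hs.2.le.trans hτ.2⟩ hs.2.ne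
  have hr' : HasRightTangent γ τ (direction o q) := by
    refine tendsto_const_nhds.congr' ?_
    filter_upwards [Ioo_mem_nhdsGT hτ1] with s hs
    exact hdir q s (hafter s ⟨hs.1.le, hs.2.le⟩) ⟨hτ.1.trans hs.1.le, hs.2.le⟩ hs.1.ne'
  rw [hl.unique hl', hr.unique hr', noSharpTurn_direction hop hoq] at hlr
  linarith

/-- A junction whose arcs are sides of an acute triangle. The two arcs of a `Λ`-junction make a
sharp turn at its head. -/
noncomputable def triangleJunction (kind : JunctionKind) (port : Fin 3 → Plane)
    (h : IsAcute port) : Junction where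
  kind := kind
  port := port
  arc i k := AffineMap.lineMap (port i) (port k)
  port_injective := h.injective
  arc_locallyMonotone i k hik := isLocallyMonotone_lineMap (h.injective.ne hik.lt.ne)
  port_mem_arc i k l hik hl := by
    rw [trace_lineMap] at hl
    by_contra! hne
    exact h.notMem_segment hik.lt.ne hne.1 hne.2 hl
  arc_inter i k i' k' _ _ := by
    rw [trace_lineMap, trace_lineMap]
    exact ((convex_segment _ _).inter (convex_segment _ _)).isPreconnected
  tails_disconnected hk := by
    subst hk
    rintro ⟨γ, hγ, hsub⟩
    refine not_isLocallyMonotone_acute (o := port 0) (h 0 1 2 (by decide) (by decide) (by decide))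
      (h.segment_inter (by decide) (by decide) (by decide)) hγ (hsub.trans ?_)
    rintro x ⟨i, k, ⟨rfl, hk⟩, hx⟩
    rw [trace_lineMap] at hx
    have : k = 1 ∨ k = 2 := by
      revert hk
      clear hx
      revert k
      decide
    rcases this with rfl | rfl
    · exact Or.inl hx
    · exact Or.inr hx

theorem exists_segment_of_mem_region {kind : JunctionKind} {port : Fin 3 → Plane}
    {h : IsAcute port} {p : Plane} (hp : p ∈ (triangleJunction kind port h).region) :
    ∃ i k, i ≠ k ∧ p ∈ segment ℝ (port i) (port k) := by
  obtain ⟨i, k, hik, hp⟩ := hp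
  exact ⟨i, k, JunctionKind.Joins.lt hik |>.ne, trace_lineMap (port i) (port k) ▸ hp⟩

/-- The tangent at a port of a triangular junction points to another corner. -/
theorem exists_direction_of_leavesAlong {port : Fin 3 → Plane} (h : IsAcute port) {i k l : Fin 3}
    {d : Plane} (hkl : k ≠ l)
    (hd : LeavesAlong (AffineMap.lineMap (port k) (port l)) (port i) d) :
    ∃ m, m ≠ i ∧ d = direction (port i) (port m) := by
  rcases hd.lineMap with ⟨h1, h2⟩ | ⟨h1, h2⟩
  · obtain rfl := h.injective h1
    exact ⟨l, hkl.symm, h2⟩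
  · obtain rfl := h.injective h1
    exact ⟨k, hkl, h2⟩

/-! ### Coordinates near a leaf -/

/-- The point with coordinates `(s, t)` in the orthogonal frame at `o` whose first vector is `w`. -/
noncomputable def chart (o w : Plane) (s t : ℝ) : Plane :=
  o + s • w + t • !₂[-w 1, w 0]

section Chart

variable {o w : Plane}

theorem inner_chart (s t s' t' u v u' v' : ℝ) :
    inner ℝ (chart o w s t - chart o w s' t') (chart o w u v - chart o w u' v') =
      ((s - s') * (u - u') + (t - t') * (v - v')) * inner ℝ w w := by
  simp only [chart, PiLp.inner_apply, Fin.sum_univ_two]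
  simp
  ring

theorem chart_zero : chart o w 0 0 = o := by simp [chart]

theorem chart_add_smul (s t s' t' r : ℝ) :
    chart o w s t + r • (chart o w s' t' - chart o w s t) =
      chart o w (s + r * (s' - s)) (t + r * (t' - t)) := by
  simp only [chart]
  module

theorem chart_inj (hw : w ≠ 0) {s t s' t' : ℝ} :
    chart o w s t = chart o w s' t' ↔ s = s' ∧ t = t' := by
  refine ⟨fun h => ?_, fun h => by rw [h.1, h.2]⟩
  have h1 := inner_chart (o := o) (w := w) s t s' t' s t s' t'
  rw [h, sub_self, inner_zero_left] at h1
  have h2 : 0 < inner ℝ w w := real_inner_self_pos.2 hw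
  have h3 := (mul_eq_zero.1 h1.symm).resolve_right h2.ne'
  constructor <;> nlinarith [mul_self_nonneg (s - s'), mul_self_nonneg (t - t')]

theorem mem_segment_chart {s t s' t' : ℝ} {p : Plane} :
    p ∈ segment ℝ (chart o w s t) (chart o w s' t') ↔
      ∃ r ∈ Icc (0 : ℝ) 1, p = chart o w (s + r * (s' - s)) (t + r * (t' - t)) := by
  simp only [mem_segment_iff, chart_add_smul]

theorem dist_chart_le {s t m : ℝ} (hs : |s| ≤ m) (ht : |t| ≤ m) :
    dist (chart o w s t) o ≤ 2 * m * ‖w‖ := by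
  have hm : 0 ≤ m := (abs_nonneg s).trans hs
  have h1 := inner_chart (o := o) (w := w) s t 0 0 s t 0 0
  rw [chart_zero, real_inner_self_eq_norm_sq, real_inner_self_eq_norm_sq] at h1
  rw [dist_eq_norm]
  have h2 : s * s ≤ m * m := abs_le_iff_mul_self_le.1 (by rwa [abs_of_nonneg hm])
  have h3 : t * t ≤ m * m := abs_le_iff_mul_self_le.1 (by rwa [abs_of_nonneg hm])
  refine abs_le_of_sq_le_sq' ?_ (by positivity) |>.2
  rw [h1]
  nlinarith [mul_nonneg (mul_nonneg hm hm) (sq_nonneg ‖w‖), sq_nonneg ‖w‖,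
    mul_le_mul_of_nonneg_right h2 (sq_nonneg ‖w‖), mul_le_mul_of_nonneg_right h3 (sq_nonneg ‖w‖)]

end Chart

/-! ### Planarity of the grafted drawing -/

namespace Drawing

variable {V J E : Type*}

/-- All tracks are line segments, and every vertex is a leaf. -/
structure IsStraight (A : Drawing V J E) : Prop where
  track_eq : ∀ e, A.track e = AffineMap.lineMap (A.pos (A.src e)) (A.pos (A.tgt e))
  leaf : ∀ v, ∃! e, A.IsEnd e (.inl v)

theorem IsStraight.trace_leg {A : Drawing V J E} (hS : A.IsStraight) (l : A.Leg) :
    trace (A.track l.track) = segment ℝ (A.pos l.source) (A.pos l.target) := by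
  rw [hS.track_eq, trace_lineMap]
  rcases l.goes with ⟨h1, h2⟩ | ⟨h1, h2⟩
  · rw [h1, h2]
  · rw [h1, h2, segment_symm]

theorem IsStraight.leavesAlong_target {A : Drawing V J E} (hS : A.IsStraight) (l : A.Leg) :
    LeavesAlong (A.track l.track) (A.pos l.target)
      (direction (A.pos l.target) (A.pos l.source)) := by
  rw [hS.track_eq]
  rcases l.goes with ⟨h1, h2⟩ | ⟨h1, h2⟩
  · rw [h1, h2]
    exact leavesAlong_lineMap_right _ _
  · rw [h1, h2]
    exact leavesAlong_lineMap_left _ _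

theorem IsStraight.leavesAlong_cases {A : Drawing V J E} (hS : A.IsStraight) (l : A.Leg)
    {p d : Plane} (h : LeavesAlong (A.track l.track) p d) :
    (p = A.pos l.source ∧ d = direction (A.pos l.source) (A.pos l.target)) ∨
      (p = A.pos l.target ∧ d = direction (A.pos l.target) (A.pos l.source)) := by
  rw [hS.track_eq] at h
  rcases l.goes with ⟨h1, h2⟩ | ⟨h1, h2⟩
  · rw [h1, h2] at h
    exact h.lineMap
  · rw [h1, h2] at h
    exact h.lineMap.symm

theorem _root_.LeavesAlong.mem_trace {γ : ℝ → Plane} {p d : Plane} (h : LeavesAlong γ p d) :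
    p ∈ trace γ := by
  rcases h with ⟨h, -⟩ | ⟨h, -⟩
  · exact ⟨0, by simp, h⟩
  · exact ⟨1, by simp, h⟩

theorem pos_mem_part {A : Drawing V J E} {N : Set (V ⊕ J)} {t : Terminal V J} (h : t.node ∈ N) :
    A.pos t ∈ A.part N := by
  rcases t with v | ⟨j, i⟩
  · exact vertexPos_mem_part h
  · exact region_subset_part h ((A.junction j).port_mem_region i)

/-- The geometric conditions under which the junction `g` can be grafted in place of the leaf at the
source of `l`: the new parts lie in a region `B` that contains nothing of the old drawing but a
piece of the track of the leaf, and they fit together. -/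
structure IsGraftable {x : V} (A : Drawing ↥({x}ᶜ : Set V) J E) (y : ↥({x}ᶜ : Set V))
    (l : A.Leg) (g : Junction) (a b c : Fin 3) (Y X : Plane) (B : Set Plane) : Prop where
  port_ne : ∀ s, a ≠ cond s c b
  new_port_ne : b ≠ c
  old_notMem : ∀ p ∈ A.part {.inl y}ᶜ, p ∉ B
  region_subset : g.region ⊆ B
  new_subset : ∀ s, segment ℝ (g.port (cond s c b)) (cond s X Y) ⊆ B
  trunk_subset : segment ℝ (g.port a) (A.pos l.target) ⊆ trace (A.track l.track)
  direction_trunk :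
    direction (A.pos l.target) (g.port a) = direction (A.pos l.target) (A.vertexPos y)
  trunk_region : segment ℝ (g.port a) (A.pos l.target) ∩ g.region ⊆ {g.port a}
  trunk_new : ∀ s, Disjoint (segment ℝ (g.port a) (A.pos l.target))
    (segment ℝ (g.port (cond s c b)) (cond s X Y))
  new_new : Disjoint (segment ℝ (g.port b) Y) (segment ℝ (g.port c) X)
  new_region : ∀ s, segment ℝ (g.port (cond s c b)) (cond s X Y) ∩ g.region ⊆
    {g.port (cond s c b)}
  new_ne : ∀ s, g.port (cond s c b) ≠ cond s X Y
  smooth_trunk : ∀ k m d, g.kind.Joins k m → LeavesAlong (g.arc k m) (g.port a) d →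
    NoSharpTurn (direction (g.port a) (A.pos l.target)) d
  smooth_new : ∀ s k m d, g.kind.Joins k m → LeavesAlong (g.arc k m) (g.port (cond s c b)) d →
    NoSharpTurn (direction (g.port (cond s c b)) (cond s X Y)) d

section Graft

variable {x : V} {A : Drawing ↥({x}ᶜ : Set V) J E} {y : ↥({x}ᶜ : Set V)} {l : A.Leg}
  {g : Junction} {a b c : Fin 3} {Y X : Plane} {B : Set Plane}

theorem pos_graft_leaf : (A.graft y g a b c Y X).pos (graftTerminal y a (.inl y)) = g.port a := by
  rw [graftTerminal_leaf]
  rfl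

theorem vertexPos_graft_old {v : ↥({x}ᶜ : Set V)} (h : v ≠ y) :
    (A.graft y g a b c Y X).vertexPos v = A.vertexPos v := by
  have h1 : (v : V) ≠ x := v.2
  have h2 : (v : V) ≠ y := fun h' => h (Subtype.ext h')
  simp [graft, graftVertexPos, h1, h2]

theorem vertexPos_graft_new (s : Bool) :
    (A.graft y g a b c Y X).vertexPos (cond s x y) = cond s X Y := by
  have h1 : (y : V) ≠ x := y.2
  cases s <;> simp [graft, graftVertexPos, h1]

theorem pos_graft_old {t : Terminal ↥({x}ᶜ : Set V) J} (h : t ≠ .inl y) :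
    (A.graft y g a b c Y X).pos (graftTerminal y a t) = A.pos t := by
  rcases t with v | ⟨j, i⟩
  · have hv : v ≠ y := fun h' => h (congrArg _ h')
    rw [graftTerminal_inl hv]
    exact vertexPos_graft_old hv
  · rfl

theorem graft_vertex_cases (y : ↥({x}ᶜ : Set V)) (v : V) :
    (∃ w : ↥({x}ᶜ : Set V), w ≠ y ∧ v = w) ∨ ∃ s : Bool, v = cond s x y := by
  by_cases hx : v = x
  · exact Or.inr ⟨true, hx⟩
  · by_cases hy : v = y
    · exact Or.inr ⟨false, hy⟩
    · exact Or.inl ⟨⟨v, hx⟩, fun h => hy (congrArg Subtype.val h), rfl⟩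

theorem cond_ne_coe {v : ↥({x}ᶜ : Set V)} (h : v ≠ y) (s : Bool) : cond s x ↑y ≠ (v : V) := by
  cases s
  · exact fun h' => h (Subtype.ext h'.symm)
  · exact fun h' => v.2 h'.symm

theorem cond_injective (y : ↥({x}ᶜ : Set V)) {s s' : Bool} (h : cond s x ↑y = cond s' x ↑y) :
    s = s' := by
  have hxy : x ≠ y := fun h => y.2 h.symm
  cases s <;> cases s' <;> simp_all

theorem track_graft_new (s : Bool) : (A.graft y g a b c Y X).track (.inr s) =
    AffineMap.lineMap (g.port (cond s c b)) (cond s X Y) := by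
  rw [← vertexPos_graft_new (A := A) (g := g) (a := a) (b := b) (c := c)]
  rfl

section Straight

variable (hS : A.IsStraight) (hl : l.source = .inl y)
include hS hl

theorem leaf_track {e : E} (h : A.IsEnd e (.inl y)) : e = l.track :=
  (hS.leaf y).unique h (hl ▸ l.isEnd_source)

omit hl in
theorem isStraight_graft : (A.graft y g a b c Y X).IsStraight where
  track_eq _ := rfl
  leaf v := by
    rcases graft_vertex_cases y v with ⟨w, hw, rfl⟩ | ⟨s, rfl⟩
    · obtain ⟨e, he, huniq⟩ := hS.leaf w
      refine ⟨.inl e, isEnd_graft_inl.2 ⟨_, he, graftTerminal_inl hw⟩, ?_⟩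
      rintro (e' | s) he'
      · obtain ⟨t, ht, htw⟩ := isEnd_graft_inl.1 he'
        rw [graftTerminal_injective (htw.trans (graftTerminal_inl hw).symm)] at ht
        rw [huniq e' ht]
      · rcases isEnd_graft_inr.1 he' with h | h
        · cases h
        · exact absurd (Sum.inl_injective h) (cond_ne_coe hw s)
    · refine ⟨.inr s, Or.inr rfl, ?_⟩
      rintro (e' | s') he'
      · obtain ⟨t, ht, htw⟩ := isEnd_graft_inl.1 he'
        obtain ⟨w, -, hw, h⟩ := graftTerminal_eq_inl htw
        exact absurd h (cond_ne_coe hw s)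
      · rcases isEnd_graft_inr.1 he' with h | h
        · cases h
        · rw [cond_injective y (Sum.inl_injective h)]

theorem track_graft_old {e : E} (h : e ≠ l.track) :
    (A.graft y g a b c Y X).track (.inl e) = A.track e := by
  rw [hS.track_eq]
  have h1 : A.src e ≠ .inl y := fun h' => h (leaf_track hS hl (Or.inl h'))
  have h2 : A.tgt e ≠ .inl y := fun h' => h (leaf_track hS hl (Or.inr h'))
  rw [← pos_graft_old (A := A) (g := g) (a := a) (b := b) (c := c) (Y := Y) (X := X) h1,
    ← pos_graft_old (A := A) (g := g) (a := a) (b := b) (c := c) (Y := Y) (X := X) h2]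
  rfl

theorem trace_old_subset {e : E} (h : e ≠ l.track) :
    trace (A.track e) ⊆ A.part {.inl y}ᶜ := by
  obtain ⟨m, rfl, -⟩ := exists_leg (Or.inl rfl : A.IsEnd e (A.src e))
  refine trace_subset_part (fun h' => ?_) fun h' => ?_
  · exact h (leaf_track hS hl (node_eq_inl h' ▸ m.isEnd_source))
  · exact h (leaf_track hS hl (node_eq_inl h' ▸ m.isEnd_target))

variable (hA : A.IsTreeLike)
include hA

omit hS in
theorem target_ne_leaf : l.target ≠ .inl y := fun h => l.node_ne hA (by rw [hl, h])

theorem trace_graft_trunk : trace ((A.graft y g a b c Y X).track (.inl l.track)) =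
    segment ℝ (g.port a) (A.pos l.target) := by
  have h := (isStraight_graft (g := g) (a := a) (b := b) (c := c) (Y := Y) (X := X) hS).trace_leg
    (l.graft y g a b c Y X)
  rw [show (l.graft y g a b c Y X).source = graftTerminal y a (.inl y) from
      congrArg (graftTerminal y a) hl,
    show (l.graft y g a b c Y X).target = graftTerminal y a l.target from rfl, pos_graft_leaf,
    pos_graft_old (target_ne_leaf hl hA)] at h
  exact h

theorem leavesAlong_trunk {p d : Plane}
    (h : LeavesAlong ((A.graft y g a b c Y X).track (.inl l.track)) p d) :
    (p = g.port a ∧ d = direction (g.port a) (A.pos l.target)) ∨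
      (p = A.pos l.target ∧ d = direction (A.pos l.target) (g.port a)) := by
  have h := (isStraight_graft hS).leavesAlong_cases (l.graft y g a b c Y X) h
  rw [show (l.graft y g a b c Y X).source = graftTerminal y a (.inl y) from
      congrArg (graftTerminal y a) hl,
    show (l.graft y g a b c Y X).target = graftTerminal y a l.target from rfl, pos_graft_leaf,
    pos_graft_old (target_ne_leaf hl hA)] at h
  exact h

variable (hP : A.IsPlanar) (hg : IsGraftable A y l g a b c Y X B)
include hP hg

omit hP in
theorem trace_graft_subset (e : E) :
    trace ((A.graft y g a b c Y X).track (.inl e)) ⊆ trace (A.track e) := by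
  by_cases h : e = l.track
  · rw [h, trace_graft_trunk hS hl hA]
    exact hg.trunk_subset
  · rw [track_graft_old hS hl h]

omit hS hl hA hP in
theorem trace_new_subset (s : Bool) :
    trace ((A.graft y g a b c Y X).track (.inr s)) ⊆ B := by
  rw [track_graft_new, trace_lineMap]
  exact hg.new_subset s

omit hA hP in
theorem trace_old_disjoint {e : E} (h : e ≠ l.track) {p : Plane}
    (hp : p ∈ trace ((A.graft y g a b c Y X).track (.inl e))) : p ∉ B := by
  rw [track_graft_old hS hl h] at hp
  exact hg.old_notMem p (trace_old_subset hS hl h hp)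

omit hS hl hA hP in
theorem region_old_disjoint {j : J} {p : Plane} (hp : p ∈ (A.junction j).region) : p ∉ B :=
  hg.old_notMem p (region_subset_part (by simp) hp)

omit hS hl hA hP in
theorem vertex_old_disjoint {v : ↥({x}ᶜ : Set V)} (h : v ≠ y) : A.vertexPos v ∉ B :=
  hg.old_notMem _ (vertexPos_mem_part (by simpa using h))

/-- Grafting a junction with two new leaves in place of a leaf preserves planarity. -/
theorem isPlanar_graft : (A.graft y g a b c Y X).IsPlanar := by
  have hZ : A.pos l.target ∉ B := hg.old_notMem _ (pos_mem_part (N := {.inl y}ᶜ) fun h =>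
    target_ne_leaf hl hA (node_eq_inl h))
  have haB : g.port a ∈ B := hg.region_subset (g.port_mem_region a)
  have hnewB : ∀ s, cond s X Y ∈ B := fun s => hg.new_subset s (right_mem_segment ℝ _ _)
  have hnew_region : ∀ s, cond s X Y ∉ g.region := fun s h =>
    hg.new_ne s (hg.new_region s ⟨right_mem_segment ℝ _ _, h⟩).symm
  have hnew_new : ∀ s s' p, s ≠ s' → p ∈ segment ℝ (g.port (cond s c b)) (cond s X Y) →
      p ∉ segment ℝ (g.port (cond s' c b)) (cond s' X Y) := by
    rintro (_ | _) (_ | _) p hne h h'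
    · exact hne rfl
    · exact Set.disjoint_left.1 hg.new_new h h'
    · exact Set.disjoint_left.1 hg.new_new h' h
    · exact hne rfl
  have htrace : ∀ s, trace ((A.graft y g a b c Y X).track (.inr s)) =
      segment ℝ (g.port (cond s c b)) (cond s X Y) := fun s => by
    rw [track_graft_new, trace_lineMap]
  -- The trunk is the only old track that enters the region `B`.
  have hout : ∀ e p, p ∈ trace ((A.graft y g a b c Y X).track (.inl e)) → p ∈ B →
      e = l.track := fun e p hp hpB => by
    by_contra h
    exact trace_old_disjoint hS hl hg h hp hpB
  constructor
  · rintro (e | s)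
    · refine isLocallyMonotone_lineMap ?_
      change (A.graft y g a b c Y X).pos (graftTerminal y a (A.src e)) ≠
        (A.graft y g a b c Y X).pos (graftTerminal y a (A.tgt e))
      have hne := (hP.track_locallyMonotone e).ne
      by_cases h1 : A.src e = .inl y
      · have h2 : A.tgt e ≠ .inl y := fun h2 => hne (by rw [h1, h2])
        rw [h1, pos_graft_leaf, pos_graft_old h2]
        rintro h
        exact hg.old_notMem _ (pos_mem_part (N := {.inl y}ᶜ) fun h => h2 (node_eq_inl h))
          (h ▸ haB)
      · rw [pos_graft_old h1]
        by_cases h2 : A.tgt e = .inl y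
        · rw [h2, pos_graft_leaf]
          rintro h
          exact hg.old_notMem _ (pos_mem_part (N := {.inl y}ᶜ) fun h => h1 (node_eq_inl h))
            (h ▸ haB)
        · rw [pos_graft_old h2]
          exact hne
    · have h := isLocallyMonotone_lineMap (hg.new_ne s)
      rw [← track_graft_new (A := A) (y := y) (a := a)] at h
      rw [← vertexPos_graft_new (A := A) (y := y) (g := g) (a := a) (b := b) (c := c)] at h
      exact h
  · rintro (_ | j) i
    · by_cases hia : i = a
      · subst hia
        refine ⟨.inl l.track, isEnd_graft_inl.2 ⟨_, l.isEnd_source, ?_⟩, ?_⟩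
        · rw [hl, graftTerminal_leaf]
        rintro (e | s) he
        · obtain ⟨t, ht, h⟩ := isEnd_graft_inl.1 he
          rw [(graftTerminal_eq_none h).1] at ht
          rw [leaf_track hS hl ht]
        · rcases isEnd_graft_inr.1 he with h | h
          · exact absurd (by simpa using h.symm) (hg.port_ne s)
          · cases h
      · have hs : ∃ s, i = cond s c b := by
          have h1 := hg.port_ne false
          have h2 := hg.port_ne true
          have h3 := hg.new_port_ne
          have key : ∀ i a b c : Fin 3, i ≠ a → a ≠ b → a ≠ c → b ≠ c → i = b ∨ i = c := by
            decide
          rcases key i a b c hia h1 h2 h3 with h | h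
          · exact ⟨false, h⟩
          · exact ⟨true, h⟩
        obtain ⟨s, rfl⟩ := hs
        refine ⟨.inr s, Or.inl rfl, ?_⟩
        rintro (e | s') he
        · obtain ⟨t, ht, h⟩ := isEnd_graft_inl.1 he
          exact absurd (graftTerminal_eq_none h).2 hia
        · rcases isEnd_graft_inr.1 he with h | h
          · have h' : cond s' c b = cond s c b := by simpa using h
            have h3 := hg.new_port_ne
            cases s <;> cases s' <;> simp_all
          · cases h
    · obtain ⟨e, he, huniq⟩ := hP.port_track j i
      refine ⟨.inl e, isEnd_graft_inl.2 ⟨_, he, rfl⟩, ?_⟩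
      rintro (e' | s) he'
      · obtain ⟨t, ht, h⟩ := isEnd_graft_inl.1 he'
        rw [graftTerminal_eq_some h] at ht
        rw [huniq e' ht]
      · rcases isEnd_graft_inr.1 he' with h | h <;> simp at h
  · rintro (e | s) (_ | j) i k m d d' hjoin hd hd'
    · change LeavesAlong _ (g.port i) d at hd
      have hi : g.port i ∈ B := hg.region_subset (g.port_mem_region i)
      have he := hout e _ hd.mem_trace hi
      rw [he] at hd
      rcases leavesAlong_trunk hS hl hA hd with ⟨h1, rfl⟩ | ⟨h1, -⟩
      · obtain rfl := g.port_injective h1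
        exact hg.smooth_trunk k m d' hjoin hd'
      · exact absurd (h1 ▸ hi) hZ
    · refine hP.port_smooth e j i k m d d' hjoin ?_ hd'
      by_cases he : e = l.track
      · subst he
        rcases leavesAlong_trunk hS hl hA hd with ⟨h1, -⟩ | ⟨h1, rfl⟩
        · exact absurd haB (h1 ▸ region_old_disjoint hg
            ((A.junction j).port_mem_region i))
        · change (A.junction j).port i = _ at h1
          rw [h1, hg.direction_trunk]
          have := hS.leavesAlong_target l
          rwa [hl] at this
      · rwa [track_graft_old hS hl he] at hd
    · change LeavesAlong _ (g.port i) d at hd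
      rw [track_graft_new] at hd
      rcases hd.lineMap with ⟨h1, rfl⟩ | ⟨h1, -⟩
      · obtain rfl := g.port_injective h1
        exact hg.smooth_new s k m d' hjoin hd'
      · exact absurd (h1 ▸ g.port_mem_region i) (hnew_region s)
    · exact absurd (trace_new_subset hg s hd.mem_trace)
        (region_old_disjoint hg ((A.junction j).port_mem_region i))
  · intro v v' h
    rcases graft_vertex_cases y v with ⟨w, hw, rfl⟩ | ⟨s, rfl⟩ <;>
      rcases graft_vertex_cases y v' with ⟨w', hw', rfl⟩ | ⟨s', rfl⟩
    · rw [vertexPos_graft_old hw, vertexPos_graft_old hw'] at h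
      rw [hP.vertex_vertex h]
    · rw [vertexPos_graft_old hw, vertexPos_graft_new] at h
      exact absurd (h ▸ hnewB s') (vertex_old_disjoint hg hw)
    · rw [vertexPos_graft_old hw', vertexPos_graft_new] at h
      exact absurd (h ▸ hnewB s) (vertex_old_disjoint hg hw')
    · rw [vertexPos_graft_new, vertexPos_graft_new] at h
      by_contra hne
      exact hnew_new s s' _ (fun h => hne (by rw [h])) (right_mem_segment ℝ _ _)
        (h ▸ right_mem_segment ℝ _ _)
  · intro v o
    rcases graft_vertex_cases y v with ⟨w, hw, rfl⟩ | ⟨s, rfl⟩ <;> rcases o with _ | j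
    · rw [vertexPos_graft_old hw]
      exact fun h => vertex_old_disjoint hg hw (hg.region_subset h)
    · rw [vertexPos_graft_old hw]
      exact hP.vertex_junction w j
    · rw [vertexPos_graft_new]
      exact hnew_region s
    · rw [vertexPos_graft_new]
      exact fun h => region_old_disjoint hg h (hnewB s)
  · intro v e' h
    rcases graft_vertex_cases y v with ⟨w, hw, rfl⟩ | ⟨s, rfl⟩ <;> rcases e' with e | s'
    · rw [vertexPos_graft_old hw] at h
      exact isEnd_graft_inl.2 ⟨_, hP.vertex_track w e (trace_graft_subset hS hl hA hg e h),
        graftTerminal_inl hw⟩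
    · rw [vertexPos_graft_old hw] at h
      exact absurd (trace_new_subset hg s' h) (vertex_old_disjoint hg hw)
    · rw [vertexPos_graft_new] at h
      rw [hout e _ h (hnewB s), trace_graft_trunk hS hl hA] at h
      exact absurd (right_mem_segment ℝ _ _) (Set.disjoint_left.1 (hg.trunk_new s) h)
    · rw [vertexPos_graft_new, htrace] at h
      by_cases hs : s = s'
      · subst hs
        exact Or.inr rfl
      · exact absurd h (hnew_new s s' _ hs (right_mem_segment ℝ _ _))
  · intro o o' hne
    rw [Set.disjoint_left]
    rcases o with _ | j <;> rcases o' with _ | j'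
    · exact absurd rfl hne
    · exact fun p hp hp' => region_old_disjoint hg hp' (hg.region_subset hp)
    · exact fun p hp hp' => region_old_disjoint hg hp (hg.region_subset hp')
    · exact fun p hp hp' => Set.disjoint_left.1
        (hP.junction_junction j j' fun h => hne (by rw [h])) hp hp'
  · rintro (e | s) (_ | j) p ⟨hp, hp'⟩
    · have he := hout e p hp (hg.region_subset hp')
      subst he
      rw [trace_graft_trunk hS hl hA] at hp
      refine ⟨a, isEnd_graft_inl.2 ⟨_, l.isEnd_source, ?_⟩, hg.trunk_region ⟨hp, hp'⟩⟩
      rw [hl, graftTerminal_leaf]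
    · obtain ⟨i, hi, h⟩ := hP.track_junction e j p ⟨trace_graft_subset hS hl hA hg e hp, hp'⟩
      exact ⟨i, isEnd_graft_inl.2 ⟨_, hi, rfl⟩, h⟩
    · rw [htrace] at hp
      exact ⟨cond s c b, Or.inl rfl, hg.new_region s ⟨hp, hp'⟩⟩
    · exact absurd (trace_new_subset hg s hp)
        (region_old_disjoint hg hp')
  · have hmix : ∀ e s p, p ∈ trace ((A.graft y g a b c Y X).track (.inl e)) →
        p ∉ trace ((A.graft y g a b c Y X).track (.inr s)) := by
      intro e s p hp hp'
      have he := hout e p hp (trace_new_subset hg s hp')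
      rw [he, trace_graft_trunk hS hl hA] at hp
      rw [htrace] at hp'
      exact Set.disjoint_left.1 (hg.trunk_new s) hp hp'
    rintro (e | s) (e' | s') hne p ⟨hp, hp'⟩
    · have hne' : e ≠ e' := fun h => hne (by rw [h])
      obtain ⟨t, h1, h2, h3⟩ := hP.track_track e e' hne' p
        ⟨trace_graft_subset hS hl hA hg e hp, trace_graft_subset hS hl hA hg e' hp'⟩
      have hty : t ≠ .inl y := by
        rintro rfl
        exact hne' ((leaf_track hS hl h1).trans (leaf_track hS hl h2).symm)
      exact ⟨graftTerminal y a t, isEnd_graft_inl.2 ⟨t, h1, rfl⟩, isEnd_graft_inl.2 ⟨t, h2, rfl⟩,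
        by rw [pos_graft_old hty, h3]⟩
    · exact absurd hp' (hmix e s' p hp)
    · exact absurd hp (hmix e' s p hp')
    · rw [htrace] at hp hp'
      exact absurd hp' (hnew_new s s' p (fun h => hne (by rw [h])) hp)

omit hA hg in
/-- A small enough triangle around the leaf can be grafted. In the coordinates given by the leaf and
the other end of its track, its corners are `(ε, 0)` and `(-ε, ±ε)`, and the new leaves are
`(-2ε, ±2ε)`. -/
theorem exists_isGraftable [Finite V] [Finite J] [Finite E] (kind : JunctionKind) (hab : a ≠ b)
    (hac : a ≠ c) (hbc : b ≠ c) :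
    ∃ g Y X B, g.kind = kind ∧ IsGraftable A y l g a b c Y X B := by
  set o := A.vertexPos y with ho
  set w := A.pos l.target - o with hw
  obtain ⟨R, hR, hball⟩ : ∃ R > 0, Metric.ball o R ⊆ (A.part {.inl y}ᶜ)ᶜ := by
    refine Metric.isOpen_iff.1 (isClosed_part hP _).isOpen_compl o ?_
    exact Set.disjoint_left.1 (disjoint_part hP disjoint_compl_right)
      (vertexPos_mem_part (N := {.inl y}) rfl)
  have hw0 : w ≠ 0 := by
    obtain ⟨γ, hγ⟩ := l.exists_traverses hP
    have := hγ.locallyMonotone.ne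
    rw [hl] at this
    exact sub_ne_zero.2 this.symm
  have hwpos : 0 < ‖w‖ := norm_pos_iff.2 hw0
  have hW : 0 < inner ℝ w w := real_inner_self_pos.2 hw0
  obtain ⟨ε, hε, hε1, hεR⟩ : ∃ ε > 0, ε < 1 ∧ 2 * (2 * ε) * ‖w‖ < R := by
    refine ⟨min (1 / 2) (R / (8 * ‖w‖)), by positivity, (min_le_left _ _).trans_lt (by norm_num),
      ?_⟩
    have h1 : min (1 / 2) (R / (8 * ‖w‖)) * (8 * ‖w‖) ≤ R :=
      (le_div_iff₀ (by positivity)).1 (min_le_right _ _)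
    linarith
  have hεW : 0 < ε ^ 2 * inner ℝ w w := by positivity
  have hZ : A.pos l.target = chart o w 1 0 := by simp [chart, hw]
  set u : Fin 3 → ℝ := fun i => if i = a then ε else -ε with hu
  set v : Fin 3 → ℝ := fun i => if i = a then 0 else if i = b then ε else -ε with hv
  have hua : u a = ε := if_pos rfl
  have hub : u b = -ε := if_neg hab.symm
  have huc : u c = -ε := if_neg hac.symm
  have hva : v a = 0 := if_pos rfl
  have hvb : v b = ε := by rw [hv]; simp [hab.symm]
  have hvc : v c = -ε := by rw [hv]; simp [hac.symm, hbc.symm]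
  have hcov : ∀ i, i = a ∨ i = b ∨ i = c := by
    have key : ∀ i a b c : Fin 3, a ≠ b → a ≠ c → b ≠ c → i = a ∨ i = b ∨ i = c := by decide
    exact fun i => key i a b c hab hac hbc
  set port : Fin 3 → Plane := fun i => chart o w (u i) (v i) with hport
  have hacute : IsAcute port := by
    intro i k m hik him hkm
    simp only [hport]
    rw [inner_chart]
    rcases hcov i with rfl | rfl | rfl <;> rcases hcov k with rfl | rfl | rfl <;>
      rcases hcov m with rfl | rfl | rfl <;> first | contradiction | skip
    all_goals
      simp only [hua, hub, huc, hva, hvb, hvc]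
      linarith
  have hpb : ∀ s : Bool, port (cond s c b) = chart o w (-ε) (cond s (-ε) ε) := by
    rintro (_ | _)
    · simp only [hport, cond_false, hub, hvb]
    · simp only [hport, cond_true, huc, hvc]
  have hpa : port a = chart o w ε 0 := by simp only [hport, hua, hva]
  set Y := chart o w (-2 * ε) (2 * ε) with hY
  set X := chart o w (-2 * ε) (-2 * ε) with hX
  have hXY : ∀ s : Bool, cond s X Y = chart o w (-2 * ε) (2 * cond s (-ε) ε) := by
    rintro (_ | _)
    · rfl
    · simp [hX]
  have hinB : ∀ s t, |s| ≤ 2 * ε → |t| ≤ 2 * ε → chart o w s t ∈ Metric.ball o R := fun s t hs ht =>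
    (dist_chart_le hs ht).trans_lt hεR
  have hreg : ∀ p ∈ (triangleJunction kind port hacute).region,
      ∃ s t, p = chart o w s t ∧ |s| ≤ ε ∧ |t| ≤ ε := by
    have hle : ∀ i, |u i| ≤ ε ∧ |v i| ≤ ε := by
      intro i
      rcases hcov i with rfl | rfl | rfl
      · rw [hua, hva]
        simp [abs_of_pos hε, hε.le]
      · rw [hub, hvb]
        simp [abs_of_pos hε]
      · rw [huc, hvc]
        simp [abs_of_pos hε]
    have hconv : ∀ p q r : ℝ, |p| ≤ ε → |q| ≤ ε → r ∈ Icc (0 : ℝ) 1 → |p + r * (q - p)| ≤ ε := by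
      intro p q r hp hq hr
      rw [abs_le] at *
      constructor <;> nlinarith [hr.1, hr.2]
    intro p hp
    obtain ⟨i, k, -, hp⟩ := exists_segment_of_mem_region hp
    obtain ⟨r, hr, rfl⟩ := mem_segment_chart.1 hp
    exact ⟨_, _, rfl, hconv _ _ _ (hle i).1 (hle k).1 hr, hconv _ _ _ (hle i).2 (hle k).2 hr⟩
  have htrunk : ∀ p ∈ segment ℝ (port a) (A.pos l.target), ∃ s, ε ≤ s ∧ p = chart o w s 0 := by
    intro p hp
    rw [hpa, hZ] at hp
    obtain ⟨r, hr, rfl⟩ := mem_segment_chart.1 hp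
    exact ⟨ε + r * (1 - ε), by nlinarith [hr.1], by congr 1; ring⟩
  have hnew : ∀ (s : Bool) p, p ∈ segment ℝ (port (cond s c b)) (cond s X Y) →
      ∃ r ∈ Icc (0 : ℝ) 1, p = chart o w (-(1 + r) * ε) ((1 + r) * cond s (-ε) ε) := by
    intro s p hp
    rw [hpb, hXY] at hp
    obtain ⟨r, hr, rfl⟩ := mem_segment_chart.1 hp
    exact ⟨r, hr, by congr 1 <;> ring⟩
  have hsign : ∀ s : Bool, |cond s (-ε) ε| = ε := by
    rintro (_ | _) <;> simp [abs_of_pos hε]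
  have hsmooth : ∀ {i k m : Fin 3} {q d : Plane}, kind.Joins k m → port i ≠ q →
      (∀ n, n ≠ i → inner ℝ (q - port i) (port n - port i) < 0) →
      LeavesAlong (AffineMap.lineMap (port k) (port m)) (port i) d →
      NoSharpTurn (direction (port i) q) d := by
    intro i k m q d hjoin hne hinner hd
    obtain ⟨n, hn, rfl⟩ := exists_direction_of_leavesAlong hacute hjoin.lt.ne hd
    exact (noSharpTurn_direction hne (hacute.injective.ne hn.symm)).2 (hinner n hn)
  have hpZ : port a ≠ A.pos l.target := by
    rw [hpa, hZ, Ne, chart_inj hw0]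
    rintro ⟨h, -⟩
    exact hε1.ne h
  have hpXY : ∀ s : Bool, port (cond s c b) ≠ cond s X Y := by
    intro s
    rw [hpb, hXY, Ne, chart_inj hw0]
    rintro ⟨h, -⟩
    linarith
  have hPZ : port a = A.pos l.target + (1 - ε) • (o - A.pos l.target) := by
    rw [hpa, hZ]
    simp only [chart]
    module
  refine ⟨triangleJunction kind port hacute, Y, X, Metric.ball o R, rfl, ?_⟩
  refine ⟨by rintro (_ | _) <;> assumption, hbc, fun p hp hpB => hball hpB hp, ?_, ?_, ?_, ?_, ?_,
    ?_, ?_, ?_, hpXY, ?_, ?_⟩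
  · intro p hp
    obtain ⟨s, t, rfl, hs, ht⟩ := hreg p hp
    exact hinB s t (by linarith) (by linarith)
  · intro s p hp
    obtain ⟨r, hr, rfl⟩ := hnew s p hp
    have h1 : 0 ≤ 1 + r := by linarith [hr.1]
    refine hinB _ _ ?_ ?_
    · rw [abs_mul, abs_neg, abs_of_nonneg h1, abs_of_pos hε]
      nlinarith [hr.2]
    · rw [abs_mul, hsign, abs_of_nonneg h1]
      nlinarith [hr.2]
  · rw [hS.trace_leg l, hl]
    refine (convex_segment _ _).segment_subset ?_ (right_mem_segment ℝ _ _)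
    rw [segment_symm]
    exact mem_segment_iff.2 ⟨1 - ε, ⟨by linarith, by linarith⟩, hPZ⟩
  · change direction _ (port a) = _
    rw [hPZ, direction_of_ray (by linarith)]
  · rintro p ⟨hp, hp'⟩
    obtain ⟨s, t, rfl, hs, -⟩ := hreg p hp'
    obtain ⟨s', hs', h⟩ := htrunk _ hp
    obtain ⟨rfl, rfl⟩ := (chart_inj hw0).1 h
    have h1 : s = ε := le_antisymm ((le_abs_self s).trans hs) hs'
    rw [h1]
    exact hpa.symm
  · intro s
    rw [Set.disjoint_left]
    intro p hp hp'
    obtain ⟨r, hr, rfl⟩ := hnew s p hp'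
    obtain ⟨s', hs', h⟩ := htrunk _ hp
    obtain ⟨h1, -⟩ := (chart_inj hw0).1 h
    nlinarith [hr.1]
  · rw [Set.disjoint_left]
    intro p hp hp'
    obtain ⟨r, hr, rfl⟩ := hnew false p hp
    obtain ⟨r', hr', h⟩ := hnew true _ hp'
    obtain ⟨-, h2⟩ := (chart_inj hw0).1 h
    simp only [cond_false, cond_true] at h2
    nlinarith [hr.1, hr'.1]
  · rintro s p ⟨hp, hp'⟩
    obtain ⟨r, hr, rfl⟩ := hnew s p hp
    obtain ⟨s', t', h, hs', -⟩ := hreg _ hp'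
    obtain ⟨h1, -⟩ := (chart_inj hw0).1 h
    have h2 := (abs_le.1 hs').1
    have h3 : r = 0 := by
      by_contra hne
      nlinarith [mul_pos (lt_of_le_of_ne hr.1 (Ne.symm hne)) hε]
    rw [h3]
    change _ = port (cond s c b)
    rw [hpb]
    congr 1 <;> ring
  · intro k m d hjoin hd
    refine hsmooth hjoin hpZ (fun n hn => ?_) hd
    rw [hZ, hpa]
    simp only [hport]
    rw [inner_chart]
    have hun : u n = -ε := if_neg hn
    rw [hun]
    have := mul_pos (mul_pos hε (by linarith : 0 < 1 - ε)) hW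
    nlinarith
  · intro s k m d hjoin hd
    refine hsmooth hjoin (hpXY s) (fun n hn => ?_) hd
    rw [hpb, hXY]
    simp only [hport]
    rw [inner_chart]
    cases s <;> rcases hcov n with rfl | rfl | rfl <;> first | contradiction | skip
    all_goals
      simp only [hua, hub, huc, hva, hvb, hvc, cond_true, cond_false]
      linarith

end Straight

end Graft

end Drawing

/-! ### Drawings of distance-hereditary graphs -/

namespace Drawing

variable {V : Type*}

open Classical in
/-- The drawing that consists of two vertices and the segment between them. -/
noncomputable def edge (p q : V) : Drawing V Empty Unit :=
  let place : V → Plane := fun v => if v = p then 0 else EuclideanSpace.single 0 1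
  { vertexPos := place
    junction := Empty.elim
    src := fun _ => .inl p
    tgt := fun _ => .inl q
    track := fun _ => AffineMap.lineMap (place p) (place q) }

section Edge

variable {p q : V}

theorem isStraight_edge (hV : ∀ v, v = p ∨ v = q) : (edge p q).IsStraight where
  track_eq _ := rfl
  leaf v := ⟨(), (hV v).imp (fun h => congrArg _ h.symm) fun h => congrArg _ h.symm,
    fun _ _ => rfl⟩

variable (hpq : p ≠ q) (hV : ∀ v, v = p ∨ v = q)
include hpq

theorem vertexPos_edge_ne : (edge p q).vertexPos p ≠ (edge p q).vertexPos q := by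
  simp only [edge, if_true, if_neg hpq.symm]
  intro h
  have := congrFun (congrArg WithLp.ofLp h) 0
  simp at this

include hV

theorem isPlanar_edge : (edge p q).IsPlanar where
  track_locallyMonotone _ := isLocallyMonotone_lineMap (vertexPos_edge_ne hpq)
  port_track j := j.elim
  port_smooth _ j := j.elim
  vertex_vertex u v h := by
    have hne := vertexPos_edge_ne hpq
    rcases hV u with rfl | rfl <;> rcases hV v with rfl | rfl
    · rfl
    · exact absurd h hne
    · exact absurd h.symm hne
    · rfl
  vertex_junction _ j := j.elim
  vertex_track v _ _ := (hV v).imp (fun h => congrArg _ h.symm) fun h => congrArg _ h.symm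
  junction_junction j := j.elim
  track_junction _ j := j.elim
  track_track _ _ h := absurd rfl h

theorem isTreeLike_edge : (edge p q).IsTreeLike := by
  have hadj : (edge p q).underlying.Adj (.inl p) (.inl q) := by
    rw [underlying, SimpleGraph.fromEdgeSet_adj]
    exact ⟨⟨(), rfl⟩, fun h => hpq (Sum.inl_injective h)⟩
  have hfin : Finite V :=
    Set.finite_univ_iff.1 (((Set.finite_singleton q).insert p).subset fun v _ => hV v)
  refine isTreeLike_iff_card.2 ⟨fun _ h => ?_, fun _ _ _ => rfl, ?_, ?_⟩
  · exact hpq (Sum.inl_injective (Sym2.mk_isDiag_iff.1 h))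
  · have hreach : ∀ n, (edge p q).underlying.Reachable (.inl p) n := by
      rintro (v | j)
      · rcases hV v with rfl | rfl
        · exact .refl _
        · exact hadj.reachable
      · exact j.elim
    exact (SimpleGraph.connected_iff _).2
      ⟨fun n m => (hreach n).symm.trans (hreach m), ⟨.inl p⟩⟩
  · have h : (Set.univ : Set V) = {p, q} := (Set.eq_univ_of_forall hV).symm
    rw [Nat.card_sum, ← Set.ncard_univ V, h, Set.ncard_pair hpq]
    simp

theorem route_edge (u v : V) : (edge p q).Route u v ↔ u ≠ v := by
  have hA := isTreeLike_edge hpq hV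
  have hroute : (edge p q).Route p q :=
    ⟨⟨(), .inl p, .inl q, Or.inl ⟨rfl, rfl⟩⟩, _, rfl, rfl, .refl⟩
  constructor
  · rintro h rfl
    exact not_route_self hA u h
  · intro h
    rcases hV u with rfl | rfl <;> rcases hV v with rfl | rfl
    · exact absurd rfl h
    · exact hroute
    · exact hroute.symm
    · exact absurd rfl h

end Edge

/-- The drawing that consists of a single vertex. -/
noncomputable def point (V : Type*) : Drawing V Empty Empty where
  vertexPos _ := 0
  junction := Empty.elim
  src := Empty.elim
  tgt := Empty.elim
  track := Empty.elim

theorem isPlanar_point [Subsingleton V] : (point V).IsPlanar where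
  track_locallyMonotone e := e.elim
  port_track j := j.elim
  port_smooth e := e.elim
  vertex_vertex := Function.injective_of_subsingleton _
  vertex_junction _ j := j.elim
  vertex_track _ e := e.elim
  junction_junction j := j.elim
  track_junction e := e.elim
  track_track e := e.elim

theorem isTreeLike_point [Subsingleton V] [Nonempty V] : (point V).IsTreeLike where
  no_loop e := e.elim
  no_parallel e := e.elim
  isTree := by
    have : Subsingleton (V ⊕ Empty) := (Equiv.sumEmpty V Empty).subsingleton
    exact .of_subsingleton

/-- The graph of the routes of a grafted drawing: the new vertex `x` is linked to `y` as the ports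
`b` and `c` are, and if `P` says whether the ports `a` and `c` are linked, then it is linked to the
other neighbours of `y` if and only if `P` holds. -/
theorem route_graft_iff_adj {J E : Type*} [Finite V] [Finite J] [Finite E] {G : SimpleGraph V}
    {x : V} {A : Drawing ↥({x}ᶜ : Set V) J E} {y : ↥({x}ᶜ : Set V)} {l : A.Leg} {g : Junction}
    {a b c : Fin 3} {Y X : Plane} (hA : A.IsTreeLike) (hl : l.source = .inl y)
    (hleaf : ∀ e, A.IsEnd e (.inl y) → e = l.track)
    (hG : ∀ u v, (G.induce {x}ᶜ).Adj u v ↔ A.Route u v) (hab : g.kind.Linked a b)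
    (hac : ∀ z, z ≠ x → z ≠ y → (G.Adj x z ↔ g.kind.Linked a c ∧ G.Adj y z))
    (hbc : G.Adj x y ↔ g.kind.Linked b c) (u v : V) :
    G.Adj u v ↔ (A.graft y g a b c Y X).Route u v := by
  have hB : (A.graft y g a b c Y X).IsTreeLike := isTreeLike_graft hA
  have hold : ∀ (w : ↥({x}ᶜ : Set V)) (s : Bool), w ≠ y →
      (G.Adj w (cond s x y) ↔ (A.graft y g a b c Y X).Route w (cond s x y)) := by
    intro w s hw
    rw [route_graft_leaf hA hl hleaf hw, ← hG, SimpleGraph.comap_adj]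
    cases s
    · exact (and_iff_right hab).symm
    · rw [cond_true, G.adj_comm, hac w w.2 fun h => hw (Subtype.ext h), G.adj_comm]
      rfl
  have hnew : G.Adj y x ↔ (A.graft y g a b c Y X).Route y x := by
    rw [route_graft_new hA hl hleaf, G.adj_comm, hbc]
  have hcomm : ∀ {u v}, (A.graft y g a b c Y X).Route u v ↔ (A.graft y g a b c Y X).Route v u :=
    ⟨Route.symm, Route.symm⟩
  rcases graft_vertex_cases y u with ⟨w, hw, rfl⟩ | ⟨s, rfl⟩ <;>
    rcases graft_vertex_cases y v with ⟨w', hw', rfl⟩ | ⟨s', rfl⟩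
  · rw [route_graft_old hA hl hleaf hw hw', ← hG]
    rfl
  · exact hold w s' hw
  · rw [G.adj_comm, hcomm]
    exact hold w' s hw'
  · cases s <;> cases s'
    · exact iff_of_false (G.loopless.irrefl _) (not_route_self hB _)
    · exact hnew
    · rw [G.adj_comm, hcomm]
      exact hnew
    · exact iff_of_false (G.loopless.irrefl _) (not_route_self hB _)

/-- The choice of the junction and of its ports for a pruning pair: a `Δ`-junction for adjacent
twins, and a `Λ`-junction otherwise, whose head is on the side of the old drawing for non-adjacent
twins, and on the side of `y` for a vertex `x` pendant at `y`. -/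
theorem exists_ports_of_pruningPair [Nontrivial V] {G : SimpleGraph V} (hG : G.Connected)
    {x y : V} (h : G.IsPruningPair univ x y) :
    ∃ (K : JunctionKind) (a b c : Fin 3), a ≠ b ∧ a ≠ c ∧ b ≠ c ∧ K.Linked a b ∧
      (∀ z, z ≠ x → z ≠ y → (G.Adj x z ↔ K.Linked a c ∧ G.Adj y z)) ∧
      (G.Adj x y ↔ K.Linked b c) := by
  obtain ⟨-, -, hxy, htwin | hpend⟩ := h
  · by_cases hadj : G.Adj x y
    · refine ⟨.delta, 0, 1, 2, by decide, by decide, by decide, ?_, fun z h1 h2 => ?_, ?_⟩ <;>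
        simp [JunctionKind.Linked, JunctionKind.Joins, hadj]
      exact htwin z trivial h1 h2
    · refine ⟨.lambda, 0, 1, 2, by decide, by decide, by decide, ?_, fun z h1 h2 => ?_, ?_⟩ <;>
        simp [JunctionKind.Linked, JunctionKind.Joins, hadj]
      exact htwin z trivial h1 h2
  · have hadj : G.Adj x y := by
      obtain ⟨z, hz⟩ := hG.preconnected.exists_adj_of_nontrivial x
      rwa [← hpend z trivial hz]
    refine ⟨.lambda, 1, 0, 2, by decide, by decide, by decide, ?_, fun z h1 h2 => ?_, ?_⟩ <;>
      simp [JunctionKind.Linked, JunctionKind.Joins, hadj]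
    exact fun h => h2 (hpend z trivial h)

universe u

/-- Every distance-hereditary graph with at least two vertices is represented by a drawing in which
all vertices are leaves: a vertex of a pruning pair is deleted, and put back by a graft. -/
theorem exists_drawing (n : ℕ) : ∀ {V : Type u} [Finite V] {G : SimpleGraph V},
    IsDistanceHereditary G → Nat.card V = n + 2 →
    ∃ (J E : Type) (_ : Finite J) (_ : Finite E) (A : Drawing V J E),
      A.IsPlanar ∧ A.IsTreeLike ∧ A.IsStraight ∧ ∀ u v, G.Adj u v ↔ A.Route u v := by
  induction n with
  | zero =>
    intro V _ G hG hV
    obtain ⟨p, q, hpq, huniv⟩ := Nat.card_eq_two_iff.1 hV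
    have hV : ∀ v, v = p ∨ v = q := fun v => huniv.ge (mem_univ v)
    refine ⟨Empty, Unit, inferInstance, inferInstance, edge p q, isPlanar_edge hpq hV,
      isTreeLike_edge hpq hV, isStraight_edge hV, fun u v => ?_⟩
    rw [route_edge hpq hV]
    refine ⟨SimpleGraph.Adj.ne, fun h => ?_⟩
    have : Nontrivial V := ⟨p, q, hpq⟩
    obtain ⟨w, hw⟩ := hG.1.preconnected.exists_adj_of_nontrivial u
    have hwv : w = v := by
      have := hw.ne
      rcases hV u with rfl | rfl <;> rcases hV v with rfl | rfl <;> rcases hV w with rfl | rfl <;>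
        first | rfl | contradiction
    exact hwv ▸ hw
  | succ n ih =>
    intro V _ G hG hV
    have : Nontrivial V := Finite.one_lt_card_iff_nontrivial.1 (by omega)
    obtain ⟨x, y, hxy⟩ := hG.exists_pruningPair
    have hcard : Nat.card ↥({x}ᶜ : Set V) = n + 2 := by
      have h := Set.ncard_add_ncard_compl ({x} : Set V)
      rw [Set.ncard_singleton] at h
      rw [Nat.card_coe_set_eq]
      omega
    obtain ⟨J, E, _, _, A, hP, hA, hS, hroute⟩ := ih (hG.induce_compl hxy) hcard
    obtain ⟨e, he, -⟩ := hS.leaf ⟨y, hxy.2.2.1.symm⟩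
    obtain ⟨l, -, hl⟩ := exists_leg he
    obtain ⟨K, a, b, c, hab, hac, hbc, h1, h2, h3⟩ := exists_ports_of_pruningPair hG.1 hxy
    obtain ⟨g, Y, X, B, rfl, hg⟩ := exists_isGraftable hS hl hP K hab hac hbc
    exact ⟨Option J, E ⊕ Bool, inferInstance, inferInstance, A.graft _ g a b c Y X,
      isPlanar_graft hS hl hA hP hg, isTreeLike_graft hA, isStraight_graft hS,
      route_graft_iff_adj hA hl (fun e he => leaf_track hS hl he) hroute h1 h2 h3⟩

end Drawing

theorem theorem2 {V : Type*} [Finite V] (G : SimpleGraph V) :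
    IsDistanceHereditary G ↔ IsDeltaConfluent G := by
  constructor
  · intro hG
    have := hG.1.nonempty
    rcases subsingleton_or_nontrivial V with _ | _
    · refine ⟨Empty, Empty, inferInstance, inferInstance, .point V, Drawing.isPlanar_point,
        Drawing.isTreeLike_point, ?_⟩
      rw [Drawing.represents_iff Drawing.isPlanar_point Drawing.isTreeLike_point]
      intro u v
      obtain rfl := Subsingleton.elim u v
      exact iff_of_false (G.loopless.irrefl _) (Drawing.not_route_self Drawing.isTreeLike_point _)
    · have hV : 1 < Nat.card V := Finite.one_lt_card
      obtain ⟨n, hn⟩ := Nat.exists_eq_add_of_le hV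
      obtain ⟨J, E, hJ, hE, A, hP, hA, -, hroute⟩ :=
        Drawing.exists_drawing n hG (hn.trans (by omega))
      exact ⟨J, E, hJ, hE, A, hP, hA, (Drawing.represents_iff hP hA G).2 hroute⟩
  · rintro ⟨J, E, _, _, A, hP, hA, hG⟩
    exact Drawing.isDistanceHereditary_of_route hP hA ((Drawing.represents_iff hP hA G).1 hG)
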